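/- Let $r>0$ and let $\mathbb S^2_r\subset\mathbb R^3$ be the sphere of radius $r$ with surface measure $ds=r^2\sin\theta\,d\theta\,d\phi$ in spherical coordinates $(\theta,\phi)\in(0,\pi)\times(0,2\pi)$. Let $\Delta_h$ be its Laplace–Beltrami operator. It has the spherical harmonics $Y_{lm}(\cdot/r)$, $l\ge 0$, $|m|\le l$, as eigenfunctions, with $-\Delta_hY_{lm}=\frac{l(l+1)}{r^2}Y_{lm}$. For $s\ge 0$ let $H^s(\mathbb S^2_r)$ be the domain of $(I-\Delta_h)^{s/2}$ in the complex space $L^2(\mathbb S^2_r)$, with $\|f\|_{H^s}=\|(I-\Delta_h)^{s/2}f\|_{L^2}$. Let $H^s_\diamond(\mathbb S^2_r)=\{f\in H^s(\mathbb S^2_r):\int f\,ds=0\}$ with the norm $\|f\|_{H^s_\diamond}=\|(-\Delta_h)^{s/2}f\|_{L^2}$, and let $H^{-s}_\diamond(\mathbb S^2_r)$ be the space of bounded conjugate-linear functionals on $H^s_\diamond(\mathbb S^2_r)$. Let $C_{H^s_\diamond\to L^p}$ denote the least constant $C$ with $\|f\|_{L^p}\le C\|f\|_{H^s_\diamond}$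 for all $f\in H^s_\diamond(\mathbb S^2_r)$. Let $\gamma>0$ and $\omega,\Omega_{\mathrm{ref}}\in\mathbb R$, and let $\Omega=\Omega(\theta)$ be a real-valued function in $H^1(\mathbb S^2_r)$ that does not depend on $\phi$, i.e. $\Omega\in H^1(\mathbb S^2_r;m=0)$. Put $$\beta_\Omega=\Omega-\Omega_{\mathrm{ref}},\qquad \alpha_\Omega=\frac1{r^2\sin\theta}\frac{d}{d\theta}\Big(\frac1{\sin\theta}\frac{d}{d\theta}\big(\Omega\sin^2\theta\big)\Big),$$ where $\alpha_\Omega$ is understood as a distribution. That is, for finite linear combinations $\Psi,\psi$ of the $Y_{lm}$ with $l\ge1$, and $h=\frac{\partial\Psi}{\partial\phi}\,\overline{\psi}$, $$\Big\langle\alpha_\Omega\frac{\partial\Psi}{\partial\phi},\psi\Big\rangle=\int_0^{2\pi}\!\!\int_0^\pi \Omega\,\sin^2\theta\;\frac{\partial}{\partial\theta}\Big(\frac1{\sin\theta}\frac{\partial h}{\partial\theta}\Big)\,d\theta\,d\phi .$$ Then the differential operator $$\mathbf B\Psi=\gamma\Delta_h^2\Psi+i\omega\Delta_h\Psi-\beta_\Omega\,\Delta_h\frac{\partial\Psi}{\partial\phi}+\alpha_\Omega\frac{\partial\Psi}{\partial\phi},$$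 defined on finite linear combinations of the $Y_{lm}$, $l\ge1$, through the pairing $\langle\mathbf B\Psi,\psi\rangle$ with such combinations $\psi$, has a unique extension to a bounded linear operator $\mathbf B:H^2_\diamond(\mathbb S^2_r)\to H^{-2}_\diamond(\mathbb S^2_r)$, and 1. $\mathbf B$ is a Fredholm operator of index $0$; 2. $\mathbf B$ is boundedly invertible whenever $$|\omega|>\frac{4}{\gamma^3}\big(C_{H^1_\diamond\to L^6}\,C_{H^{1/2}_\diamond\to L^3}\big)^4\big(\|\Omega-\Omega_{\mathrm{ref}}\|_{H^1}^2+9\|\Omega\|_{H^1}^2\big)^2 .$$ -/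

import Mathlib

open MeasureTheory Polynomial
open scoped NNReal ENNReal

noncomputable section

namespace InertialWave

/-! ### The sphere of radius `r` in spherical coordinates

A function on the sphere of radius `r` is identified with its counterpart in the spherical
coordinates `(θ, φ) ∈ (0, π) × (0, 2π)` (polar and azimuthal angle); the surface measure is
`ds = r² sin θ dθ dφ`. -/

/-- The coordinate domain `(0, π) × (0, 2π)`. -/
def coordDomain : Set (ℝ × ℝ) := Set.Ioo 0 Real.pi ×ˢ Set.Ioo 0 (2 * Real.pi)

/-- The surface measure `r² sin θ dθ dφ` of the sphere of radius `r`. -/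
def sphereMeasure (r : ℝ) : Measure (ℝ × ℝ) :=
  (volume.restrict coordDomain).withDensity fun p => ENNReal.ofReal (r ^ 2 * Real.sin p.1)

/-- The partial derivative `∂/∂θ`. -/
def dTheta (f : ℝ × ℝ → ℂ) (p : ℝ × ℝ) : ℂ := deriv (fun t : ℝ => f (t, p.2)) p.1

/-- The partial derivative `∂/∂φ`. -/
def dPhi (f : ℝ × ℝ → ℂ) (p : ℝ × ℝ) : ℂ := deriv (fun t : ℝ => f (p.1, t)) p.2

/-- The Laplace-Beltrami operator `Δ_h` of the sphere of radius `r`,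
`Δ_h f = (r² sin θ)⁻¹ ∂_θ (sin θ ∂_θ f) + (r² sin² θ)⁻¹ ∂_φ² f`. -/
def laplaceBeltrami (r : ℝ) (f : ℝ × ℝ → ℂ) (p : ℝ × ℝ) : ℂ :=
  1 / ((r ^ 2 * Real.sin p.1 : ℝ) : ℂ)
      * dTheta (fun q => (Real.sin q.1 : ℂ) * dTheta f q) p
    + 1 / ((r ^ 2 * Real.sin p.1 ^ 2 : ℝ) : ℂ) * dPhi (dPhi f) p

/-! ### Spherical harmonics -/

/-- The indices `(l, m)` with `|m| ≤ l`. -/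
abbrev HarmonicIndex : Type := {i : ℕ × ℤ // i.2.natAbs ≤ i.1}

/-- The spherical harmonic `Y_{lm}`, normalized in `L²` of the unit sphere:
`√((2l+1)/(4π) · (l-|m|)!/(l+|m|)!) (sin θ)^{|m|} P_l^{(|m|)}(cos θ) e^{imφ}`, where
`P_l = (2^l l!)⁻¹ (d/dx)^l (x²-1)^l` is the Legendre polynomial. -/
def sphericalHarmonic (i : HarmonicIndex) (p : ℝ × ℝ) : ℂ :=
  ((Real.sqrt ((2 * i.1.1 + 1) / (4 * Real.pi)
        * ((i.1.1 - i.1.2.natAbs).factorial / (i.1.1 + i.1.2.natAbs).factorial))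
      * Real.sin p.1 ^ i.1.2.natAbs
      * ((derivative^[i.1.1 + i.1.2.natAbs] ((X ^ 2 - 1 : ℝ[X]) ^ i.1.1)).eval (Real.cos p.1)
          / (2 ^ i.1.1 * i.1.1.factorial)) : ℝ) : ℂ)
    * Complex.exp (Complex.I * i.1.2 * p.2)

/-- The eigenvalue `l(l+1)/r²` of `-Δ_h` to which `Y_{lm}` belongs. -/
def eigenvalue (r : ℝ) (i : HarmonicIndex) : ℝ := (i.1.1 : ℝ) * (i.1.1 + 1) / r ^ 2

/-- The Fourier coefficient of `f` with respect to the orthonormal system `Y_{lm} / r` of `L²` of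
the sphere of radius `r`. -/
def harmonicCoeff (r : ℝ) (f : ℝ × ℝ → ℂ) (i : HarmonicIndex) : ℂ :=
  ∫ p, starRingEnd ℂ (sphericalHarmonic i p / r) * f p ∂(sphereMeasure r)

/-! ### The Sobolev spaces `H^s`: the Hilbert scale generated by `(I - Δ_h)^{1/2}` -/

/-- `f ∈ H^s`, that is, `f` lies in `L²` and in the domain of `(I - Δ_h)^{s/2}`. -/
def MemSobolev (r : ℝ) (s : ℝ≥0) (f : ℝ × ℝ → ℂ) : Prop :=
  MemLp f 2 (sphereMeasure r) ∧
    Summable fun i => (1 + eigenvalue r i) ^ (s : ℝ) * ‖harmonicCoeff r f i‖ ^ 2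

/-- The norm `‖f‖_{H^s} = ‖(I - Δ_h)^{s/2} f‖_{L²}`. -/
def sobolevNorm (r : ℝ) (s : ℝ≥0) (f : ℝ × ℝ → ℂ) : ℝ :=
  Real.sqrt (∑' i, (1 + eigenvalue r i) ^ (s : ℝ) * ‖harmonicCoeff r f i‖ ^ 2)

/-- The function on the sphere (independent of `φ`, that is, of azimuthal order `m = 0`) given by a
real profile of the polar angle. -/
def zonal (Ω : ℝ → ℝ) (p : ℝ × ℝ) : ℂ := (Ω p.1 : ℂ)

/-! ### Basic facts needed to define the mean-zero spaces -/

lemma eigenvalue_nonneg (r : ℝ) (i : HarmonicIndex) : 0 ≤ eigenvalue r i := by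
  unfold eigenvalue; positivity

lemma continuous_sphericalHarmonic (i : HarmonicIndex) : Continuous (sphericalHarmonic i) := by
  unfold sphericalHarmonic
  refine Continuous.mul (Complex.continuous_ofReal.comp ?_) (by fun_prop)
  refine Continuous.mul (by fun_prop) (Continuous.div_const ?_ _)
  exact (Polynomial.continuous _).comp (by fun_prop)

instance (r : ℝ) : IsFiniteMeasure (sphereMeasure r) := by
  unfold sphereMeasure
  have hfin : volume coordDomain < ∞ := by
    unfold coordDomain
    rw [Measure.volume_eq_prod, Measure.prod_prod, Real.volume_Ioo, Real.volume_Ioo]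
    exact ENNReal.mul_lt_top ENNReal.ofReal_lt_top ENNReal.ofReal_lt_top
  refine isFiniteMeasure_withDensity (ne_of_lt ?_)
  calc ∫⁻ p in coordDomain, ENNReal.ofReal (r ^ 2 * Real.sin p.1)
      ≤ ∫⁻ _ in coordDomain, ENNReal.ofReal (r ^ 2) := by
        refine lintegral_mono fun p => ENNReal.ofReal_le_ofReal ?_
        nlinarith [Real.sin_le_one p.1, sq_nonneg r]
    _ < ∞ := by
        rw [setLIntegral_const]
        exact ENNReal.mul_lt_top ENNReal.ofReal_lt_top hfin

lemma ae_mem_coordDomain (r : ℝ) : ∀ᵐ p ∂(sphereMeasure r), p ∈ coordDomain := by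
  have h : ∀ᵐ p ∂(volume.restrict coordDomain), p ∈ coordDomain :=
    ae_restrict_mem (measurableSet_Ioo.prod measurableSet_Ioo)
  exact (withDensity_absolutelyContinuous _ _).ae_le h

lemma integrable_harmonic_mul (r : ℝ) {f : ℝ × ℝ → ℂ} (hf : MemLp f 2 (sphereMeasure r))
    (i : HarmonicIndex) :
    Integrable (fun p => starRingEnd ℂ (sphericalHarmonic i p / r) * f p) (sphereMeasure r) := by
  have hc : Continuous fun p => starRingEnd ℂ (sphericalHarmonic i p / r) :=
    Complex.continuous_conj.comp ((continuous_sphericalHarmonic i).div_const _)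
  obtain ⟨C, hC⟩ := (isCompact_Icc.prod isCompact_Icc :
    IsCompact (Set.Icc 0 Real.pi ×ˢ Set.Icc 0 (2 * Real.pi))).exists_bound_of_continuousOn
      hc.continuousOn
  refine (hf.integrable (by norm_num)).bdd_mul hc.aestronglyMeasurable (c := C) ?_
  filter_upwards [ae_mem_coordDomain r] with p hp
  exact hC p ⟨Set.Ioo_subset_Icc_self hp.1, Set.Ioo_subset_Icc_self hp.2⟩

lemma harmonicCoeff_congr (r : ℝ) {f g : ℝ × ℝ → ℂ} (h : f =ᵐ[sphereMeasure r] g)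
    (i : HarmonicIndex) : harmonicCoeff r f i = harmonicCoeff r g i := by
  refine integral_congr_ae ?_
  filter_upwards [h] with p hp
  rw [hp]

lemma harmonicCoeff_add (r : ℝ) (f g : Lp ℂ 2 (sphereMeasure r)) (i : HarmonicIndex) :
    harmonicCoeff r (f + g : Lp ℂ 2 (sphereMeasure r)) i
      = harmonicCoeff r f i + harmonicCoeff r g i := by
  rw [harmonicCoeff_congr r (Lp.coeFn_add f g)]
  unfold harmonicCoeff
  rw [← integral_add (integrable_harmonic_mul r (Lp.memLp f) i)
    (integrable_harmonic_mul r (Lp.memLp g) i)]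
  simp [mul_add]

lemma harmonicCoeff_smul (r : ℝ) (c : ℂ) (f : Lp ℂ 2 (sphereMeasure r)) (i : HarmonicIndex) :
    harmonicCoeff r (c • f : Lp ℂ 2 (sphereMeasure r)) i = c * harmonicCoeff r f i := by
  rw [harmonicCoeff_congr r (Lp.coeFn_smul c f)]
  unfold harmonicCoeff
  rw [← integral_const_mul]
  congr 1; ext p
  simp only [Pi.smul_apply, smul_eq_mul]; ring

/-! ### The mean-zero spaces `H^s_⋄` and their duals -/

/-- `H^s_⋄ = {f ∈ H^s : ⟨f, 1⟩ = 0}` as a subspace of `L²`. -/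
def diamondSubmodule (r : ℝ) (s : ℝ≥0) : Submodule ℂ (Lp ℂ 2 (sphereMeasure r)) where
  carrier := {f | MemSobolev r s f ∧ ∫ p, f p ∂(sphereMeasure r) = 0}
  zero_mem' := by
    have h : ∀ i, harmonicCoeff r (0 : Lp ℂ 2 (sphereMeasure r)) i = 0 := fun i => by
      simpa using harmonicCoeff_smul r 0 0 i
    refine ⟨⟨Lp.memLp _, ?_⟩, ?_⟩
    · simp only [h]; simp
    · rw [integral_congr_ae (Lp.coeFn_zero ℂ 2 (sphereMeasure r))]; simp
  add_mem' := by
    rintro f g ⟨⟨-, hf⟩, hf0⟩ ⟨⟨-, hg⟩, hg0⟩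
    refine ⟨⟨Lp.memLp _, ?_⟩, ?_⟩
    · refine Summable.of_nonneg_of_le (fun i => ?_) (fun i => ?_) ((hf.add hg).mul_left 2)
      · have := eigenvalue_nonneg r i; positivity
      · have h1 := eigenvalue_nonneg r i
        have h2 : (0 : ℝ) ≤ (1 + eigenvalue r i) ^ (s : ℝ) := by positivity
        rw [harmonicCoeff_add]
        have h3 := norm_add_le (harmonicCoeff r f i) (harmonicCoeff r g i)
        have h4 : ‖harmonicCoeff r f i + harmonicCoeff r g i‖ ^ 2
            ≤ 2 * (‖harmonicCoeff r f i‖ ^ 2 + ‖harmonicCoeff r g i‖ ^ 2) := by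
          nlinarith [norm_nonneg (harmonicCoeff r f i + harmonicCoeff r g i),
            sq_nonneg (‖harmonicCoeff r f i‖ - ‖harmonicCoeff r g i‖)]
        calc _ ≤ (1 + eigenvalue r i) ^ (s : ℝ)
              * (2 * (‖harmonicCoeff r f i‖ ^ 2 + ‖harmonicCoeff r g i‖ ^ 2)) := by gcongr
          _ = _ := by ring
    · rw [integral_congr_ae (Lp.coeFn_add f g)]
      simp only [Pi.add_apply]
      rw [integral_add ((Lp.memLp f).integrable (by norm_num))
        ((Lp.memLp g).integrable (by norm_num)), hf0, hg0, add_zero]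
  smul_mem' := by
    rintro c f ⟨⟨-, hf⟩, hf0⟩
    refine ⟨⟨Lp.memLp _, ?_⟩, ?_⟩
    · refine (hf.mul_left (‖c‖ ^ 2)).congr fun i => ?_
      rw [harmonicCoeff_smul, norm_mul]; ring
    · rw [integral_congr_ae (Lp.coeFn_smul c f)]
      simp only [Pi.smul_apply, smul_eq_mul]
      rw [integral_const_mul, hf0, mul_zero]

/-- The space `H^s_⋄` of mean-zero functions of Sobolev order `s ≥ 0`. -/
def HDiamond (r : ℝ) (s : ℝ≥0) : Type := diamondSubmodule r s

instance (r : ℝ) (s : ℝ≥0) : AddCommGroup (HDiamond r s) :=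
  inferInstanceAs (AddCommGroup (diamondSubmodule r s))

instance (r : ℝ) (s : ℝ≥0) : Module ℂ (HDiamond r s) :=
  inferInstanceAs (Module ℂ (diamondSubmodule r s))

/-- An element of `H^s_⋄` as a function (an almost everywhere representative). -/
def HDiamond.toFun {r : ℝ} {s : ℝ≥0} (f : HDiamond r s) : ℝ × ℝ → ℂ :=
  (f.1 : Lp ℂ 2 (sphereMeasure r))

lemma memℓp_diamond (r : ℝ) (s : ℝ≥0) (f : HDiamond r s) :
    Memℓp (fun i => ((eigenvalue r i ^ ((s : ℝ) / 2) : ℝ) : ℂ) * harmonicCoeff r f.toFun i) 2 := by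
  refine memℓp_gen ?_
  refine Summable.of_nonneg_of_le (fun i => by positivity) (fun i => ?_) f.2.1.2
  have h1 := eigenvalue_nonneg r i
  have h2 : (0 : ℝ) ≤ eigenvalue r i ^ ((s : ℝ) / 2) := by positivity
  have h3 : (eigenvalue r i ^ ((s : ℝ) / 2)) ^ 2 = eigenvalue r i ^ (s : ℝ) := by
    rw [← Real.rpow_natCast, ← Real.rpow_mul h1]; norm_num
  have h4 : eigenvalue r i ^ (s : ℝ) ≤ (1 + eigenvalue r i) ^ (s : ℝ) :=
    Real.rpow_le_rpow h1 (by linarith) s.2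
  simp only [ENNReal.toReal_ofNat, Real.rpow_ofNat, norm_mul, Complex.norm_real,
    Real.norm_of_nonneg h2, mul_pow, h3]
  exact mul_le_mul_of_nonneg_right h4 (by positivity)

/-- The linear map `f ↦ (λ_l^{s/2} f_{lm})`, that is, `(-Δ_h)^{s/2} f` in coordinates. -/
def diamondMap (r : ℝ) (s : ℝ≥0) : HDiamond r s →ₗ[ℂ] lp (fun _ : HarmonicIndex => ℂ) 2 where
  toFun f := ⟨_, memℓp_diamond r s f⟩
  map_add' f g := by
    ext i
    change _ * harmonicCoeff r (f.1 + g.1 : Lp ℂ 2 (sphereMeasure r)) i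
      = _ * harmonicCoeff r f.1 i + _ * harmonicCoeff r g.1 i
    rw [harmonicCoeff_add]; ring
  map_smul' c f := by
    ext i
    change _ * harmonicCoeff r (c • f.1 : Lp ℂ 2 (sphereMeasure r)) i
      = c * (_ * harmonicCoeff r f.1 i)
    rw [harmonicCoeff_smul]; ring

/-- The norm `‖f‖_{H^s_⋄} = ‖(-Δ_h)^{s/2} f‖_{L²}`. -/
instance (r : ℝ) (s : ℝ≥0) : SeminormedAddCommGroup (HDiamond r s) :=
  SeminormedAddCommGroup.induced (HDiamond r s) (lp (fun _ : HarmonicIndex => ℂ) 2)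
    (diamondMap r s)

instance (r : ℝ) (s : ℝ≥0) : NormedSpace ℂ (HDiamond r s) :=
  NormedSpace.induced ℂ (HDiamond r s) (lp (fun _ : HarmonicIndex => ℂ) 2) (diamondMap r s)

/-- The norm of `H^s_⋄` written out: `‖f‖² = ∑_{lm} λ_l^s |f_{lm}|²`. -/
lemma norm_sq_eq (r : ℝ) (s : ℝ≥0) (f : HDiamond r s) :
    ‖f‖ ^ 2 = ∑' i, eigenvalue r i ^ (s : ℝ) * ‖harmonicCoeff r f.toFun i‖ ^ 2 := by
  have h := lp.norm_rpow_eq_tsum (p := 2) (by norm_num) (diamondMap r s f)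
  simp only [ENNReal.toReal_ofNat, Real.rpow_ofNat] at h
  change ‖diamondMap r s f‖ ^ 2 = _
  rw [h]
  refine tsum_congr fun i => ?_
  have h1 := eigenvalue_nonneg r i
  have h2 : (0 : ℝ) ≤ eigenvalue r i ^ ((s : ℝ) / 2) := by positivity
  have h3 : (eigenvalue r i ^ ((s : ℝ) / 2)) ^ 2 = eigenvalue r i ^ (s : ℝ) := by
    rw [← Real.rpow_natCast, ← Real.rpow_mul h1]; norm_num
  change ‖((eigenvalue r i ^ ((s : ℝ) / 2) : ℝ) : ℂ) * harmonicCoeff r f.toFun i‖ ^ 2 = _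
  rw [norm_mul, Complex.norm_real, Real.norm_of_nonneg h2, mul_pow, h3]

/-- The dual space `H^{-s}_⋄ = (H^s_⋄)'` of bounded conjugate-linear functionals, so that the
duality pairing `⟨F, ψ⟩` is linear in `F` and conjugate-linear in `ψ`, like the `L²` inner
product of the functions it extends. -/
abbrev HDiamondDual (r : ℝ) (s : ℝ≥0) : Type := HDiamond r s →SL[starRingEnd ℂ] ℂ

/-- The embedding constant `C_{H^s_⋄ → L^p}`: the least `C ∈ [0, ∞]` such that
`‖f‖_{L^p} ≤ C ‖f‖_{H^s_⋄}` for all `f ∈ H^s_⋄`. -/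
def embeddingConst (r : ℝ) (s : ℝ≥0) (p : ℝ≥0∞) : ℝ≥0∞ :=
  sInf {C | ∀ f : HDiamond r s, eLpNorm f.toFun p (sphereMeasure r) ≤ C * ‖f‖ₑ}

/-! ### The operator `B = γ Δ_h² + iω Δ_h - β_Ω Δ_h ∂_φ + α_Ω ∂_φ` -/

/-- The finite linear combinations of the spherical harmonics `Y_{lm}` with `l ≥ 1`: a dense space
of smooth mean-zero functions. -/
def harmonicSpan : Submodule ℂ (ℝ × ℝ → ℂ) :=
  Submodule.span ℂ (sphericalHarmonic '' {i | 1 ≤ i.1.1})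

/-- The coefficient `α_Ω = (r² sin θ)⁻¹ d/dθ ((sin θ)⁻¹ d/dθ (Ω sin² θ))` as a distribution: its
pairing `∫ α_Ω h ds` with a smooth function `h`. Since `ds = r² sin θ dθ dφ`, moving both
derivatives to `h` gives `∫∫ Ω sin² θ ∂_θ ((sin θ)⁻¹ ∂_θ h) dθ dφ`; there are no boundary terms
when the azimuthal mean of `h` vanishes at the poles, as it does for `h = (∂_φ f) g̅`. -/
def alphaPairing (Ω : ℝ → ℝ) (h : ℝ × ℝ → ℂ) : ℂ :=
  ∫ p in coordDomain, ((Ω p.1 * Real.sin p.1 ^ 2 : ℝ) : ℂ)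
    * dTheta (fun q => 1 / (Real.sin q.1 : ℂ) * dTheta h q) p

/-- The pairing `⟨B f, g⟩` of smooth functions `f`, `g`, where `β_Ω = Ω - Ω_ref`. -/
def inertialPairing (r γ ω Ωref : ℝ) (Ω : ℝ → ℝ) (f g : ℝ × ℝ → ℂ) : ℂ :=
  (∫ p, ((γ : ℂ) * laplaceBeltrami r (laplaceBeltrami r f) p
        + Complex.I * ω * laplaceBeltrami r f p
        - ((Ω p.1 - Ωref : ℝ) : ℂ) * laplaceBeltrami r (dPhi f) p)
      * starRingEnd ℂ (g p) ∂(sphereMeasure r))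
    + alphaPairing Ω (fun p => dPhi f p * starRingEnd ℂ (g p))

/-- The bounded operator `B : H²_⋄ → H^{-2}_⋄` is the (continuous extension of the) differential
operator `γ Δ_h² + iω Δ_h - β_Ω Δ_h ∂_φ + α_Ω ∂_φ`: on the dense space of finite linear
combinations of spherical harmonics, `⟨B Ψ, ψ⟩` is given by that differential expression. -/
def IsInertialOperator (r γ ω Ωref : ℝ) (Ω : ℝ → ℝ)
    (B : HDiamond r 2 →L[ℂ] HDiamondDual r 2) : Prop :=
  ∀ f ∈ harmonicSpan, ∀ g ∈ harmonicSpan, ∀ Ψ ψ : HDiamond r 2,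
    Ψ.toFun =ᵐ[sphereMeasure r] f → ψ.toFun =ᵐ[sphereMeasure r] g →
      B Ψ ψ = inertialPairing r γ ω Ωref Ω f g

end InertialWave

end

/-! Both rotation terms are of lower order than the viscous term, and weighted L² norms of β = Ω -
Ω_ref and of Ω suffice to show it. Sending Ψ to the coefficients of -Δ_h Ψ identifies H²_⋄
isometrically with ℓ² (`coeffEquiv`, which rests on the completeness of the spherical harmonics). In
these coordinates ⟨BΨ, Ψ⟩ is γ‖Δ_h Ψ‖² - iω‖(-Δ_h)^{1/2} Ψ‖² plus a form S(Ψ) that carries β and α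
and splits over the azimuthal orders m.

Write a = r‖Ψ‖_{H²_⋄} and n = ‖(-Δ_h)^{1/2} Ψ‖, and let ‖·‖ be the norm of L²((0, π), sin θ dθ). The
heart of the proof is the pair of bounds |Re S| ≤ K a √(an) and |Im S| ≤ K' a √(an), with K = ‖β‖/√2
and K' = K + 12.1 ‖Ω‖ (`abs_re_skewForm_le`, `abs_im_skewForm_le`). The α-term is i·m times a real
symmetric form, so it is absent from the real part. The β-term needs only a pointwise bound of a
mode by its gradient norm. In the α-term both derivatives are moved off Ω; what remains is
controlled by an L⁴ bound of the gradient of a mode (`IsModeLaplacian.integral_gradSq_sq_le`),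
obtained from one-dimensional multiplier identities. In each order the factor m is absorbed by
m(m+1) ≤ l(l+1).

Fredholm property: a √(an) ≤ δa² + n²/δ³, and n² is a compact form on H²_⋄ because the eigenvalues
tend to infinity. Adding a multiple of a projection onto finitely many harmonics therefore makes the
operator coercive, hence an isomorphism. A finite rank perturbation of an isomorphism has index 0
(`exists_equiv_sub_finProj`, `isFredholm_of_eq_sub`). The same a priori bounds give boundedness
through polarization (`exists_operator`).

Invertibility: for Ψ ≠ 0 in the kernel, the real part gives γa² ≤ K r² a √(an) and the imaginary
part gives |ω|n² ≤ K' a √(an). Eliminating a yields |ω|γ³ ≤ r⁶ K' K³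
(`abs_mul_pow_le_of_form_bounds`). The assumed frequency bound excludes this: the embedding
constants are bounded from below by explicit zonal test functions (`exists_le_embeddingConst_mul`),
and the rest is an elementary inequality in ‖β‖ and ‖Ω‖ (`form_const_le`). No Sobolev embedding has
to be proved. With trivial kernel and index 0 the operator is bijective. -/

noncomputable section

namespace InertialWave

/-! ### Associated Legendre functions -/

/-- The unnormalized derivatives `(d/dx)^n (x² - 1)^l`. -/
def rodrigues (l n : ℕ) : ℝ[X] := derivative^[n] ((X ^ 2 - 1 : ℝ[X]) ^ l)

lemma derivative_rodrigues (l n : ℕ) : derivative (rodrigues l n) = rodrigues l (n + 1) := by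
  simp [rodrigues, Function.iterate_succ_apply']

/-- The power u = (x² - 1)^l satisfies (x² - 1)u' = 2l x u. One differentiation gives the case n =
0, and each further differentiation is one induction step. -/
lemma rodrigues_ode_aux (l n : ℕ) :
    (X ^ 2 - 1) * rodrigues l (n + 2) + C (2 * (n + 1) - 2 * l : ℝ) * X * rodrigues l (n + 1)
      + C ((n + 1) * (n - 2 * l) : ℝ) * rodrigues l n = 0 := by
  induction n with
  | zero =>
    have h : (X ^ 2 - 1) * rodrigues l 1 = C (2 * l : ℝ) * X * rodrigues l 0 := by
      rcases l with _ | l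
      · simp [rodrigues]
      · simp only [rodrigues, Function.iterate_one, Function.iterate_zero, id, derivative_pow,
          derivative_sub, derivative_one]
        simp
        ring
    have h2 := congrArg derivative h
    simp only [derivative_mul, derivative_rodrigues, derivative_sub, derivative_X_pow,
      derivative_one, derivative_C, derivative_X] at h2
    simp only [map_sub, map_mul, map_natCast, map_ofNat, map_one, map_zero,
      Nat.cast_zero, zero_add] at h2 ⊢
    simp at h2 ⊢
    linear_combination h2
  | succ n ih =>
    have h2 := congrArg derivative ih
    simp only [derivative_mul, derivative_rodrigues, derivative_sub, derivative_X_pow,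
      derivative_one, derivative_C, derivative_X, derivative_add, derivative_zero] at h2
    simp only [map_sub, map_mul, map_add, map_natCast, map_ofNat, map_one,
      Nat.cast_add, Nat.cast_one] at h2 ⊢
    simp at h2 ⊢
    linear_combination h2

/-- The associated Legendre equation for the `m`-th derivative of the Legendre polynomial. -/
lemma rodrigues_ode (l m : ℕ) (x : ℝ) :
    (1 - x ^ 2) * (rodrigues l (l + m + 2)).eval x
      = 2 * (m + 1) * x * (rodrigues l (l + m + 1)).eval x
        - (l - m) * (l + m + 1) * (rodrigues l (l + m)).eval x := by
  have h := congrArg (eval x) (rodrigues_ode_aux l (l + m))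
  simp at h
  linear_combination -h

/-- The function `sin^m θ p(cos θ)`. -/
def polar (m : ℕ) (p : ℝ[X]) (θ : ℝ) : ℝ := Real.sin θ ^ m * p.eval (Real.cos θ)

lemma contDiff_polar (m : ℕ) (p : ℝ[X]) {n : WithTop ℕ∞} : ContDiff ℝ n (polar m p) := by
  unfold polar
  exact (Real.contDiff_sin.pow m).mul (((p.contDiff_aeval n)).comp Real.contDiff_cos)

lemma hasDerivAt_eval_cos (p : ℝ[X]) (θ : ℝ) :
    HasDerivAt (fun t => p.eval (Real.cos t)) (-(Real.sin θ * p.derivative.eval (Real.cos θ))) θ := by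
  have := (p.hasDerivAt (Real.cos θ)).comp θ (Real.hasDerivAt_cos θ)
  refine this.congr_deriv ?_
  ring

lemma hasDerivAt_sin_pow (m : ℕ) (θ : ℝ) :
    HasDerivAt (fun t => Real.sin t ^ m) (m * Real.sin θ ^ (m - 1) * Real.cos θ) θ := by
  simpa using (Real.hasDerivAt_sin θ).fun_pow m

/-- The factor m makes the truncated exponent m - 1 harmless at m = 0. -/
lemma natCast_mul_pow_pred (m : ℕ) (x : ℝ) : x * (m * x ^ (m - 1)) = m * x ^ m := by
  rcases m with _ | m
  · simp
  · simp [pow_succ]; ring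

/-- The factor sin θ keeps the result inside the functions `polar`, up to a factor cos θ, so that no
negative power of sin θ occurs at the poles. -/
lemma sin_mul_deriv_polar (m : ℕ) (p : ℝ[X]) (θ : ℝ) :
    Real.sin θ * deriv (polar m p) θ = m * (Real.cos θ * polar m p θ)
      - polar (m + 2) p.derivative θ := by
  have h := (hasDerivAt_sin_pow m θ).mul (hasDerivAt_eval_cos p θ)
  have h2 : deriv (polar m p) θ = _ := h.deriv
  rw [h2]
  simp only [polar]
  have := natCast_mul_pow_pred m (Real.sin θ)
  linear_combination (Real.cos θ * p.eval (Real.cos θ)) * this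

lemma hasDerivAt_polar (m : ℕ) (p : ℝ[X]) (θ : ℝ) :
    HasDerivAt (polar m p) (deriv (polar m p) θ) θ :=
  ((contDiff_polar m p (n := 1)).differentiable (by norm_num)).differentiableAt.hasDerivAt

/-- The normalized associated Legendre function: `Y_{lm} = legendre l |m| (θ) e^{imφ}`. -/
def legendre (l m : ℕ) (θ : ℝ) : ℝ :=
  Real.sqrt ((2 * l + 1) / (4 * Real.pi) * ((l - m).factorial / (l + m).factorial))
    / (2 ^ l * l.factorial) * polar m (rodrigues l (l + m)) θ

lemma contDiff_legendre (l m : ℕ) {n : WithTop ℕ∞} : ContDiff ℝ n (legendre l m) :=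
  contDiff_const.mul (contDiff_polar _ _)

lemma sphericalHarmonic_eq (i : HarmonicIndex) (p : ℝ × ℝ) :
    sphericalHarmonic i p
      = (legendre i.1.1 i.1.2.natAbs p.1 : ℂ) * Complex.exp (Complex.I * i.1.2 * p.2) := by
  unfold sphericalHarmonic legendre polar rodrigues
  congr 2
  ring

/-- Two applications of `sin_mul_deriv_polar` reduce the claim to the associated Legendre equation
`rodrigues_ode` at x = cos θ. The extra factor sin θ makes it valid at the poles too. -/
lemma sturmLiouville_polar (l m : ℕ) (θ : ℝ) :
    Real.sin θ * deriv (fun t => Real.sin t * deriv (polar m (rodrigues l (l + m))) t) θ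
      = (m ^ 2 - l * (l + 1) * Real.sin θ ^ 2) * polar m (rodrigues l (l + m)) θ := by
  set p := rodrigues l (l + m)
  have h1 : (fun t => Real.sin t * deriv (polar m p) t)
      = fun t => m * (Real.cos t * polar m p t) - polar (m + 2) p.derivative t :=
    funext fun t => sin_mul_deriv_polar m p t
  rw [h1]
  have h2 := (((Real.hasDerivAt_cos θ).mul (hasDerivAt_polar m p θ)).const_mul (m : ℝ)).sub
    (hasDerivAt_polar (m + 2) p.derivative θ)
  have h3 : deriv (fun t => m * (Real.cos t * polar m p t) - polar (m + 2) p.derivative t) θ = _ :=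
    h2.deriv
  rw [h3]
  have h4 := sin_mul_deriv_polar m p θ
  have h5 := sin_mul_deriv_polar (m + 2) p.derivative θ
  have h6 := rodrigues_ode l m (Real.cos θ)
  have h7 := Real.sin_sq_add_cos_sq θ
  simp only [p, derivative_rodrigues] at h4 h5 ⊢
  simp only [polar] at h4 h5 ⊢
  simp only [Nat.cast_add, Nat.cast_ofNat] at h5
  have h8 : Real.cos θ ^ 2 = 1 - Real.sin θ ^ 2 := by linarith
  have h9 : 1 - Real.cos θ ^ 2 = Real.sin θ ^ 2 := by linarith
  rw [h9] at h6
  linear_combination (m * Real.cos θ) * h4 - h5 + Real.sin θ ^ (m + 2) * h6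
    + m ^ 2 * Real.sin θ ^ m * (rodrigues l (l + m)).eval (Real.cos θ) * h8

/-- The functions `legendre l m` solve the Sturm-Liouville problem of `Δ_h` in azimuthal order
`m`. -/
lemma sturmLiouville_legendre (l m : ℕ) (θ : ℝ) :
    Real.sin θ * deriv (fun t => Real.sin t * deriv (legendre l m) t) θ
      = (m ^ 2 - l * (l + 1) * Real.sin θ ^ 2) * legendre l m θ := by
  have h := sturmLiouville_polar l m θ
  unfold legendre
  set c := Real.sqrt ((2 * l + 1) / (4 * Real.pi) * ((l - m).factorial / (l + m).factorial))
    / (2 ^ l * l.factorial)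
  have h1 : (fun t => Real.sin t * deriv (fun θ => c * polar m (rodrigues l (l + m)) θ) t)
      = fun t => c * (Real.sin t * deriv (polar m (rodrigues l (l + m))) t) := by
    funext t
    rw [deriv_const_mul_field']
    simp only []
    ring
  rw [h1, deriv_const_mul_field']
  simp only []
  linear_combination c * h

/-- By the associated Legendre equation, the difference of the two integrands is the derivative of
sin^{2m+2} θ times the product of two consecutive derivatives of (x² - 1)^l, which vanishes at both
poles. This recursion in m carries the normalization of the harmonics. -/
lemma integral_rodrigues_succ (l m : ℕ) :
    ∫ θ in (0 : ℝ)..Real.pi, polar (2 * (m + 1) + 1) (rodrigues l (l + (m + 1)) ^ 2) θ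
      = (l - m) * (l + m + 1)
        * ∫ θ in (0 : ℝ)..Real.pi, polar (2 * m + 1) (rodrigues l (l + m) ^ 2) θ := by
  have hc : ∀ k p, IntervalIntegrable (polar k p) volume 0 Real.pi := fun k p =>
    (contDiff_polar k p (n := 0)).continuous.intervalIntegrable _ _
  rw [← sub_eq_zero, ← neg_eq_zero, neg_sub, ← intervalIntegral.integral_const_mul,
    ← intervalIntegral.integral_sub ((hc _ _).const_mul _) (hc _ _)]
  have h : ∀ θ ∈ Set.uIcc 0 Real.pi, HasDerivAt
      (polar (2 * m + 2) (rodrigues l (l + m) * rodrigues l (l + m + 1)))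
      ((l - m) * (l + m + 1) * polar (2 * m + 1) (rodrigues l (l + m) ^ 2) θ
        - polar (2 * (m + 1) + 1) (rodrigues l (l + (m + 1)) ^ 2) θ) θ := by
    intro θ _
    have h := (hasDerivAt_sin_pow (2 * m + 2) θ).mul
      (hasDerivAt_eval_cos (rodrigues l (l + m) * rodrigues l (l + m + 1)) θ)
    refine h.congr_deriv ?_
    have h6 := rodrigues_ode l m (Real.cos θ)
    have h7 := Real.sin_sq_add_cos_sq θ
    have h9 : 1 - Real.cos θ ^ 2 = Real.sin θ ^ 2 := by linarith
    rw [h9] at h6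
    simp only [polar, derivative_mul, derivative_rodrigues, eval_add, eval_mul, eval_pow]
    rw [show 2 * m + 2 - 1 = 2 * m + 1 by omega]
    push_cast
    linear_combination (-Real.sin θ ^ (2 * m + 1) * (rodrigues l (l + m)).eval (Real.cos θ)) * h6
  rw [intervalIntegral.integral_eq_sub_of_hasDerivAt h (((hc _ _).const_mul _).sub (hc _ _))]
  simp [polar]

lemma rodrigues_top (l : ℕ) : rodrigues l (l + l) = C ((2 * l).factorial : ℝ) := by
  have hm : ((X ^ 2 - 1 : ℝ[X]) ^ l).Monic := by
    apply Monic.pow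
    have := monic_X_pow_sub_C (1 : ℝ) (n := 2) (by norm_num)
    simpa using this
  have hd : ((X ^ 2 - 1 : ℝ[X]) ^ l).natDegree = 2 * l := by
    have h2 : (X ^ 2 - 1 : ℝ[X]).natDegree = 2 := by
      have := natDegree_X_pow_sub_C (n := 2) (r := (1 : ℝ))
      simpa using this
    rw [natDegree_pow, h2]; ring
  have h0 : (rodrigues l (l + l)).natDegree = 0 := by
    have := natDegree_iterate_derivative ((X ^ 2 - 1 : ℝ[X]) ^ l) (l + l)
    rw [hd] at this
    unfold rodrigues; omega
  rw [eq_C_of_natDegree_eq_zero h0]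
  congr 1
  unfold rodrigues
  rw [coeff_iterate_derivative]
  have : ((X ^ 2 - 1 : ℝ[X]) ^ l).coeff (0 + (l + l)) = 1 := by
    have := hm.coeff_natDegree
    rw [hd] at this
    rw [← this]; congr 1; omega
  rw [this, zero_add, ← two_mul, Nat.descFactorial_self]
  simp

lemma integral_sin_pow_odd_eq (l : ℕ) :
    ∫ θ in (0 : ℝ)..Real.pi, Real.sin θ ^ (2 * l + 1)
      = 2 * (2 ^ l * l.factorial) ^ 2 / (2 * l + 1).factorial := by
  rw [integral_sin_pow_odd]
  have : (∏ i ∈ Finset.range l, (2 * (i : ℝ) + 2) / (2 * i + 3))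
      = (2 ^ l * l.factorial) ^ 2 / (2 * l + 1).factorial := by
    induction l with
    | zero => simp
    | succ l ih =>
      rw [Finset.prod_range_succ, ih]
      have : (2 * (l + 1) + 1).factorial = (2 * l + 3) * ((2 * l + 2) * (2 * l + 1).factorial) := by
        rw [show 2 * (l + 1) + 1 = (2 * l + 1 + 1) + 1 by ring, Nat.factorial_succ,
          Nat.factorial_succ]
      rw [this, Nat.factorial_succ l]
      have h0 : ((2 * l + 1).factorial : ℝ) ≠ 0 := by positivity
      push_cast
      field_simp
      ring
  rw [this]; ring

/-- Induction on k = l - m, starting at m = l. There the derivative is the constant (2l)! and the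
integral is that of an odd power of the sine; `integral_rodrigues_succ` then lowers m. -/
lemma integral_rodrigues_sq (l k : ℕ) (hk : k ≤ l) :
    ∫ θ in (0 : ℝ)..Real.pi, polar (2 * (l - k) + 1) (rodrigues l (l + (l - k)) ^ 2) θ
      = 2 * (2 ^ l * l.factorial) ^ 2 / (2 * l + 1) * ((l + (l - k)).factorial / k.factorial) := by
  induction k with
  | zero =>
    simp only [Nat.sub_zero, rodrigues_top, polar, ← C_pow, eval_C]
    rw [intervalIntegral.integral_mul_const, integral_sin_pow_odd_eq, Nat.factorial_succ, ← two_mul]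
    have h0 : ((2 * l).factorial : ℝ) ≠ 0 := by positivity
    push_cast
    field_simp
    simp
  | succ k ih =>
    have ih := ih (by omega)
    have h := integral_rodrigues_succ l (l - (k + 1))
    rw [show l - (k + 1) + 1 = l - k by omega, ih] at h
    have h1 : ((l - (k + 1) : ℕ) : ℝ) = l - (k + 1) := by push_cast [Nat.cast_sub hk]; ring
    have h2 : (l + (l - k)).factorial
        = (l + (l - (k + 1)) + 1) * (l + (l - (k + 1))).factorial := by
      rw [← Nat.factorial_succ]; congr 1; omega
    rw [h2, h1] at h
    rw [Nat.factorial_succ]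
    have h3 : (0 : ℝ) < l + (l - (k + 1)) + 1 := by
      have : ((k + 1 : ℕ) : ℝ) ≤ l := by exact_mod_cast hk
      push_cast at this; linarith [Nat.cast_nonneg (α := ℝ) l]
    have h4 : (0 : ℝ) < k + 1 := by positivity
    have h5 : (0 : ℝ) < k.factorial := by positivity
    push_cast [h1] at h ⊢
    have h6 : ((l : ℝ) - (l - (k + 1))) = k + 1 := by ring
    rw [h6] at h
    have : (k + 1) * (l + (l - (k + 1)) + 1) ≠ (0 : ℝ) := by positivity
    apply mul_left_cancel₀ this
    rw [← h]
    field_simp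

lemma integral_legendre_sq (l m : ℕ) (hm : m ≤ l) :
    ∫ θ in (0 : ℝ)..Real.pi, legendre l m θ * legendre l m θ * Real.sin θ
      = 1 / (2 * Real.pi) := by
  have h := integral_rodrigues_sq l (l - m) (by omega)
  rw [show l - (l - m) = m by omega] at h
  have h1 : ∀ θ, legendre l m θ * legendre l m θ * Real.sin θ
      = ((2 * l + 1) / (4 * Real.pi) * ((l - m).factorial / (l + m).factorial))
        / (2 ^ l * l.factorial) ^ 2 * polar (2 * m + 1) (rodrigues l (l + m) ^ 2) θ := by
    intro θ
    have h0 : (0 : ℝ) ≤ (2 * l + 1) / (4 * Real.pi) * ((l - m).factorial / (l + m).factorial) := by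
      positivity
    unfold legendre polar
    conv_rhs => rw [← Real.mul_self_sqrt h0]
    simp only [eval_pow]
    ring
  simp_rw [h1]
  rw [intervalIntegral.integral_const_mul, h]
  field_simp
  norm_num

/-- Lagrange's identity: the Wronskian weighted by sin θ vanishes at both poles, and its derivative
is the integrand times l'(l'+1) - l(l+1), which is nonzero for l ≠ l'. -/
lemma integral_legendre_mul_of_ne (l l' m : ℕ) (h : l ≠ l') :
    ∫ θ in (0 : ℝ)..Real.pi, legendre l m θ * legendre l' m θ * Real.sin θ = 0 := by
  have hy : ∀ l, Differentiable ℝ (legendre l m) := fun l =>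
    (contDiff_legendre l m (n := 1)).differentiable (by norm_num)
  have hy' : ∀ l, ContDiff ℝ 1 (fun θ => Real.sin θ * deriv (legendre l m) θ) := fun l =>
    Real.contDiff_sin.mul ((contDiff_legendre l m (n := 2)).deriv' )
  have hd : ∀ θ ∈ Set.Ioo 0 Real.pi, HasDerivAt
      (fun θ => (Real.sin θ * deriv (legendre l m) θ) * legendre l' m θ
        - (Real.sin θ * deriv (legendre l' m) θ) * legendre l m θ)
      (((l' : ℝ) * (l' + 1) - l * (l + 1)) * (legendre l m θ * legendre l' m θ * Real.sin θ)) θ := by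
    intro θ hθ
    have hs : Real.sin θ ≠ 0 := (Real.sin_pos_of_mem_Ioo hθ).ne'
    have h1 := fun l => ((hy' l).differentiable (by norm_num) θ).hasDerivAt
    have h2 := ((h1 l).mul (hy l' θ).hasDerivAt).sub ((h1 l').mul (hy l θ).hasDerivAt)
    refine h2.congr_deriv ?_
    have e1 := sturmLiouville_legendre l m θ
    have e2 := sturmLiouville_legendre l' m θ
    apply mul_left_cancel₀ hs
    linear_combination legendre l' m θ * e1 - legendre l m θ * e2
  have hcont : ∀ l, Continuous (legendre l m) := fun l => (hy l).continuous
  have h3 := intervalIntegral.integral_eq_sub_of_hasDerivAt_of_le Real.pi_pos.le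
    (((((hy' l).continuous).mul (hcont l')).sub (((hy' l').continuous).mul (hcont l))).continuousOn)
    hd (Continuous.intervalIntegrable (by have := hcont l; have := hcont l'; fun_prop) _ _)
  rw [intervalIntegral.integral_const_mul] at h3
  simp at h3
  rcases h3 with h3 | h3
  · exfalso
    apply h
    have h4 : (l : ℝ) = l' := by
      nlinarith [Nat.cast_nonneg (α := ℝ) l, Nat.cast_nonneg (α := ℝ) l']
    exact_mod_cast h4
  · exact h3

/-! ### Weighted one-dimensional estimates -/

/-- Cauchy-Schwarz with a weight: t ↦ ∫ (u + t w)² ρ is a nonnegative quadratic polynomial, so its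
discriminant is at most zero. -/
lemma sq_integral_mul_le {α : Type*} [MeasurableSpace α] {μ : Measure α} {u w ρ : α → ℝ}
    (hρ : ∀ᵐ x ∂μ, 0 ≤ ρ x) (hu : Integrable (fun x => u x ^ 2 * ρ x) μ)
    (hw : Integrable (fun x => w x ^ 2 * ρ x) μ) (huw : Integrable (fun x => u x * w x * ρ x) μ) :
    (∫ x, u x * w x * ρ x ∂μ) ^ 2 ≤ (∫ x, u x ^ 2 * ρ x ∂μ) * ∫ x, w x ^ 2 * ρ x ∂μ := by
  have h : ∀ t : ℝ, 0 ≤ (∫ x, w x ^ 2 * ρ x ∂μ) * (t * t)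
      + (2 * ∫ x, u x * w x * ρ x ∂μ) * t + ∫ x, u x ^ 2 * ρ x ∂μ := by
    intro t
    have h1 : 0 ≤ ∫ x, (t * t) * (w x ^ 2 * ρ x) + (2 * t) * (u x * w x * ρ x)
        + u x ^ 2 * ρ x ∂μ := by
      refine integral_nonneg_of_ae ?_
      filter_upwards [hρ] with x hx
      have : 0 ≤ (u x + t * w x) ^ 2 * ρ x := by positivity
      simp only [Pi.zero_apply]
      linarith
    have h2 : Integrable (fun x => (t * t) * (w x ^ 2 * ρ x) + (2 * t) * (u x * w x * ρ x)) μ :=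
      (hw.const_mul _).add (huw.const_mul _)
    rw [integral_add h2 hu, integral_add (hw.const_mul _) (huw.const_mul _), integral_const_mul, integral_const_mul] at h1
    linarith
  have := discrim_le_zero h
  unfold discrim at this
  nlinarith

lemma abs_integral_mul_le {α : Type*} [MeasurableSpace α] {μ : Measure α} {u w ρ : α → ℝ}
    (hρ : ∀ᵐ x ∂μ, 0 ≤ ρ x) (hu : Integrable (fun x => u x ^ 2 * ρ x) μ)
    (hw : Integrable (fun x => w x ^ 2 * ρ x) μ) (huw : Integrable (fun x => u x * w x * ρ x) μ) :
    |∫ x, u x * w x * ρ x ∂μ|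
      ≤ Real.sqrt (∫ x, u x ^ 2 * ρ x ∂μ) * Real.sqrt (∫ x, w x ^ 2 * ρ x ∂μ) := by
  rw [← Real.sqrt_mul (integral_nonneg_of_ae ?_)]
  · exact Real.abs_le_sqrt (sq_integral_mul_le hρ hu hw huw)
  · filter_upwards [hρ] with x hx
    simp only [Pi.zero_apply]; positivity

lemma ae_sin_nonneg : ∀ᵐ θ ∂(volume.restrict (Set.Ioc 0 Real.pi)), 0 ≤ Real.sin θ := by
  filter_upwards [ae_restrict_mem measurableSet_Ioc] with θ hθ
  exact Real.sin_nonneg_of_nonneg_of_le_pi hθ.1.le hθ.2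

lemma Continuous.integrableOn_zero_pi {u : ℝ → ℝ} (hu : Continuous u) :
    IntegrableOn u (Set.Ioc 0 Real.pi) :=
  (hu.intervalIntegrable 0 Real.pi).1

lemma integral_abs_mul_abs_le {u w : ℝ → ℝ} (hu : Continuous u) (hw : Continuous w) :
    ∫ θ in (0 : ℝ)..Real.pi, |u θ| * |w θ| * Real.sin θ
      ≤ Real.sqrt (∫ θ in (0 : ℝ)..Real.pi, u θ ^ 2 * Real.sin θ)
        * Real.sqrt (∫ θ in (0 : ℝ)..Real.pi, w θ ^ 2 * Real.sin θ) := by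
  simp only [intervalIntegral.integral_of_le Real.pi_pos.le]
  have h := abs_integral_mul_le (u := fun θ => |u θ|) (w := fun θ => |w θ|) ae_sin_nonneg
    (Continuous.integrableOn_zero_pi (by fun_prop)) (Continuous.integrableOn_zero_pi (by fun_prop))
    (Continuous.integrableOn_zero_pi (by fun_prop))
  simp only [sq_abs] at h
  exact (le_abs_self _).trans h

/-- As K vanishes at both ends, |K θ| is bounded by the integral of |K'| over either side of θ.
Adding the two bounds gains the factor 2, which is the source of the 1/√2 in the β-estimate. -/
lemma two_mul_abs_le_integral_abs_deriv {K K' : ℝ → ℝ} (hK : ∀ θ, HasDerivAt K (K' θ) θ)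
    (hK' : Continuous K') (h0 : K 0 = 0) (hπ : K Real.pi = 0) {θ : ℝ}
    (hθ : θ ∈ Set.Icc 0 Real.pi) : 2 * |K θ| ≤ ∫ t in (0 : ℝ)..Real.pi, |K' t| := by
  have hi : ∀ a b, IntervalIntegrable K' volume a b := fun a b => hK'.intervalIntegrable a b
  have h1 := intervalIntegral.integral_eq_sub_of_hasDerivAt (fun t _ => hK t) (hi 0 θ)
  have h2 := intervalIntegral.integral_eq_sub_of_hasDerivAt (fun t _ => hK t) (hi θ Real.pi)
  have h3 := intervalIntegral.abs_integral_le_integral_abs (f := K') (μ := volume) hθ.1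
  have h4 := intervalIntegral.abs_integral_le_integral_abs (f := K') (μ := volume) hθ.2
  rw [h1, h0, sub_zero] at h3
  rw [h2, hπ, zero_sub, abs_neg] at h4
  have h5 := intervalIntegral.integral_add_adjacent_intervals (hi 0 θ).abs (hi θ Real.pi).abs
  rw [← h5]; linarith

/-- `sin θ f θ` has the image `g` under the part of azimuthal order `m ≥ 1` of the
Laplace-Beltrami operator of the unit sphere. -/
structure IsModeLaplacian (m : ℕ) (f g : ℝ → ℝ) : Prop where
  one_le : 1 ≤ m
  contDiff : ContDiff ℝ 2 f
  continuous : Continuous g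
  eq : ∀ θ ∈ Set.Ioo 0 Real.pi, Real.sin θ * g θ
    = Real.sin θ ^ 2 * deriv (deriv f) θ + 3 * Real.sin θ * Real.cos θ * deriv f θ
      + (1 - 2 * Real.sin θ ^ 2 - m ^ 2) * f θ

/-- The derivative of `sin θ f θ`. -/
def sinMulDeriv (f : ℝ → ℝ) (θ : ℝ) : ℝ := Real.cos θ * f θ + Real.sin θ * deriv f θ

/-- The squared length of the gradient of `sin θ f θ e^{imφ}`. -/
def gradSq (m : ℕ) (f : ℝ → ℝ) (θ : ℝ) : ℝ := sinMulDeriv f θ ^ 2 + m ^ 2 * f θ ^ 2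

/-- The `L²` norm on `(0, π)` with the weight `sin θ`. -/
def sinNorm (g : ℝ → ℝ) : ℝ := Real.sqrt (∫ θ in (0 : ℝ)..Real.pi, g θ ^ 2 * Real.sin θ)

/-- The `L²` norm of the gradient of `sin θ f θ e^{imφ}`, up to the factor `√(2π)`. -/
def gradNorm (m : ℕ) (f : ℝ → ℝ) : ℝ :=
  Real.sqrt (∫ θ in (0 : ℝ)..Real.pi, gradSq m f θ * Real.sin θ)

lemma gradSq_nonneg (m : ℕ) (f : ℝ → ℝ) (θ : ℝ) : 0 ≤ gradSq m f θ := by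
  unfold gradSq; positivity

lemma sinNorm_nonneg (g : ℝ → ℝ) : 0 ≤ sinNorm g := Real.sqrt_nonneg _

lemma gradNorm_nonneg (m : ℕ) (f : ℝ → ℝ) : 0 ≤ gradNorm m f := Real.sqrt_nonneg _

lemma integral_mul_sin_nonneg {u : ℝ → ℝ} (hu : ∀ θ, 0 ≤ u θ) :
    0 ≤ ∫ θ in (0 : ℝ)..Real.pi, u θ * Real.sin θ := by
  refine intervalIntegral.integral_nonneg Real.pi_pos.le fun θ hθ => mul_nonneg (hu θ) ?_
  exact Real.sin_nonneg_of_nonneg_of_le_pi hθ.1 hθ.2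

lemma sinNorm_sq (g : ℝ → ℝ) :
    sinNorm g ^ 2 = ∫ θ in (0 : ℝ)..Real.pi, g θ ^ 2 * Real.sin θ :=
  Real.sq_sqrt (integral_mul_sin_nonneg fun _ => sq_nonneg _)

lemma gradNorm_sq (m : ℕ) (f : ℝ → ℝ) :
    gradNorm m f ^ 2 = ∫ θ in (0 : ℝ)..Real.pi, gradSq m f θ * Real.sin θ :=
  Real.sq_sqrt (integral_mul_sin_nonneg (gradSq_nonneg m f))

namespace IsModeLaplacian

variable {m : ℕ} {f g : ℝ → ℝ}

section

variable (h : IsModeLaplacian m f g)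
include h

lemma hasDerivAt (θ : ℝ) : HasDerivAt f (deriv f θ) θ :=
  (h.contDiff.differentiable (by norm_num) θ).hasDerivAt

lemma hasDerivAt_deriv (θ : ℝ) : HasDerivAt (deriv f) (deriv (deriv f) θ) θ :=
  ((h.contDiff.deriv' (n := 1)).differentiable (by norm_num) θ).hasDerivAt

lemma continuous_f : Continuous f := h.contDiff.continuous

lemma continuous_deriv : Continuous (deriv f) := (h.contDiff.deriv' (n := 1)).continuous

lemma continuous_sinMulDeriv : Continuous (sinMulDeriv f) := by
  have := h.continuous_f
  have := h.continuous_deriv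
  unfold sinMulDeriv
  fun_prop

lemma continuous_gradSq : Continuous (gradSq m f) := by
  have := h.continuous_f
  have := h.continuous_sinMulDeriv
  unfold gradSq
  fun_prop

lemma hasDerivAt_sin_mul (θ : ℝ) :
    HasDerivAt (fun t => Real.sin t * f t) (sinMulDeriv f θ) θ :=
  (Real.hasDerivAt_sin θ).mul (h.hasDerivAt θ)

/-- The mode equation in divergence form. Every multiplier identity below multiplies it by a
suitable factor and integrates. -/
lemma hasDerivAt_sin_mul_sinMulDeriv {θ : ℝ} (hθ : θ ∈ Set.Ioo 0 Real.pi) :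
    HasDerivAt (fun t => Real.sin t * sinMulDeriv f t) (Real.sin θ * g θ + m ^ 2 * f θ) θ := by
  have h1 := (Real.hasDerivAt_sin θ).mul
    (((Real.hasDerivAt_cos θ).mul (h.hasDerivAt θ)).add
      ((Real.hasDerivAt_sin θ).mul (h.hasDerivAt_deriv θ)))
  refine h1.congr_deriv ?_
  simp only [Pi.add_apply, Pi.mul_apply]
  have h2 := h.eq θ hθ
  have h3 := Real.sin_sq_add_cos_sq θ
  linear_combination -h2 + f θ * h3

lemma one_le_cast : (1 : ℝ) ≤ m := by exact_mod_cast h.one_le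

/-- With F = sin θ f, the square F² vanishes at the poles and has derivative 2 F F'. Since F carries
a factor sin θ and 2m|f||F'| ≤ `gradSq`, the integral of |2 F F'| is at most `gradNorm`²/m. -/
lemma mul_sq_le {θ : ℝ} (hθ : θ ∈ Set.Icc 0 Real.pi) :
    m * (Real.sin θ * f θ) ^ 2 ≤ gradNorm m f ^ 2 / 2 := by
  have hf := h.continuous_f
  have hv := h.continuous_sinMulDeriv
  have he := h.continuous_gradSq
  have h1 := two_mul_abs_le_integral_abs_deriv (K := fun t => (Real.sin t * f t) ^ 2)
    (K' := fun t => 2 * (Real.sin t * f t) * sinMulDeriv f t)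
    (fun t => by simpa using (h.hasDerivAt_sin_mul t).fun_pow 2) (by fun_prop) (by simp) (by simp) hθ
  rw [abs_of_nonneg (by positivity)] at h1
  have h2 : ∫ t in (0 : ℝ)..Real.pi, |2 * (Real.sin t * f t) * sinMulDeriv f t|
      ≤ ∫ t in (0 : ℝ)..Real.pi, (1 / m : ℝ) * (gradSq m f t * Real.sin t) := by
    refine intervalIntegral.integral_mono_on Real.pi_pos.le
      (Continuous.intervalIntegrable (by fun_prop) _ _)
      (Continuous.intervalIntegrable (by fun_prop) _ _) fun t ht => ?_
    have hs := Real.sin_nonneg_of_nonneg_of_le_pi ht.1 ht.2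
    have hm := h.one_le_cast
    rw [one_div, ← div_eq_inv_mul, le_div_iff₀ (by positivity), abs_mul, abs_mul, abs_mul,
      abs_of_nonneg hs, abs_two]
    have : 2 * |f t| * |sinMulDeriv f t| * m ≤ gradSq m f t := by
      unfold gradSq
      rw [← sq_abs (sinMulDeriv f t), ← sq_abs (f t)]
      nlinarith [sq_nonneg (m * |f t| - |sinMulDeriv f t|)]
    nlinarith
  rw [intervalIntegral.integral_const_mul, ← gradNorm_sq] at h2
  have hm := h.one_le_cast
  have h3 : 2 * (Real.sin θ * f θ) ^ 2 ≤ 1 / m * gradNorm m f ^ 2 := h1.trans h2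
  rw [one_div, ← div_eq_inv_mul, le_div_iff₀ (by positivity)] at h3
  linarith

/-- Green's identity: the divergence form is multiplied by sin θ f. -/
lemma integral_gradSq_mul_sin :
    gradNorm m f ^ 2
      = -∫ θ in (0 : ℝ)..Real.pi, Real.sin θ * f θ * g θ * Real.sin θ := by
  have hf := h.continuous_f
  have hv := h.continuous_sinMulDeriv
  have he := h.continuous_gradSq
  have hg := h.continuous
  rw [gradNorm_sq, eq_neg_iff_add_eq_zero, ← intervalIntegral.integral_add
    (Continuous.intervalIntegrable (by fun_prop) _ _)
    (Continuous.intervalIntegrable (by fun_prop) _ _)]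
  have h1 := intervalIntegral.integral_eq_sub_of_hasDerivAt_of_le Real.pi_pos.le
    (f := fun t => Real.sin t * f t * (Real.sin t * sinMulDeriv f t))
    (f' := fun θ => gradSq m f θ * Real.sin θ + Real.sin θ * f θ * g θ * Real.sin θ)
    (by fun_prop) (fun θ hθ => ?_) (Continuous.intervalIntegrable (by fun_prop) _ _)
  · rw [h1]; simp
  · refine ((h.hasDerivAt_sin_mul θ).mul (h.hasDerivAt_sin_mul_sinMulDeriv hθ)).congr_deriv ?_
    unfold gradSq
    ring

lemma integral_sin_mul_abs_mul_abs_le :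
    ∫ θ in (0 : ℝ)..Real.pi, |m * f θ| * |g θ| * Real.sin θ ≤ gradNorm m f * sinNorm g := by
  have hf := h.continuous_f
  have hv := h.continuous_sinMulDeriv
  have he := h.continuous_gradSq
  have hg := h.continuous
  refine (integral_abs_mul_abs_le (u := fun θ => m * f θ) (by fun_prop) hg).trans ?_
  refine mul_le_mul_of_nonneg_right (Real.sqrt_le_sqrt ?_) (Real.sqrt_nonneg _)
  refine intervalIntegral.integral_mono_on Real.pi_pos.le
      (Continuous.intervalIntegrable (by fun_prop) _ _)
      (Continuous.intervalIntegrable (by fun_prop) _ _) fun t ht => ?_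
  have hs := Real.sin_nonneg_of_nonneg_of_le_pi ht.1 ht.2
  unfold gradSq
  nlinarith [mul_nonneg (sq_nonneg (sinMulDeriv f t)) hs]

lemma integral_sinMulDeriv_abs_mul_abs_le :
    ∫ θ in (0 : ℝ)..Real.pi, |sinMulDeriv f θ| * |g θ| * Real.sin θ
      ≤ gradNorm m f * sinNorm g := by
  have hf := h.continuous_f
  have hv := h.continuous_sinMulDeriv
  have he := h.continuous_gradSq
  have hg := h.continuous
  refine (integral_abs_mul_abs_le hv hg).trans ?_
  refine mul_le_mul_of_nonneg_right (Real.sqrt_le_sqrt ?_) (Real.sqrt_nonneg _)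
  refine intervalIntegral.integral_mono_on Real.pi_pos.le
      (Continuous.intervalIntegrable (by fun_prop) _ _)
      (Continuous.intervalIntegrable (by fun_prop) _ _) fun t ht => ?_
  have hs := Real.sin_nonneg_of_nonneg_of_le_pi ht.1 ht.2
  unfold gradSq
  have : 0 ≤ (m : ℝ) ^ 2 * f t ^ 2 * Real.sin t := by positivity
  nlinarith

/-- The multiplier is f instead of sin θ f, which removes the weight sin θ on the left. The added
term ½ sin θ cos θ f² cancels the indefinite product of f and its derivative and leaves only -½ f²,
which half of m² f² absorbs because m ≥ 1. -/
lemma integral_unweighted_le :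
    m * ((∫ θ in (0 : ℝ)..Real.pi, sinMulDeriv f θ ^ 2)
      + (∫ θ in (0 : ℝ)..Real.pi, m ^ 2 * f θ ^ 2) / 2) ≤ gradNorm m f * sinNorm g := by
  have hf := h.continuous_f
  have hf' := h.continuous_deriv
  have hv := h.continuous_sinMulDeriv
  have he := h.continuous_gradSq
  have hg := h.continuous
  have hm := h.one_le_cast
  have h1 := intervalIntegral.integral_eq_sub_of_hasDerivAt_of_le Real.pi_pos.le
    (f := fun t => f t * (Real.sin t * sinMulDeriv f t)
      + (1 / 2) * (Real.sin t * Real.cos t * f t ^ 2))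
    (f' := fun θ => (sinMulDeriv f θ ^ 2 + m ^ 2 * f θ ^ 2)
      + (Real.sin θ * f θ * g θ - (1 / 2) * f θ ^ 2))
    (by fun_prop) (fun θ hθ => ?_) (Continuous.intervalIntegrable (by fun_prop) _ _)
  · have hi : ∀ {u : ℝ → ℝ}, Continuous u → IntervalIntegrable u volume 0 Real.pi :=
      fun hu => hu.intervalIntegrable _ _
    rw [intervalIntegral.integral_add (hi (by fun_prop)) (hi (by fun_prop)),
      intervalIntegral.integral_add (hi (by fun_prop)) (hi (by fun_prop)),
      intervalIntegral.integral_sub (hi (by fun_prop)) (hi (by fun_prop)),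
      intervalIntegral.integral_const_mul (1 / 2 : ℝ)] at h1
    simp only [Real.sin_pi, Real.sin_zero, zero_mul, mul_zero, add_zero, sub_zero] at h1
    have h2 := h.integral_sin_mul_abs_mul_abs_le
    have h3 : -(m * ∫ θ in (0 : ℝ)..Real.pi, Real.sin θ * f θ * g θ)
        ≤ ∫ θ in (0 : ℝ)..Real.pi, |m * f θ| * |g θ| * Real.sin θ := by
      rw [← intervalIntegral.integral_const_mul, ← intervalIntegral.integral_neg]
      refine intervalIntegral.integral_mono_on Real.pi_pos.le (hi (by fun_prop)) (hi (by fun_prop))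
        fun t ht => ?_
      have hs := Real.sin_nonneg_of_nonneg_of_le_pi ht.1 ht.2
      rw [← abs_mul]
      nlinarith [neg_abs_le (m * f t * g t)]
    have h4 : 0 ≤ ∫ θ in (0 : ℝ)..Real.pi, f θ ^ 2 :=
      intervalIntegral.integral_nonneg Real.pi_pos.le fun t _ => sq_nonneg _
    have h5 : ∫ θ in (0 : ℝ)..Real.pi, (m : ℝ) ^ 2 * f θ ^ 2
        = m ^ 2 * ∫ θ in (0 : ℝ)..Real.pi, f θ ^ 2 := intervalIntegral.integral_const_mul _ _
    rw [h5] at h1 ⊢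
    nlinarith [mul_nonneg (mul_nonneg (zero_le_one.trans hm) h4) (by nlinarith : (0:ℝ) ≤ m ^ 2 - 1)]
  · have h2 := ((h.hasDerivAt θ).mul (h.hasDerivAt_sin_mul_sinMulDeriv hθ)).add
      ((((Real.hasDerivAt_sin θ).mul (Real.hasDerivAt_cos θ)).mul
        ((h.hasDerivAt θ).fun_pow 2)).const_mul (1 / 2))
    refine h2.congr_deriv ?_
    have h3 := Real.sin_sq_add_cos_sq θ
    simp only [Pi.mul_apply, sinMulDeriv]
    simp
    linear_combination (- f θ ^ 2 / 2) * h3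

/-- The function sin θ f² vanishes at the poles, and its derivative is 2 f F' - cos θ f² with F =
sin θ f. Its L¹ norm is controlled by the unweighted integrals of `integral_unweighted_le`. -/
lemma sin_mul_sq_le {θ : ℝ} (hθ : θ ∈ Set.Icc 0 Real.pi) :
    Real.sin θ * (m ^ 2 * f θ ^ 2) ≤ 3 / 2 * (gradNorm m f * sinNorm g) := by
  have hf := h.continuous_f
  have hf' := h.continuous_deriv
  have hv := h.continuous_sinMulDeriv
  have hm := h.one_le_cast
  have h1 := two_mul_abs_le_integral_abs_deriv (K := fun t => Real.sin t * f t ^ 2)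
    (K' := fun t => 2 * f t * sinMulDeriv f t - Real.cos t * f t ^ 2)
    (fun t => ((Real.hasDerivAt_sin t).mul ((h.hasDerivAt t).fun_pow 2)).congr_deriv
      (by simp [sinMulDeriv]; ring))
    (by fun_prop) (by simp) (by simp) hθ
  have h2 : ∫ t in (0 : ℝ)..Real.pi, |2 * f t * sinMulDeriv f t - Real.cos t * f t ^ 2|
      ≤ ∫ t in (0 : ℝ)..Real.pi, (2 / m * sinMulDeriv f t ^ 2
        + (1 / (2 * m) + 1 / m ^ 2) * (m ^ 2 * f t ^ 2)) := by
    refine intervalIntegral.integral_mono_on Real.pi_pos.le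
      (Continuous.intervalIntegrable (by fun_prop) _ _)
      (Continuous.intervalIntegrable (by fun_prop) _ _) fun t ht => ?_
    -- With this splitting, m² times the final bound is 2m V + (m/2 + 1) Q, at most three times m (V
    -- + Q/2) because m ≥ 1. Halving gives the constant 3/2.
    have e1 : |2 * f t * sinMulDeriv f t| ≤ 2 / m * sinMulDeriv f t ^ 2 + m / 2 * f t ^ 2 := by
      rw [abs_le]
      have hm0 : (m : ℝ) ≠ 0 := by positivity
      have a1 : 2 / m * sinMulDeriv f t ^ 2 + m / 2 * f t ^ 2 - 2 * f t * sinMulDeriv f t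
          = (2 * sinMulDeriv f t - m * f t) ^ 2 / (2 * m) := by field_simp; ring
      have a2 : 2 / m * sinMulDeriv f t ^ 2 + m / 2 * f t ^ 2 + 2 * f t * sinMulDeriv f t
          = (2 * sinMulDeriv f t + m * f t) ^ 2 / (2 * m) := by field_simp; ring
      have a3 : 0 ≤ (2 * sinMulDeriv f t - m * f t) ^ 2 / (2 * m) := by positivity
      have a4 : 0 ≤ (2 * sinMulDeriv f t + m * f t) ^ 2 / (2 * m) := by positivity
      constructor <;> linarith
    have e2 : |Real.cos t * f t ^ 2| ≤ f t ^ 2 := by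
      rw [abs_mul, abs_of_nonneg (sq_nonneg (f t))]
      nlinarith [Real.abs_cos_le_one t, sq_nonneg (f t)]
    have e3 : (1 / (2 * m) + 1 / m ^ 2 : ℝ) * (m ^ 2 * f t ^ 2) = m / 2 * f t ^ 2 + f t ^ 2 := by
      field_simp
    rw [e3]
    linarith [abs_sub (2 * f t * sinMulDeriv f t) (Real.cos t * f t ^ 2)]
  rw [intervalIntegral.integral_add (Continuous.intervalIntegrable (by fun_prop) _ _)
    (Continuous.intervalIntegrable (by fun_prop) _ _), intervalIntegral.integral_const_mul,
    intervalIntegral.integral_const_mul] at h2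
  have h3 := h.integral_unweighted_le
  set V := ∫ θ in (0 : ℝ)..Real.pi, sinMulDeriv f θ ^ 2
  set Q := ∫ θ in (0 : ℝ)..Real.pi, (m : ℝ) ^ 2 * f θ ^ 2
  have hV : 0 ≤ V := intervalIntegral.integral_nonneg Real.pi_pos.le fun t _ => sq_nonneg _
  have hQ : 0 ≤ Q := intervalIntegral.integral_nonneg Real.pi_pos.le fun t _ => by positivity
  have h4 : 2 * (Real.sin θ * f θ ^ 2) ≤ 2 / m * V + (1 / (2 * m) + 1 / m ^ 2) * Q := by
    linarith [le_abs_self (Real.sin θ * f θ ^ 2)]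
  have h5 := mul_le_mul_of_nonneg_left h4 (sq_nonneg (m : ℝ))
  have h6 : (m : ℝ) ^ 2 * (2 / m * V + (1 / (2 * m) + 1 / m ^ 2) * Q)
      = 2 * m * V + (m / 2 + 1) * Q := by field_simp
  rw [h6] at h5
  nlinarith

/-- The multiplier 2 sin θ F', with F = sin θ f, makes (sin θ F')² - m² F² have derivative 2 sin² θ
F' g. Integrating from a pole to θ bounds the first square by the second. -/
lemma sin_mul_sinMulDeriv_sq_le {θ : ℝ} (hθ : θ ∈ Set.Icc 0 Real.pi) :
    Real.sin θ * sinMulDeriv f θ ^ 2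
      ≤ Real.sin θ * (m ^ 2 * f θ ^ 2) + 2 * (gradNorm m f * sinNorm g) := by
  have hf := h.continuous_f
  have hf' := h.continuous_deriv
  have hv := h.continuous_sinMulDeriv
  have hg := h.continuous
  have hAB : 0 ≤ gradNorm m f * sinNorm g := mul_nonneg (gradNorm_nonneg _ _) (sinNorm_nonneg _)
  have hi : ∀ {u : ℝ → ℝ}, Continuous u → ∀ a b, IntervalIntegrable u volume a b :=
      fun hu a b => hu.intervalIntegrable a b
  have hd : ∀ t ∈ Set.Ioo 0 Real.pi, HasDerivAt
      (fun t => (Real.sin t * sinMulDeriv f t) ^ 2 - m ^ 2 * (Real.sin t * f t) ^ 2)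
      (2 * (Real.sin t ^ 2 * sinMulDeriv f t * g t)) t := by
    intro t ht
    refine (((h.hasDerivAt_sin_mul_sinMulDeriv ht).fun_pow 2).sub
      (((h.hasDerivAt_sin_mul t).fun_pow 2).const_mul (m ^ 2 : ℝ))).congr_deriv ?_
    simp
    ring
  have hs0 := Real.sin_nonneg_of_nonneg_of_le_pi hθ.1 hθ.2
  have key : Real.sin θ ^ 2 * sinMulDeriv f θ ^ 2
      ≤ Real.sin θ ^ 2 * (m ^ 2 * f θ ^ 2) + Real.sin θ * (2 * (gradNorm m f * sinNorm g)) := by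
    have bound : ∀ a b, 0 ≤ a → a ≤ b → b ≤ Real.pi →
        (∀ t ∈ Set.Icc a b, Real.sin t ≤ Real.sin θ) →
        |∫ t in a..b, 2 * (Real.sin t ^ 2 * sinMulDeriv f t * g t)|
          ≤ Real.sin θ * (2 * (gradNorm m f * sinNorm g)) := by
      intro a b ha hab hb hle
      calc |∫ t in a..b, 2 * (Real.sin t ^ 2 * sinMulDeriv f t * g t)|
          ≤ ∫ t in a..b, |2 * (Real.sin t ^ 2 * sinMulDeriv f t * g t)| :=
            intervalIntegral.abs_integral_le_integral_abs hab
        _ ≤ ∫ t in a..b, (2 * Real.sin θ) * (|sinMulDeriv f t| * |g t| * Real.sin t) := by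
            refine intervalIntegral.integral_mono_on hab (hi (by fun_prop) _ _)
              (hi (by fun_prop) _ _) fun t ht => ?_
            have hst := Real.sin_nonneg_of_nonneg_of_le_pi (ha.trans ht.1) (ht.2.trans hb)
            rw [abs_mul, abs_mul, abs_mul, abs_two, abs_of_nonneg (sq_nonneg (Real.sin t))]
            have := mul_le_mul_of_nonneg_right (hle t ht)
              (by positivity : 0 ≤ |sinMulDeriv f t| * |g t| * Real.sin t)
            nlinarith
        _ = (2 * Real.sin θ) * ∫ t in a..b, (|sinMulDeriv f t| * |g t| * Real.sin t) :=
            intervalIntegral.integral_const_mul _ _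
        _ ≤ (2 * Real.sin θ) * ∫ t in (0 : ℝ)..Real.pi,
              (|sinMulDeriv f t| * |g t| * Real.sin t) := by
            refine mul_le_mul_of_nonneg_left ?_ (by positivity)
            refine intervalIntegral.integral_mono_interval ha hab hb ?_ (hi (by fun_prop) _ _)
            filter_upwards [ae_sin_nonneg] with t ht
            simp only [Pi.zero_apply]; positivity
        _ ≤ _ := by
            have := mul_le_mul_of_nonneg_left h.integral_sinMulDeriv_abs_mul_abs_le
              (by positivity : 0 ≤ 2 * Real.sin θ)
            linarith
    -- The integration starts at the nearer pole, so that sin t ≤ sin θ along the way. This pulls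
    -- out the factor sin θ that is divided off at the end.
    rcases le_total θ (Real.pi / 2) with hθ2 | hθ2
    · have h1 := intervalIntegral.integral_eq_sub_of_hasDerivAt_of_le hθ.1
        (f := fun t => (Real.sin t * sinMulDeriv f t) ^ 2 - m ^ 2 * (Real.sin t * f t) ^ 2)
        (by fun_prop) (fun t ht => hd t ⟨ht.1, ht.2.trans_le hθ.2⟩) (hi (by fun_prop) _ _)
      have h2 := bound 0 θ le_rfl hθ.1 hθ.2 fun t ht =>
        Real.sin_le_sin_of_le_of_le_pi_div_two (by linarith [ht.1, Real.pi_pos]) hθ2 ht.2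
      rw [h1] at h2
      simp only [Real.sin_zero, zero_mul] at h2
      have h3 := (le_abs_self _).trans h2
      nlinarith
    · have h1 := intervalIntegral.integral_eq_sub_of_hasDerivAt_of_le hθ.2
        (f := fun t => (Real.sin t * sinMulDeriv f t) ^ 2 - m ^ 2 * (Real.sin t * f t) ^ 2)
        (by fun_prop) (fun t ht => hd t ⟨hθ.1.trans_lt ht.1, ht.2⟩) (hi (by fun_prop) _ _)
      have h2 := bound θ Real.pi hθ.1 hθ.2 le_rfl fun t ht => by
        rw [← Real.sin_pi_sub t, ← Real.sin_pi_sub θ]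
        exact Real.sin_le_sin_of_le_of_le_pi_div_two (by linarith [ht.2, Real.pi_pos])
          (by linarith) (by linarith [ht.1])
      rw [h1] at h2
      simp only [Real.sin_pi, zero_mul] at h2
      have h3 := (neg_le_abs _).trans h2
      nlinarith
  rcases hs0.eq_or_lt with h0 | h0
  · rw [← h0]; simp; exact hAB
  · refine le_of_mul_le_mul_left ?_ h0
    linarith

/-- An L⁴ bound of the gradient. One factor `gradSq` is estimated pointwise by sin θ · `gradSq` ≤
5AB, with A = `sinNorm g`, B = `gradNorm m f` and 5 = 2 · 3/2 + 2; the other is integrated without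
weight, which costs 2AB/m. -/
lemma integral_gradSq_sq_le :
    m * ∫ θ in (0 : ℝ)..Real.pi, gradSq m f θ ^ 2 * Real.sin θ
      ≤ 10 * (gradNorm m f * sinNorm g) ^ 2 := by
  have hf := h.continuous_f
  have hf' := h.continuous_deriv
  have hv := h.continuous_sinMulDeriv
  have he := h.continuous_gradSq
  have hm := h.one_le_cast
  have hAB : 0 ≤ gradNorm m f * sinNorm g := mul_nonneg (gradNorm_nonneg _ _) (sinNorm_nonneg _)
  have h1 : ∫ θ in (0 : ℝ)..Real.pi, gradSq m f θ ^ 2 * Real.sin θ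
      ≤ ∫ θ in (0 : ℝ)..Real.pi, (5 * (gradNorm m f * sinNorm g))
        * (sinMulDeriv f θ ^ 2 + m ^ 2 * f θ ^ 2) := by
    refine intervalIntegral.integral_mono_on Real.pi_pos.le
      (Continuous.intervalIntegrable (by fun_prop) _ _)
      (Continuous.intervalIntegrable (by fun_prop) _ _) fun t ht => ?_
    have e1 := h.sin_mul_sq_le ht
    have e2 := h.sin_mul_sinMulDeriv_sq_le ht
    have e3 : Real.sin t * gradSq m f t ≤ 5 * (gradNorm m f * sinNorm g) := by
      unfold gradSq; linarith
    calc gradSq m f t ^ 2 * Real.sin t = (Real.sin t * gradSq m f t) * gradSq m f t := by ring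
      _ ≤ _ := mul_le_mul_of_nonneg_right e3 (gradSq_nonneg m f t)
  rw [intervalIntegral.integral_const_mul, intervalIntegral.integral_add
    (Continuous.intervalIntegrable (by fun_prop) _ _)
    (Continuous.intervalIntegrable (by fun_prop) _ _)] at h1
  have h3 := h.integral_unweighted_le
  set V := ∫ θ in (0 : ℝ)..Real.pi, sinMulDeriv f θ ^ 2
  set Q := ∫ θ in (0 : ℝ)..Real.pi, (m : ℝ) ^ 2 * f θ ^ 2
  have hV : 0 ≤ V := intervalIntegral.integral_nonneg Real.pi_pos.le fun t _ => sq_nonneg _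
  have h4 := mul_le_mul_of_nonneg_left h1 (zero_le_one.trans hm)
  refine h4.trans ?_
  have h5 : m * (V + Q) ≤ 2 * (gradNorm m f * sinNorm g) := by nlinarith
  nlinarith

end

end IsModeLaplacian

lemma integrableOn_mul_mul_sin {u w : ℝ → ℝ}
    (hu : AEStronglyMeasurable u (volume.restrict (Set.Ioc 0 Real.pi)))
    (hu2 : IntegrableOn (fun θ => u θ ^ 2 * Real.sin θ) (Set.Ioc 0 Real.pi)) (hw : Continuous w) :
    IntegrableOn (fun θ => u θ * w θ * Real.sin θ) (Set.Ioc 0 Real.pi) := by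
  refine Integrable.mono' (g := fun θ => u θ ^ 2 * Real.sin θ + w θ ^ 2 * Real.sin θ)
    (Integrable.add hu2 (Continuous.integrableOn_zero_pi (u := fun θ => w θ ^ 2 * Real.sin θ)
      (by fun_prop)))
    ((hu.mul hw.aestronglyMeasurable).mul Real.continuous_sin.aestronglyMeasurable) ?_
  filter_upwards [ae_sin_nonneg] with θ hθ
  rw [Real.norm_eq_abs, abs_mul, abs_of_nonneg hθ, ← add_mul]
  refine mul_le_mul_of_nonneg_right ?_ hθ
  rw [abs_le]
  constructor <;> nlinarith [sq_nonneg (u θ + w θ), sq_nonneg (u θ - w θ)]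

lemma abs_integral_mul_mul_sin_le {u w : ℝ → ℝ}
    (hu : AEStronglyMeasurable u (volume.restrict (Set.Ioc 0 Real.pi)))
    (hu2 : IntegrableOn (fun θ => u θ ^ 2 * Real.sin θ) (Set.Ioc 0 Real.pi)) (hw : Continuous w) :
    |∫ θ in (0 : ℝ)..Real.pi, u θ * w θ * Real.sin θ| ≤ sinNorm u * sinNorm w := by
  unfold sinNorm
  simp only [intervalIntegral.integral_of_le Real.pi_pos.le]
  exact abs_integral_mul_le ae_sin_nonneg hu2 (Continuous.integrableOn_zero_pi (by fun_prop))
    (integrableOn_mul_mul_sin hu hu2 hw)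

/-- The operator `sin θ h'' - cos θ h' = sin² θ ((sin θ)⁻¹ h')'`. -/
def alphaOp (h : ℝ → ℝ) (θ : ℝ) : ℝ :=
  Real.sin θ * deriv (deriv h) θ - Real.cos θ * deriv h θ

namespace IsModeLaplacian

variable {m : ℕ} {f g : ℝ → ℝ} (h : IsModeLaplacian m f g)
include h

/-- A factor sin θ splits off, so the pairing with Ω is an integral for the measure sin θ dθ and
Cauchy-Schwarz applies with the weighted norm of Ω. The other factor is quadratic in the mode and
its first derivatives, except for one product with g. -/
lemma alphaOp_sq {θ : ℝ} (hθ : θ ∈ Set.Ioo 0 Real.pi) :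
    alphaOp (fun t => (Real.sin t * f t) ^ 2) θ
      = (2 * (Real.sin θ * f θ * g θ)
        + (2 * gradSq m f θ - 4 * Real.cos θ * f θ * sinMulDeriv f θ)) * Real.sin θ := by
  have h1 : deriv (fun t => (Real.sin t * f t) ^ 2)
      = fun t => 2 * (f t * (Real.sin t * sinMulDeriv f t)) := by
    funext t
    have := ((h.hasDerivAt_sin_mul t).fun_pow 2).deriv
    rw [this]; simp; ring
  have h2 := (((h.hasDerivAt θ).mul (h.hasDerivAt_sin_mul_sinMulDeriv hθ)).const_mul 2).deriv
  have h2' : deriv (fun t => 2 * (f t * (Real.sin t * sinMulDeriv f t))) θ = _ := h2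
  unfold alphaOp
  rw [h1, h2']
  simp only [gradSq, sinMulDeriv]
  ring

lemma sinNorm_sin_mul_mul_sq_le :
    m * sinNorm (fun θ => Real.sin θ * f θ * g θ) ^ 2 ≤ gradNorm m f ^ 2 / 2 * sinNorm g ^ 2 := by
  have hf := h.continuous_f
  have hg := h.continuous
  rw [sinNorm_sq, sinNorm_sq, ← intervalIntegral.integral_const_mul,
    ← intervalIntegral.integral_const_mul]
  refine intervalIntegral.integral_mono_on Real.pi_pos.le
    (Continuous.intervalIntegrable (by fun_prop) _ _)
    (Continuous.intervalIntegrable (by fun_prop) _ _) fun t ht => ?_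
  have hs := Real.sin_nonneg_of_nonneg_of_le_pi ht.1 ht.2
  have h1 := mul_le_mul_of_nonneg_right (h.mul_sq_le ht)
    (by positivity : 0 ≤ g t ^ 2 * Real.sin t)
  linarith

/-- Since 2m|f F'| ≤ `gradSq` for F = sin θ f, the function is pointwise at most 2(m+1)/m times
`gradSq`, and `integral_gradSq_sq_le` bounds the L² norm of the latter. The factor 40 is 4 · 10. -/
lemma sinNorm_gradSq_sub_sq_le :
    m ^ 2 * (m * sinNorm (fun θ => 2 * gradSq m f θ
        - 4 * Real.cos θ * f θ * sinMulDeriv f θ) ^ 2)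
      ≤ 40 * (m + 1) ^ 2 * (gradNorm m f * sinNorm g) ^ 2 := by
  have hf := h.continuous_f
  have hv := h.continuous_sinMulDeriv
  have he := h.continuous_gradSq
  have hm := h.one_le_cast
  have h2 := h.integral_gradSq_sq_le
  have h1 : m ^ 2 * sinNorm (fun θ => 2 * gradSq m f θ
        - 4 * Real.cos θ * f θ * sinMulDeriv f θ) ^ 2
      ≤ 4 * (m + 1) ^ 2 * ∫ θ in (0 : ℝ)..Real.pi, gradSq m f θ ^ 2 * Real.sin θ := by
    rw [sinNorm_sq, ← intervalIntegral.integral_const_mul, ← intervalIntegral.integral_const_mul]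
    refine intervalIntegral.integral_mono_on Real.pi_pos.le
      (Continuous.intervalIntegrable (by fun_prop) _ _)
      (Continuous.intervalIntegrable (by fun_prop) _ _) fun t ht => ?_
    have hs := Real.sin_nonneg_of_nonneg_of_le_pi ht.1 ht.2
    have e1 : |m * (2 * gradSq m f t - 4 * Real.cos t * f t * sinMulDeriv f t)|
        ≤ 2 * (m + 1) * gradSq m f t := by
      have e2 : |m * (4 * Real.cos t * f t * sinMulDeriv f t)| ≤ 2 * gradSq m f t := by
        have e3 : |m * (4 * Real.cos t * f t * sinMulDeriv f t)|
            = |Real.cos t| * (4 * (m * |f t| * |sinMulDeriv f t|)) := by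
          simp only [abs_mul, Nat.abs_cast, Nat.abs_ofNat]; ring
        rw [e3]
        have e4 : 4 * (m * |f t| * |sinMulDeriv f t|) ≤ 2 * gradSq m f t := by
          unfold gradSq
          rw [← sq_abs (sinMulDeriv f t), ← sq_abs (f t)]
          nlinarith [sq_nonneg (m * |f t| - |sinMulDeriv f t|)]
        refine (mul_le_of_le_one_left (by positivity) (Real.abs_cos_le_one t)).trans e4
      have e5 := gradSq_nonneg m f t
      rw [mul_sub]
      refine (abs_sub _ _).trans ?_
      rw [abs_of_nonneg (by positivity : 0 ≤ m * (2 * gradSq m f t))]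
      linarith
    have e6 := pow_le_pow_left₀ (abs_nonneg _) e1 2
    rw [sq_abs] at e6
    have e7 := mul_le_mul_of_nonneg_right e6 hs
    linarith
  have h3 := mul_le_mul_of_nonneg_left h1 (zero_le_one.trans hm)
  have h4 := mul_le_mul_of_nonneg_left h2 (by positivity : (0 : ℝ) ≤ 4 * (m + 1) ^ 2)
  linarith

/-- The estimate of the `α_Ω`-term in a single azimuthal order. -/
lemma mul_abs_integral_alphaOp_le {Ω : ℝ → ℝ}
    (hΩ : AEStronglyMeasurable Ω (volume.restrict (Set.Ioc 0 Real.pi)))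
    (hΩ2 : IntegrableOn (fun θ => Ω θ ^ 2 * Real.sin θ) (Set.Ioc 0 Real.pi))
    (hAB : m * (m + 1) * gradNorm m f ^ 2 ≤ sinNorm g ^ 2) :
    m * |∫ θ in (0 : ℝ)..Real.pi, Ω θ * alphaOp (fun t => (Real.sin t * f t) ^ 2) θ|
      ≤ 12.1 * sinNorm Ω * (sinNorm g * Real.sqrt (sinNorm g * gradNorm m f)) := by
  have hf := h.continuous_f
  have hv := h.continuous_sinMulDeriv
  have he := h.continuous_gradSq
  have hg := h.continuous
  have hm := h.one_le_cast
  have e1 : ∫ θ in (0 : ℝ)..Real.pi, Ω θ * alphaOp (fun t => (Real.sin t * f t) ^ 2) θ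
      = 2 * (∫ θ in (0 : ℝ)..Real.pi, Ω θ * (Real.sin θ * f θ * g θ) * Real.sin θ)
        + ∫ θ in (0 : ℝ)..Real.pi, Ω θ * (2 * gradSq m f θ
          - 4 * Real.cos θ * f θ * sinMulDeriv f θ) * Real.sin θ := by
    rw [← intervalIntegral.integral_const_mul, ← intervalIntegral.integral_add]
    · simp only [intervalIntegral.integral_of_le Real.pi_pos.le, integral_Ioc_eq_integral_Ioo]
      refine setIntegral_congr_fun measurableSet_Ioo fun θ hθ => ?_
      simp only [h.alphaOp_sq hθ]
      ring
    · rw [intervalIntegrable_iff_integrableOn_Ioc_of_le Real.pi_pos.le]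
      exact (integrableOn_mul_mul_sin hΩ hΩ2 (by fun_prop)).const_mul 2
    · rw [intervalIntegrable_iff_integrableOn_Ioc_of_le Real.pi_pos.le]
      exact integrableOn_mul_mul_sin hΩ hΩ2 (by fun_prop)
  have b1 := abs_integral_mul_mul_sin_le hΩ hΩ2 (w := fun θ => Real.sin θ * f θ * g θ)
    (by fun_prop)
  have b2 := abs_integral_mul_mul_sin_le hΩ hΩ2 (w := fun θ => 2 * gradSq m f θ
    - 4 * Real.cos θ * f θ * sinMulDeriv f θ) (by fun_prop)
  have c1 := h.sinNorm_sin_mul_mul_sq_le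
  have c2 := h.sinNorm_gradSq_sub_sq_le
  set U := sinNorm (fun θ => Real.sin θ * f θ * g θ)
  set W := sinNorm (fun θ => 2 * gradSq m f θ - 4 * Real.cos θ * f θ * sinMulDeriv f θ)
  have hU : 0 ≤ U := sinNorm_nonneg _
  have hW : 0 ≤ W := sinNorm_nonneg _
  have hA := sinNorm_nonneg g
  have hB := gradNorm_nonneg m f
  have hO := sinNorm_nonneg Ω
  set A := sinNorm g
  set B := gradNorm m f
  have hS : Real.sqrt (A * B) ^ 2 = A * B := Real.sq_sqrt (by positivity)
  set S := Real.sqrt (A * B)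
  have hS0 : 0 ≤ S := Real.sqrt_nonneg _
  have hmB : m * B ≤ A := by
    refine le_of_sq_le_sq ?_ hA
    nlinarith [sq_nonneg B]
  -- The constant 0.7072 bounds 1/√2; one factor m is spent on m B ≤ A.
  have d1 : m * U ≤ 0.7072 * (A * S) := by
    refine le_of_sq_le_sq ?_ (by positivity)
    have := mul_le_mul_of_nonneg_left c1 (zero_le_one.trans hm)
    have h2 : m * (B ^ 2 / 2 * A ^ 2) ≤ (A * B) * A ^ 2 / 2 := by
      have := mul_le_mul_of_nonneg_right hmB (by positivity : 0 ≤ B * A ^ 2 / 2)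
      linarith
    calc (m * U) ^ 2 = m * (m * U ^ 2) := by ring
      _ ≤ (A * B) * A ^ 2 / 2 := this.trans h2
      _ ≤ (0.7072 * (A * S)) ^ 2 := by
        rw [mul_pow, mul_pow, hS]
        have : 0 ≤ A * B * A ^ 2 := by positivity
        linarith
  have d2 : m * W ≤ 10.64 * (A * S) := by
    -- The constant 2.83 bounds 2√2: m (m+1) B² ≤ A² leaves (m+1)³/m, which is at most 8m² since m +
    -- 1 ≤ 2m. Then 10.64² ≥ 40 · 2.83.
    have k1 : (m + 1) ^ 2 * B ≤ 2.83 * (m * A) := by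
      refine le_of_sq_le_sq ?_ (by positivity)
      have k2 : ((m : ℝ) + 1) ^ 3 ≤ 8 * m ^ 3 := by
        have : ((m : ℝ) + 1) ^ 3 ≤ (2 * m) ^ 3 :=
          pow_le_pow_left₀ (by positivity) (by linarith) 3
        linarith
      have k3 := mul_le_mul_of_nonneg_left hAB (by positivity : (0 : ℝ) ≤ (m + 1) ^ 3)
      have k4 := mul_le_mul_of_nonneg_right k2 (sq_nonneg A)
      have k5 : m * ((m + 1) ^ 4 * B ^ 2) ≤ m * (8 * m ^ 2 * A ^ 2) := by linarith
      have k6 := le_of_mul_le_mul_left k5 (by linarith)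
      have : 0 ≤ (m : ℝ) ^ 2 * A ^ 2 := by positivity
      calc ((m + 1) ^ 2 * B) ^ 2 = (m + 1) ^ 4 * B ^ 2 := by ring
        _ ≤ 8 * m ^ 2 * A ^ 2 := k6
        _ ≤ (2.83 * (m * A)) ^ 2 := by linarith
    refine le_of_sq_le_sq ?_ (by positivity)
    have k7 := mul_le_mul_of_nonneg_right k1 (by positivity : 0 ≤ 40 * (A ^ 2 * B))
    have k8 : m * (m * W) ^ 2 ≤ m * (40 * 2.83 * (A ^ 3 * B)) := by linarith
    have k9 := le_of_mul_le_mul_left k8 (by linarith)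
    refine k9.trans ?_
    rw [mul_pow, mul_pow, hS]
    have : 0 ≤ A ^ 3 * B := by positivity
    linarith
  rw [e1]
  calc _ ≤ m * (2 * (sinNorm Ω * U) + sinNorm Ω * W) := by
        refine mul_le_mul_of_nonneg_left ?_ (by positivity)
        refine (abs_add_le _ _).trans (add_le_add ?_ b2)
        rw [abs_mul, abs_two]
        linarith
    _ = sinNorm Ω * (2 * (m * U) + m * W) := by ring
    -- Here 2 · 0.7072 + 10.64 = 12.0544 is rounded up to 12.1.
    _ ≤ sinNorm Ω * (12.1 * (A * S)) := by
        refine mul_le_mul_of_nonneg_left ?_ hO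
        have : 0 ≤ A * S := by positivity
        linarith
    _ = _ := by ring

end IsModeLaplacian

/-! ### Integration over the sphere -/

lemma measurableSet_coordDomain : MeasurableSet coordDomain :=
  measurableSet_Ioo.prod measurableSet_Ioo

lemma sin_pos_of_mem_coordDomain {p : ℝ × ℝ} (hp : p ∈ coordDomain) : 0 < Real.sin p.1 :=
  Real.sin_pos_of_mem_Ioo hp.1

lemma integral_sphereMeasure (r : ℝ) (F : ℝ × ℝ → ℂ) :
    ∫ p, F p ∂(sphereMeasure r)
      = ∫ p in coordDomain, ((r ^ 2 * Real.sin p.1 : ℝ) : ℂ) * F p := by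
  unfold sphereMeasure
  rw [integral_withDensity_eq_integral_toReal_smul (by fun_prop) (by simp)]
  refine setIntegral_congr_fun measurableSet_coordDomain fun p hp => ?_
  have := sin_pos_of_mem_coordDomain hp
  rw [ENNReal.toReal_ofReal (by positivity), Complex.real_smul]

lemma integral_coordDomain_mul (u v : ℝ → ℂ) :
    ∫ p in coordDomain, u p.1 * v p.2
      = (∫ θ in (0 : ℝ)..Real.pi, u θ) * ∫ φ in (0 : ℝ)..(2 * Real.pi), v φ := by
  unfold coordDomain
  rw [Measure.volume_eq_prod, setIntegral_prod_mul]
  rw [intervalIntegral.integral_of_le Real.pi_pos.le,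
    intervalIntegral.integral_of_le (by positivity), integral_Ioc_eq_integral_Ioo,
    integral_Ioc_eq_integral_Ioo]

lemma integral_exp_int (k : ℤ) :
    ∫ φ in (0 : ℝ)..(2 * Real.pi), Complex.exp (Complex.I * k * φ)
      = if k = 0 then 2 * Real.pi else 0 := by
  split_ifs with hk
  · simp [hk]
  · rw [integral_exp_mul_complex (mul_ne_zero Complex.I_ne_zero (by exact_mod_cast hk))]
    have : Complex.exp (Complex.I * k * (2 * Real.pi : ℝ)) = 1 := by
      rw [Complex.exp_eq_one_iff]
      exact ⟨k, by push_cast; ring⟩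
    rw [this]
    simp

lemma integral_sphereMeasure_mul_exp (r : ℝ) (u : ℝ → ℂ) (k : ℤ) :
    ∫ p, u p.1 * Complex.exp (Complex.I * k * p.2) ∂(sphereMeasure r)
      = if k = 0 then 2 * Real.pi * r ^ 2 * ∫ θ in (0 : ℝ)..Real.pi, u θ * Real.sin θ else 0 := by
  rw [integral_sphereMeasure]
  have h := integral_coordDomain_mul (fun θ => ((r ^ 2 : ℝ) : ℂ) * (u θ * Real.sin θ))
    (fun φ => Complex.exp (Complex.I * k * φ))
  rw [integral_exp_int, intervalIntegral.integral_const_mul] at h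
  rw [show (∫ p in coordDomain, ((r ^ 2 * Real.sin p.1 : ℝ) : ℂ)
      * (u p.1 * Complex.exp (Complex.I * k * p.2)))
    = ∫ p in coordDomain, ((r ^ 2 : ℝ) : ℂ) * (u p.1 * Real.sin p.1)
      * Complex.exp (Complex.I * k * p.2) from ?_, h]
  · split_ifs
    · push_cast; ring
    · simp
  · congr 1; ext p; push_cast; ring

lemma conj_exp_mul_exp (k k' : ℤ) (φ : ℝ) :
    starRingEnd ℂ (Complex.exp (Complex.I * k * φ)) * Complex.exp (Complex.I * k' * φ)
      = Complex.exp (Complex.I * (k' - k : ℤ) * φ) := by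
  rw [← Complex.exp_conj, ← Complex.exp_add]
  congr 1
  simp
  ring

/-- The real profile of the spherical harmonic `Y_{lm}`. -/
def profile (i : HarmonicIndex) : ℝ → ℝ := legendre i.1.1 i.1.2.natAbs

lemma contDiff_profile (i : HarmonicIndex) {n : WithTop ℕ∞} : ContDiff ℝ n (profile i) :=
  contDiff_legendre _ _

lemma continuous_profile (i : HarmonicIndex) : Continuous (profile i) :=
  (contDiff_profile i (n := 0)).continuous

lemma sphericalHarmonic_eq_profile (i : HarmonicIndex) (p : ℝ × ℝ) :
    sphericalHarmonic i p = (profile i p.1 : ℂ) * Complex.exp (Complex.I * i.1.2 * p.2) :=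
  sphericalHarmonic_eq i p

lemma integral_profile_mul (i j : HarmonicIndex) (h : i.1.2 = j.1.2) :
    ∫ θ in (0 : ℝ)..Real.pi, profile i θ * profile j θ * Real.sin θ
      = if i = j then 1 / (2 * Real.pi) else 0 := by
  split_ifs with hij
  · subst hij
    exact integral_legendre_sq _ _ i.2
  · unfold profile
    rw [h]
    refine integral_legendre_mul_of_ne _ _ _ fun hl => hij ?_
    exact Subtype.ext (Prod.ext hl h)

lemma integral_conj_harmonic_mul (r : ℝ) (i j : HarmonicIndex) :
    ∫ p, starRingEnd ℂ (sphericalHarmonic i p) * sphericalHarmonic j p ∂(sphereMeasure r)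
      = if i = j then (r : ℂ) ^ 2 else 0 := by
  have h : ∀ p, starRingEnd ℂ (sphericalHarmonic i p) * sphericalHarmonic j p
      = ((profile i p.1 * profile j p.1 : ℝ) : ℂ)
        * Complex.exp (Complex.I * (j.1.2 - i.1.2 : ℤ) * p.2) := by
    intro p
    rw [sphericalHarmonic_eq_profile, sphericalHarmonic_eq_profile, map_mul, Complex.conj_ofReal,
      ← conj_exp_mul_exp]
    push_cast; ring
  simp_rw [h]
  rw [integral_sphereMeasure_mul_exp r (fun θ => ((profile i θ * profile j θ : ℝ) : ℂ))]
  by_cases hm : i.1.2 = j.1.2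
  · rw [if_pos (by omega)]
    have h2 := congrArg (fun x : ℝ => (x : ℂ)) (integral_profile_mul i j hm)
    simp only [← intervalIntegral.integral_ofReal] at h2
    simp only [Complex.ofReal_mul] at h2 ⊢
    rw [h2]
    split_ifs
    · have : (Real.pi : ℂ) ≠ 0 := by exact_mod_cast Real.pi_ne_zero
      push_cast
      field_simp
    · simp
  · rw [if_neg (by omega), if_neg (fun h => hm (by rw [h]))]

/-! ### Completeness of the spherical harmonics -/

/-- The function `sin^{|m|} θ p(cos θ) e^{imφ}`. -/
def harmonicPoly (m : ℤ) (p : ℝ[X]) (q : ℝ × ℝ) : ℂ :=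
  (polar m.natAbs p q.1 : ℂ) * Complex.exp (Complex.I * m * q.2)

/-- The space of all polynomials in `sin θ cos φ`, `sin θ sin φ`, `cos θ`. -/
def polySpan : Submodule ℂ (ℝ × ℝ → ℂ) :=
  Submodule.span ℂ (Set.range fun a : ℤ × ℝ[X] => harmonicPoly a.1 a.2)

lemma harmonicPoly_mem (m : ℤ) (p : ℝ[X]) : harmonicPoly m p ∈ polySpan :=
  Submodule.subset_span ⟨(m, p), rfl⟩

lemma degree_rodrigues (n m : ℕ) : (rodrigues (n + m) (n + m + m)).degree = n := by
  have hm : ((X ^ 2 - 1 : ℝ[X]) ^ (n + m)).Monic := by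
    apply Monic.pow
    simpa using monic_X_pow_sub_C (1 : ℝ) (n := 2) (by norm_num)
  have hd : ((X ^ 2 - 1 : ℝ[X]) ^ (n + m)).natDegree = 2 * (n + m) := by
    have h2 : (X ^ 2 - 1 : ℝ[X]).natDegree = 2 := by
      simpa using natDegree_X_pow_sub_C (n := 2) (r := (1 : ℝ))
    rw [natDegree_pow, h2]; ring
  have h1 : (rodrigues (n + m) (n + m + m)).natDegree ≤ n := by
    refine (natDegree_iterate_derivative _ _).trans ?_
    rw [hd]; omega
  have h2 : (rodrigues (n + m) (n + m + m)).coeff n ≠ 0 := by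
    unfold rodrigues
    rw [coeff_iterate_derivative]
    have : ((X ^ 2 - 1 : ℝ[X]) ^ (n + m)).coeff (n + (n + m + m)) = 1 := by
      have := hm.coeff_natDegree
      rw [hd] at this
      rw [← this]; congr 1; omega
    rw [this]
    simp [Nat.descFactorial_eq_zero_iff_lt]
  exact le_antisymm (natDegree_le_iff_degree_le.1 h1) (le_degree_of_ne_zero h2)

lemma span_rodrigues (m : ℕ) :
    Submodule.span ℝ (Set.range fun n => rodrigues (n + m) (n + m + m)) = ⊤ := by
  let S : Polynomial.Sequence ℝ := ⟨fun n => rodrigues (n + m) (n + m + m), fun n =>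
    degree_rodrigues n m⟩
  exact S.span fun i => (isUnit_iff_ne_zero.2 (leadingCoeff_ne_zero.2 (S.ne_zero i)))

/-- For fixed m, the derivatives entering the harmonics with l = n + |m| have degree exactly n,
hence span all polynomials in cos θ. Finite combinations of harmonics are thus all polynomials in
the Cartesian coordinates. -/
lemma harmonicPoly_mem_span (m : ℤ) (p : ℝ[X]) :
    harmonicPoly m p ∈ Submodule.span ℂ (Set.range sphericalHarmonic) := by
  have hp : p ∈ Submodule.span ℝ
      (Set.range fun n => rodrigues (n + m.natAbs) (n + m.natAbs + m.natAbs)) := by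
    rw [span_rodrigues]; trivial
  induction hp using Submodule.span_induction with
  | mem q hq =>
    obtain ⟨n, rfl⟩ := hq
    let i : HarmonicIndex := ⟨(n + m.natAbs, m), by simp⟩
    have hi : sphericalHarmonic i
        ∈ Submodule.span ℂ (Set.range sphericalHarmonic) := Submodule.subset_span ⟨i, rfl⟩
    have h0 : Real.sqrt ((2 * (n + m.natAbs : ℕ) + 1) / (4 * Real.pi)
        * ((n + m.natAbs - m.natAbs).factorial / (n + m.natAbs + m.natAbs).factorial))
        / (2 ^ (n + m.natAbs) * (n + m.natAbs).factorial) ≠ 0 := by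
      have : 0 < (2 * ((n + m.natAbs : ℕ) : ℝ) + 1) / (4 * Real.pi)
        * ((n + m.natAbs - m.natAbs).factorial / (n + m.natAbs + m.natAbs).factorial) := by
        positivity
      have := Real.sqrt_pos.2 this
      positivity
    convert Submodule.smul_mem _ (((_ : ℝ) : ℂ)⁻¹) hi using 1
    rotate_left
    · exact Real.sqrt ((2 * (n + m.natAbs : ℕ) + 1) / (4 * Real.pi)
        * ((n + m.natAbs - m.natAbs).factorial / (n + m.natAbs + m.natAbs).factorial))
        / (2 ^ (n + m.natAbs) * (n + m.natAbs).factorial)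
    · ext q
      rw [Pi.smul_apply, sphericalHarmonic_eq, smul_eq_mul]
      simp only [harmonicPoly, legendre, i]
      rw [Complex.ofReal_mul (Real.sqrt _ / _), mul_assoc (Complex.ofReal (Real.sqrt _ / _)),
        inv_mul_cancel_left₀]
      exact_mod_cast h0
  | zero =>
    convert Submodule.zero_mem _ using 1
    ext q; simp [harmonicPoly, polar]
  | add p q _ _ hp hq =>
    convert Submodule.add_mem _ hp hq using 1
    ext x; simp [harmonicPoly, polar]; ring
  | smul a p _ hp =>
    convert Submodule.smul_mem _ (a : ℂ) hp using 1
    ext x; simp [harmonicPoly, polar]; ring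

lemma polySpan_le : polySpan ≤ Submodule.span ℂ (Set.range sphericalHarmonic) := by
  refine Submodule.span_le.2 ?_
  rintro _ ⟨a, rfl⟩
  exact harmonicPoly_mem_span _ _

/-- The number |m| + |m'| - |m + m'| is even and nonnegative, so the surplus power of sin θ is a
power of 1 - cos² θ. -/
lemma harmonicPoly_mul (m m' : ℤ) (p p' : ℝ[X]) :
    ∃ q, harmonicPoly m p * harmonicPoly m' p' = harmonicPoly (m + m') q := by
  obtain ⟨k, hk⟩ : ∃ k, m.natAbs + m'.natAbs = (m + m').natAbs + 2 * k := by
    refine ⟨(m.natAbs + m'.natAbs - (m + m').natAbs) / 2, ?_⟩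
    omega
  refine ⟨(1 - X ^ 2) ^ k * p * p', ?_⟩
  ext x
  have h1 : Real.sin x.1 ^ m.natAbs * Real.sin x.1 ^ m'.natAbs
      = Real.sin x.1 ^ (m + m').natAbs * (1 - Real.cos x.1 ^ 2) ^ k := by
    rw [← pow_add, hk, pow_add, pow_mul, Real.sin_sq]
  have h2 : Complex.exp (Complex.I * m * x.2) * Complex.exp (Complex.I * m' * x.2)
      = Complex.exp (Complex.I * (m + m' : ℤ) * x.2) := by
    rw [← Complex.exp_add]; congr 1; push_cast; ring
  simp only [Pi.mul_apply, harmonicPoly, polar, ← h2, eval_mul, eval_pow, eval_sub, eval_one,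
    eval_X]
  have h3 := congrArg (fun x : ℝ => (x : ℂ)) h1
  push_cast at h3 ⊢
  linear_combination ((eval (Real.cos x.1) p : ℝ) : ℂ) * ((eval (Real.cos x.1) p' : ℝ) : ℂ)
    * Complex.exp (Complex.I * m * x.2) * Complex.exp (Complex.I * m' * x.2) * h3

lemma mul_mem_polySpan {F G : ℝ × ℝ → ℂ} (hF : F ∈ polySpan) (hG : G ∈ polySpan) :
    F * G ∈ polySpan := by
  have h : polySpan * polySpan ≤ polySpan := by
    unfold polySpan
    rw [Submodule.span_mul_span, Submodule.span_le]
    rintro _ ⟨_, ⟨a, rfl⟩, _, ⟨b, rfl⟩, rfl⟩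
    obtain ⟨q, hq⟩ := harmonicPoly_mul a.1 b.1 a.2 b.2
    simp only [hq]
    exact harmonicPoly_mem _ _
  exact h (Submodule.mul_mem_mul hF hG)

lemma star_mem_polySpan {F : ℝ × ℝ → ℂ} (hF : F ∈ polySpan) : star F ∈ polySpan := by
  unfold polySpan at hF
  induction hF using Submodule.span_induction with
  | mem F hF =>
    obtain ⟨a, rfl⟩ := hF
    have : star (harmonicPoly a.1 a.2) = harmonicPoly (-a.1) a.2 := by
      ext x
      simp only [Pi.star_apply, harmonicPoly, Int.natAbs_neg, RCLike.star_def, map_mul,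
        Complex.conj_ofReal, ← Complex.exp_conj]
      congr 2
      simp
    simp only [this]
    exact harmonicPoly_mem _ _
  | zero => simp
  | add F G _ _ hF hG => rw [star_add]; exact Submodule.add_mem _ hF hG
  | smul c F _ hF => rw [star_smul]; exact Submodule.smul_mem _ _ hF

lemma one_mem_polySpan : (1 : ℝ × ℝ → ℂ) ∈ polySpan := by
  convert harmonicPoly_mem 0 1 using 1
  ext x; simp [harmonicPoly, polar]

/-- The star algebra of the bounded continuous functions on the coordinate domain that are
polynomials in the Cartesian coordinates. -/
def polyAlgebra : StarSubalgebra ℂ (BoundedContinuousFunction coordDomain ℂ) where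
  carrier := {g | ∃ F ∈ polySpan, ∀ x : coordDomain, g x = F x}
  mul_mem' := by
    rintro a b ⟨F, hF, hFa⟩ ⟨G, hG, hGb⟩
    exact ⟨F * G, mul_mem_polySpan hF hG, fun x => by simp [hFa, hGb]⟩
  add_mem' := by
    rintro a b ⟨F, hF, hFa⟩ ⟨G, hG, hGb⟩
    exact ⟨F + G, Submodule.add_mem _ hF hG, fun x => by simp [hFa, hGb]⟩
  algebraMap_mem' c := ⟨c • 1, Submodule.smul_mem _ _ one_mem_polySpan, fun x => by
    simp [Algebra.algebraMap_eq_smul_one]⟩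
  star_mem' := by
    rintro a ⟨F, hF, hFa⟩
    exact ⟨star F, star_mem_polySpan hF, fun x => by simp [hFa]⟩

lemma continuous_harmonicPoly (m : ℤ) (p : ℝ[X]) : Continuous (harmonicPoly m p) := by
  have := (contDiff_polar m.natAbs p (n := 0)).continuous
  unfold harmonicPoly
  fun_prop

lemma exists_mem_polyAlgebra (m : ℤ) (p : ℝ[X]) :
    ∃ g ∈ polyAlgebra, ∀ x : coordDomain, g x = harmonicPoly m p x := by
  obtain ⟨C, hC⟩ := (isCompact_Icc.prod isCompact_Icc :
    IsCompact (Set.Icc 0 Real.pi ×ˢ Set.Icc 0 (2 * Real.pi))).exists_bound_of_continuousOn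
      (continuous_harmonicPoly m p).continuousOn
  refine ⟨BoundedContinuousFunction.ofNormedAddCommGroup (fun x : coordDomain => harmonicPoly m p x)
    ((continuous_harmonicPoly m p).comp continuous_subtype_val) C fun x => hC x
      ⟨Set.Ioo_subset_Icc_self x.2.1, Set.Ioo_subset_Icc_self x.2.2⟩,
    ⟨harmonicPoly m p, harmonicPoly_mem m p, fun x => rfl⟩, fun x => rfl⟩

/-- The value of cos θ determines θ in (0, π). Then sin θ e^{iφ} with sin θ ≠ 0 determines φ,
because two points of the open interval (0, 2π) differ by less than 2π. -/
lemma separatesPoints_polyAlgebra :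
    (polyAlgebra.map (BoundedContinuousFunction.toContinuousMapStarₐ ℂ)).SeparatesPoints := by
  intro x y hxy
  by_contra! hne
  have key : ∀ m p, harmonicPoly m p x = harmonicPoly m p y := by
    intro m p
    obtain ⟨g, hg, hgx⟩ := exists_mem_polyAlgebra m p
    rw [← hgx, ← hgx]
    exact hne _ ⟨_, ⟨g, hg, rfl⟩, rfl⟩
  apply hxy
  have h1 := key 0 X
  have h2 := key 1 1
  simp [harmonicPoly, polar] at h1 h2
  have h3 : x.1.1 = y.1.1 := Real.injOn_cos (Set.Ioo_subset_Icc_self x.2.1)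
    (Set.Ioo_subset_Icc_self y.2.1) (by exact_mod_cast h1)
  have hs : Complex.sin y.1.1 ≠ 0 := by
    exact_mod_cast (sin_pos_of_mem_coordDomain y.2).ne'
  rw [h3] at h2
  have h4 := mul_left_cancel₀ hs h2
  rw [Complex.exp_eq_exp_iff_exists_int] at h4
  obtain ⟨n, hn⟩ := h4
  have h5 : (x.1.2 : ℂ) = y.1.2 + n * (2 * Real.pi) := by
    apply mul_left_cancel₀ Complex.I_ne_zero
    linear_combination hn
  have h6 : x.1.2 = y.1.2 + n * (2 * Real.pi) := by exact_mod_cast h5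
  have hx := x.2.2
  have hy := y.2.2
  have hpi := Real.pi_pos
  have h7 : n = 0 := by
    have a1 : (n : ℝ) < 1 := by
      by_contra! hc
      nlinarith [hx.2, hy.1]
    have a2 : (-1 : ℝ) < n := by
      by_contra! hc
      nlinarith [hx.1, hy.2]
    have a1' : n < 1 := by exact_mod_cast a1
    have a2' : -1 < n := by exact_mod_cast a2
    omega
  rw [h7] at h6
  exact Subtype.ext (Prod.ext h3 (by simpa using h6))

lemma memLp_sphericalHarmonic (r : ℝ) (i : HarmonicIndex) (q : ℝ≥0∞) :
    MemLp (sphericalHarmonic i) q (sphereMeasure r) := by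
  obtain ⟨C, hC⟩ := (isCompact_Icc.prod isCompact_Icc :
    IsCompact (Set.Icc 0 Real.pi ×ˢ Set.Icc 0 (2 * Real.pi))).exists_bound_of_continuousOn
      (continuous_sphericalHarmonic i).continuousOn
  refine MemLp.of_bound (continuous_sphericalHarmonic i).aestronglyMeasurable C ?_
  filter_upwards [ae_mem_coordDomain r] with p hp
  exact hC p ⟨Set.Ioo_subset_Icc_self hp.1, Set.Ioo_subset_Icc_self hp.2⟩

lemma conj_sphericalHarmonic (i : HarmonicIndex) (p : ℝ × ℝ) :
    starRingEnd ℂ (sphericalHarmonic i p)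
      = sphericalHarmonic ⟨(i.1.1, -i.1.2), by simpa using i.2⟩ p := by
  rw [sphericalHarmonic_eq, sphericalHarmonic_eq, map_mul, Complex.conj_ofReal, ← Complex.exp_conj]
  simp

lemma integral_mul_eq_zero_of_mem_polySpan {r : ℝ} {h : ℝ × ℝ → ℝ}
    (hh : Integrable h (sphereMeasure r))
    (hY : ∀ i, ∫ p, sphericalHarmonic i p * h p ∂(sphereMeasure r) = 0) {F : ℝ × ℝ → ℂ}
    (hF : F ∈ polySpan) :
    AEStronglyMeasurable F (sphereMeasure r) ∧
      Integrable (fun p => F p * (h p : ℂ)) (sphereMeasure r) ∧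
        ∫ p, F p * h p ∂(sphereMeasure r) = 0 := by
  replace hF := polySpan_le hF
  induction hF using Submodule.span_induction with
  | mem F hF =>
    obtain ⟨i, rfl⟩ := hF
    exact ⟨(memLp_sphericalHarmonic r i 2).1,
      hh.ofReal.mul_of_top_right (memLp_sphericalHarmonic r i ⊤), hY i⟩
  | zero => exact ⟨aestronglyMeasurable_const, by simp, by simp⟩
  | add F G _ _ hF hG =>
    simp only [Pi.add_apply, add_mul]
    exact ⟨hF.1.add hG.1, hF.2.1.add hG.2.1, by
      rw [integral_add hF.2.1 hG.2.1, hF.2.2, hG.2.2, add_zero]⟩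
  | smul c F _ hF =>
    simp only [Pi.smul_apply, smul_eq_mul, mul_assoc]
    exact ⟨hF.1.const_smul c, hF.2.1.const_mul c, by
      rw [integral_const_mul, hF.2.2, mul_zero]⟩

/-- The finite measures h⁺ ds and h⁻ ds have the same integrals against the polynomial algebra, a
star subalgebra of bounded continuous functions that separates the points of the Polish space
`coordDomain`. Hence they agree, and so do their densities. -/
lemma ae_eq_zero_of_forall_integral_eq_zero_real {r : ℝ} {h : ℝ × ℝ → ℝ}
    (hh : Integrable h (sphereMeasure r))
    (hY : ∀ i, ∫ p, sphericalHarmonic i p * h p ∂(sphereMeasure r) = 0) :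
    h =ᵐ[sphereMeasure r] 0 := by
  have hopen : IsOpen coordDomain := isOpen_Ioo.prod isOpen_Ioo
  have : PolishSpace coordDomain := hopen.polishSpace
  -- The values `true` and `false` give the measures with densities h⁺ and h⁻, since
  -- `ENNReal.ofReal` truncates at zero.
  set ν : Bool → Measure (ℝ × ℝ) := fun b =>
    (sphereMeasure r).withDensity fun p => ENNReal.ofReal (if b then h p else -h p) with hν
  have hm : ∀ b : Bool, AEMeasurable (fun p => ENNReal.ofReal (if b then h p else -h p))
      (sphereMeasure r) := by
    intro b
    cases b
    · simpa using hh.1.aemeasurable.neg.ennreal_ofReal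
    · simpa using hh.1.aemeasurable.ennreal_ofReal
  have hint : ∀ b : Bool, Integrable (fun p => if b then h p else -h p) (sphereMeasure r) := by
    intro b
    cases b
    · simpa using hh.neg
    · simpa using hh
  have hfin : ∀ b, IsFiniteMeasure (ν b) := fun b =>
    isFiniteMeasure_withDensity_ofReal (hint b).2
  have hres : ∀ b, (ν b).restrict coordDomain = ν b := fun b =>
    Measure.restrict_eq_self_of_ae_mem
      ((withDensity_absolutelyContinuous _ _).ae_le (ae_mem_coordDomain r))
  have hcomap : ∀ b, IsFiniteMeasure ((ν b).comap (Subtype.val : coordDomain → ℝ × ℝ)) := by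
    intro b
    refine ⟨?_⟩
    rw [Measure.comap_apply _ Subtype.val_injective
      (fun s hs => measurableSet_coordDomain.subtype_image hs) _ MeasurableSet.univ]
    exact measure_lt_top _ _
  have hval : ∀ b, ∀ F : ℝ × ℝ → ℂ,
      ∫ x : coordDomain, F x ∂((ν b).comap (Subtype.val : coordDomain → ℝ × ℝ))
        = ∫ p, ((max (if b then h p else -h p) 0 : ℝ) : ℂ) * F p ∂(sphereMeasure r) := by
    intro b F
    rw [integral_subtype_comap measurableSet_coordDomain, hres, hν,
      integral_withDensity_eq_integral_toReal_smul₀ (hm b) (by simp)]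
    simp only [ENNReal.toReal_ofReal', Complex.real_smul]
  have heq : (ν true).comap (Subtype.val : coordDomain → ℝ × ℝ) = (ν false).comap Subtype.val := by
    refine ext_of_forall_mem_subalgebra_integral_eq_of_polish separatesPoints_polyAlgebra ?_
    rintro g ⟨F, hF, hgF⟩
    simp_rw [hgF]
    rw [hval true, hval false]
    obtain ⟨hFm, h1, h2⟩ := integral_mul_eq_zero_of_mem_polySpan hh hY hF
    have hi : ∀ b : Bool, Integrable
        (fun p => ((max (if b then h p else -h p) 0 : ℝ) : ℂ) * F p) (sphereMeasure r) := by
      intro b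
      refine Integrable.mono h1 (AEStronglyMeasurable.mul ?_ hFm)
        (Filter.Eventually.of_forall fun p => ?_)
      · exact Complex.continuous_ofReal.comp_aestronglyMeasurable
          ((hint b).1.sup aestronglyMeasurable_const)
      · rw [norm_mul, norm_mul, mul_comm, Complex.norm_real, Complex.norm_real]
        refine mul_le_mul_of_nonneg_left ?_ (norm_nonneg _)
        rw [Real.norm_eq_abs, Real.norm_eq_abs, abs_of_nonneg (le_max_right _ _)]
        cases b
        · simp [neg_le_abs]
        · simp [le_abs_self]
    rw [← sub_eq_zero, ← integral_sub (hi true) (hi false), ← h2]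
    congr 1; ext p
    rw [← sub_mul, mul_comm, ← Complex.ofReal_sub]
    congr 2
    simp only [if_true, Bool.false_eq_true, if_false]
    rcases le_total 0 (h p) with h0 | h0
    · rw [max_eq_left h0, max_eq_right (by linarith)]; ring
    · rw [max_eq_right h0, max_eq_left (by linarith)]; ring
  have heq2 : ν true = ν false := by
    rw [← hres true, ← hres false, ← map_comap_subtype_coe measurableSet_coordDomain, heq,
      map_comap_subtype_coe measurableSet_coordDomain]
  have h3 := (withDensity_eq_iff_of_sigmaFinite (hm true) (hm false)).1 heq2
  filter_upwards [h3] with p hp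
  simp only [if_true, Bool.false_eq_true, if_false] at hp
  rcases lt_trichotomy (h p) 0 with h0 | h0 | h0
  · rw [ENNReal.ofReal_of_nonpos h0.le, eq_comm, ENNReal.ofReal_eq_zero] at hp
    linarith
  · exact h0
  · rw [ENNReal.ofReal_of_nonpos (by linarith : -h p ≤ 0), ENNReal.ofReal_eq_zero] at hp
    linarith

/-- The spherical harmonics are complete in `L²`. -/
lemma ae_eq_zero_of_harmonicCoeff_eq_zero {r : ℝ} (hr : 0 < r) {f : ℝ × ℝ → ℂ}
    (hf : MemLp f 2 (sphereMeasure r)) (h : ∀ i, harmonicCoeff r f i = 0) :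
    f =ᵐ[sphereMeasure r] 0 := by
  have hfi : Integrable f (sphereMeasure r) := hf.integrable (by norm_num)
  have hi : ∀ i, Integrable (fun p => sphericalHarmonic i p * f p) (sphereMeasure r) := fun i =>
    hfi.mul_of_top_right (memLp_sphericalHarmonic r i ⊤)
  have hr' : (r : ℂ) ≠ 0 := by exact_mod_cast hr.ne'
  have h1 : ∀ i, ∫ p, starRingEnd ℂ (sphericalHarmonic i p) * f p ∂(sphereMeasure r) = 0 := by
    intro i
    have := h i
    unfold harmonicCoeff at this
    have e : ∀ p, starRingEnd ℂ (sphericalHarmonic i p / r) * f p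
        = (r : ℂ)⁻¹ * (starRingEnd ℂ (sphericalHarmonic i p) * f p) := by
      intro p
      rw [map_div₀, Complex.conj_ofReal]; ring
    simp_rw [e] at this
    rw [integral_const_mul] at this
    simpa [hr'] using this
  -- Conjugation replaces m by -m and so permutes the harmonics. Thus f and its conjugate are both
  -- orthogonal to all of them, and the real case applies to the real and imaginary parts.
  have h2 : ∀ i, ∫ p, sphericalHarmonic i p * f p ∂(sphereMeasure r) = 0 := by
    intro i
    have := h1 ⟨(i.1.1, -i.1.2), by simpa using i.2⟩
    simp only [conj_sphericalHarmonic, neg_neg] at this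
    exact this
  have h3 : ∀ i, ∫ p, sphericalHarmonic i p * starRingEnd ℂ (f p) ∂(sphereMeasure r) = 0 := by
    intro i
    have := congrArg (starRingEnd ℂ) (h1 i)
    rw [← integral_conj] at this
    simpa using this
  have hi3 : ∀ i, Integrable (fun p => sphericalHarmonic i p * starRingEnd ℂ (f p))
      (sphereMeasure r) := fun i =>
    (hf.star.integrable (by norm_num)).mul_of_top_right (memLp_sphericalHarmonic r i ⊤)
  have hre := ae_eq_zero_of_forall_integral_eq_zero_real (h := fun p => (f p).re) hfi.re (by
    intro i
    have : ∀ p, sphericalHarmonic i p * ((f p).re : ℂ)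
        = (1 / 2) * (sphericalHarmonic i p * f p + sphericalHarmonic i p * starRingEnd ℂ (f p)) := by
      intro p
      rw [← mul_add, Complex.add_conj]; push_cast; ring
    simp_rw [this]
    rw [integral_const_mul, integral_add (hi i) (hi3 i), h2, h3]; simp)
  have him := ae_eq_zero_of_forall_integral_eq_zero_real (h := fun p => (f p).im) hfi.im (by
    intro i
    have : ∀ p, sphericalHarmonic i p * ((f p).im : ℂ)
        = (1 / (2 * Complex.I)) * (sphericalHarmonic i p * f p
          - sphericalHarmonic i p * starRingEnd ℂ (f p)) := by
      intro p
      rw [← mul_sub, Complex.sub_conj]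
      field_simp
      push_cast; ring
    simp_rw [this]
    rw [integral_const_mul, integral_sub (hi i) (hi3 i), h2, h3]; simp)
  filter_upwards [hre, him] with p h1 h2
  exact Complex.ext h1 h2

/-- The element `Y_{lm} / r` of `L²`. -/
def harmonicLp (r : ℝ) (i : HarmonicIndex) : Lp ℂ 2 (sphereMeasure r) :=
  ((memLp_sphericalHarmonic r i 2).mul_const (r : ℂ)⁻¹).toLp

lemma coeFn_harmonicLp (r : ℝ) (i : HarmonicIndex) :
    harmonicLp r i =ᵐ[sphereMeasure r] fun p => sphericalHarmonic i p / r := by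
  filter_upwards [MemLp.coeFn_toLp ((memLp_sphericalHarmonic r i 2).mul_const (r : ℂ)⁻¹)] with p hp
  rw [div_eq_mul_inv]; exact hp

lemma inner_harmonicLp (r : ℝ) (i : HarmonicIndex) (f : Lp ℂ 2 (sphereMeasure r)) :
    inner ℂ (harmonicLp r i) f = harmonicCoeff r f i := by
  rw [L2.inner_def]
  unfold harmonicCoeff
  refine integral_congr_ae ?_
  filter_upwards [coeFn_harmonicLp r i] with p hp
  rw [hp, RCLike.inner_apply, mul_comm]

lemma harmonicCoeff_sphericalHarmonic {r : ℝ} (hr : 0 < r) (i j : HarmonicIndex) :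
    harmonicCoeff r (sphericalHarmonic j) i = if i = j then (r : ℂ) else 0 := by
  have hr' : (r : ℂ) ≠ 0 := by exact_mod_cast hr.ne'
  unfold harmonicCoeff
  have e : ∀ p, starRingEnd ℂ (sphericalHarmonic i p / r) * sphericalHarmonic j p
      = (r : ℂ)⁻¹ * (starRingEnd ℂ (sphericalHarmonic i p) * sphericalHarmonic j p) := by
    intro p
    rw [map_div₀, Complex.conj_ofReal]; ring
  simp_rw [e]
  rw [integral_const_mul, integral_conj_harmonic_mul]
  split_ifs
  · field_simp
  · simp

lemma orthonormal_harmonicLp {r : ℝ} (hr : 0 < r) : Orthonormal ℂ (harmonicLp r) := by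
  have hr' : (r : ℂ) ≠ 0 := by exact_mod_cast hr.ne'
  classical
  rw [orthonormal_iff_ite]
  intro i j
  rw [inner_harmonicLp, harmonicCoeff_congr r (coeFn_harmonicLp r j)]
  have := harmonicCoeff_sphericalHarmonic hr i j
  unfold harmonicCoeff at this ⊢
  simp_rw [← mul_div_assoc]
  rw [integral_div, this]
  split_ifs
  · field_simp
  · simp

/-- The orthonormal basis `Y_{lm} / r` of `L²` of the sphere of radius `r`. -/
def harmonicBasis {r : ℝ} (hr : 0 < r) : HilbertBasis HarmonicIndex ℂ (Lp ℂ 2 (sphereMeasure r)) :=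
  HilbertBasis.mkOfOrthogonalEqBot (orthonormal_harmonicLp hr) (by
    rw [Submodule.eq_bot_iff]
    intro f hf
    rw [Submodule.mem_orthogonal] at hf
    have h := ae_eq_zero_of_harmonicCoeff_eq_zero hr (Lp.memLp f) fun i => by
      rw [← inner_harmonicLp]
      exact hf _ (Submodule.subset_span ⟨i, rfl⟩)
    exact (Lp.eq_zero_iff_ae_eq_zero).2 h)

lemma harmonicBasis_repr {r : ℝ} (hr : 0 < r) (f : Lp ℂ 2 (sphereMeasure r)) (i : HarmonicIndex) :
    (harmonicBasis hr).repr f i = harmonicCoeff r f i := by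
  rw [HilbertBasis.repr_apply_apply, harmonicBasis, HilbertBasis.coe_mkOfOrthogonalEqBot,
    inner_harmonicLp]

/-! ### The space `H²_⋄` as a sequence space -/

/-- The indices of the mean-zero spherical harmonics. -/
abbrev PosIndex : Type := {i : HarmonicIndex // 1 ≤ i.1.1}

/-- The space `ℓ²` of coefficients. -/
abbrev CoeffSpace : Type := lp (fun _ : PosIndex => ℂ) 2

/-- The finite linear combination of mean-zero spherical harmonics with given coefficients. -/
def harmonicSum (c : PosIndex →₀ ℂ) : ℝ × ℝ → ℂ :=
  Finsupp.linearCombination ℂ (fun i : PosIndex => sphericalHarmonic i.1) c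

lemma harmonicSum_apply (c : PosIndex →₀ ℂ) (p : ℝ × ℝ) :
    harmonicSum c p = ∑ i ∈ c.support, c i * sphericalHarmonic i.1 p := by
  simp [harmonicSum, Finsupp.linearCombination_apply, Finsupp.sum]

lemma mem_harmonicSpan_iff {f : ℝ × ℝ → ℂ} : f ∈ harmonicSpan ↔ ∃ c, harmonicSum c = f := by
  unfold harmonicSpan harmonicSum
  rw [show sphericalHarmonic '' {i | 1 ≤ i.1.1}
    = Set.range (fun i : PosIndex => sphericalHarmonic i.1) by
      ext; simp [Set.mem_image], Finsupp.mem_span_range_iff_exists_finsupp]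
  rfl

lemma memLp_harmonicSum (r : ℝ) (c : PosIndex →₀ ℂ) (q : ℝ≥0∞) :
    MemLp (harmonicSum c) q (sphereMeasure r) := by
  have : harmonicSum c = fun p => ∑ i ∈ c.support, c i * sphericalHarmonic i.1 p :=
    funext (harmonicSum_apply c)
  rw [this]
  exact memLp_finsetSum _ fun i _ => (memLp_sphericalHarmonic r i.1 q).const_mul _

lemma eigenvalue_pos {r : ℝ} (hr : 0 < r) (i : PosIndex) : 0 < eigenvalue r i.1 := by
  have := i.2
  unfold eigenvalue
  have h : (1 : ℝ) ≤ i.1.1.1 := by exact_mod_cast this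
  positivity

lemma two_div_le_eigenvalue {r : ℝ} (hr : 0 < r) (i : PosIndex) : 2 / r ^ 2 ≤ eigenvalue r i.1 := by
  have := i.2
  unfold eigenvalue
  have h : (1 : ℝ) ≤ i.1.1.1 := by exact_mod_cast this
  gcongr
  nlinarith

lemma harmonicCoeff_harmonicSum {r : ℝ} (hr : 0 < r) (c : PosIndex →₀ ℂ) (i : HarmonicIndex) :
    harmonicCoeff r (harmonicSum c) i
      = if h : 1 ≤ i.1.1 then (r : ℂ) * c ⟨i, h⟩ else 0 := by
  have h1 : harmonicCoeff r (harmonicSum c) i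
      = ∑ j ∈ c.support, c j * harmonicCoeff r (sphericalHarmonic j.1) i := by
    unfold harmonicCoeff
    simp_rw [harmonicSum_apply, Finset.mul_sum]
    rw [integral_finsetSum]
    · refine Finset.sum_congr rfl fun j _ => ?_
      rw [← integral_const_mul]
      congr 1; ext p; ring
    · intro j _
      simp_rw [mul_left_comm _ (c j)]
      exact (integrable_harmonic_mul r (memLp_sphericalHarmonic r j.1 2) i).const_mul _
  rw [h1]
  simp_rw [harmonicCoeff_sphericalHarmonic hr]
  split_ifs with h
  · rw [Finset.sum_eq_single ⟨i, h⟩]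
    · simp [mul_comm]
    · intro j _ hj
      rw [if_neg, mul_zero]
      rintro rfl
      exact hj rfl
    · intro hi
      simp only [Finsupp.mem_support_iff, not_not] at hi
      simp [hi]
  · refine Finset.sum_eq_zero fun j _ => ?_
    rw [if_neg, mul_zero]
    rintro rfl
    exact h j.2

/-- The index `(0, 0)` of the constant spherical harmonic. -/
def zeroIndex : HarmonicIndex := ⟨(0, 0), by simp⟩

lemma eq_zeroIndex {i : HarmonicIndex} (hi : ¬ 1 ≤ i.1.1) : i = zeroIndex := by
  have h0 : i.1.1 = 0 := by omega
  have h1 := i.2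
  rw [h0] at h1
  exact Subtype.ext (Prod.ext h0 (by simpa [zeroIndex] using h1))

lemma sphericalHarmonic_zeroIndex (p : ℝ × ℝ) :
    sphericalHarmonic zeroIndex p = (Real.sqrt (1 / (4 * Real.pi)) : ℝ) := by
  simp [sphericalHarmonic, zeroIndex]

lemma harmonicCoeff_zeroIndex (r : ℝ) (f : ℝ × ℝ → ℂ) :
    harmonicCoeff r f zeroIndex
      = ((Real.sqrt (1 / (4 * Real.pi)) / r : ℝ) : ℂ) * ∫ p, f p ∂(sphereMeasure r) := by
  unfold harmonicCoeff
  rw [← integral_const_mul]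
  congr 1; ext p
  rw [sphericalHarmonic_zeroIndex, ← Complex.ofReal_div, Complex.conj_ofReal]

/-- Mean zero means a vanishing (0, 0) coefficient. This allows the sums for the mean-zero spaces to
run over `PosIndex`, where all eigenvalues are positive. -/
lemma harmonicCoeff_zeroIndex_eq_zero_iff {r : ℝ} (hr : 0 < r) (f : ℝ × ℝ → ℂ) :
    harmonicCoeff r f zeroIndex = 0 ↔ ∫ p, f p ∂(sphereMeasure r) = 0 := by
  rw [harmonicCoeff_zeroIndex, mul_eq_zero, or_iff_right]
  have : Real.sqrt (1 / (4 * Real.pi)) / r ≠ 0 :=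
    (div_pos (Real.sqrt_pos.2 (by positivity)) hr).ne'
  exact_mod_cast this

lemma exists_hDiamond_eq {r : ℝ} (hr : 0 < r) (s : ℝ≥0) (c : PosIndex →₀ ℂ) :
    ∃ Ψ : HDiamond r s, Ψ.toFun =ᵐ[sphereMeasure r] harmonicSum c := by
  have h := (memLp_harmonicSum r c 2).coeFn_toLp
  refine ⟨⟨(memLp_harmonicSum r c 2).toLp, ⟨⟨Lp.memLp _, ?_⟩, ?_⟩⟩, h⟩
  · have hc := harmonicCoeff_congr r h
    refine summable_of_hasFiniteSupport (Set.Finite.subset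
      ((c.support.map (Function.Embedding.subtype _)).finite_toSet) fun i hi => ?_)
    rw [Function.mem_support, hc, harmonicCoeff_harmonicSum hr] at hi
    split_ifs at hi with h1
    · rw [Finset.mem_coe, Finset.mem_map]
      refine ⟨⟨i, h1⟩, ?_, rfl⟩
      rw [Finsupp.mem_support_iff]
      intro h2
      simp [h2] at hi
    · simp at hi
  · rw [integral_congr_ae h, ← harmonicCoeff_zeroIndex_eq_zero_iff hr, harmonicCoeff_harmonicSum hr]
    simp [zeroIndex]

lemma HDiamond.harmonicCoeff_zeroIndex {r : ℝ} (hr : 0 < r) {s : ℝ≥0} (f : HDiamond r s) :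
    harmonicCoeff r f.toFun zeroIndex = 0 :=
  (harmonicCoeff_zeroIndex_eq_zero_iff hr _).2 f.2.2

/-- The norm of `H^s_⋄` as a sum over the mean-zero harmonics. -/
lemma norm_sq_eq_tsum_posIndex {r : ℝ} (hr : 0 < r) (s : ℝ≥0) (f : HDiamond r s) :
    ‖f‖ ^ 2 = ∑' i : PosIndex, eigenvalue r i.1 ^ (s : ℝ) * ‖harmonicCoeff r f.toFun i.1‖ ^ 2 := by
  rw [norm_sq_eq]
  refine (tsum_subtype_eq_of_support_subset (s := {i : HarmonicIndex | 1 ≤ i.1.1})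
    (fun i hi => ?_)).symm
  by_contra h
  rw [Set.mem_ofPred_eq] at h
  rw [Function.mem_support, eq_zeroIndex h, f.harmonicCoeff_zeroIndex hr] at hi
  simp at hi

lemma summable_hDiamond {r : ℝ} (f : HDiamond r 2) :
    Summable fun i : PosIndex => ‖(eigenvalue r i.1 : ℂ) * harmonicCoeff r f.toFun i.1‖ ^ 2 := by
  have h := (lp.memℓp (diamondMap r 2 f)).summable (by norm_num)
  have h2 := h.comp_injective (Subtype.val_injective (p := fun i : HarmonicIndex => 1 ≤ i.1.1))
  refine h2.congr fun i => ?_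
  simp only [Function.comp, ENNReal.toReal_ofNat, Real.rpow_ofNat]
  change ‖((eigenvalue r i.1 ^ (((2 : ℝ≥0) : ℝ) / 2) : ℝ) : ℂ) * harmonicCoeff r f.toFun i.1‖ ^ 2 = _
  norm_num

/-- The coefficients of `-Δ_h f`. -/
def coeffMap (r : ℝ) : HDiamond r 2 →ₗ[ℂ] CoeffSpace where
  toFun f := ⟨fun i => (eigenvalue r i.1 : ℂ) * harmonicCoeff r f.toFun i.1, by
    refine memℓp_gen ?_
    simpa using summable_hDiamond f⟩
  map_add' f g := by
    ext i
    change _ * harmonicCoeff r (f.1 + g.1 : Lp ℂ 2 (sphereMeasure r)) i.1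
      = _ * harmonicCoeff r f.1 i.1 + _ * harmonicCoeff r g.1 i.1
    rw [harmonicCoeff_add]; ring
  map_smul' c f := by
    ext i
    change _ * harmonicCoeff r (c • f.1 : Lp ℂ 2 (sphereMeasure r)) i.1
      = c * (_ * harmonicCoeff r f.1 i.1)
    rw [harmonicCoeff_smul]; ring

lemma coeffMap_apply (r : ℝ) (f : HDiamond r 2) (i : PosIndex) :
    coeffMap r f i = (eigenvalue r i.1 : ℂ) * harmonicCoeff r f.toFun i.1 := rfl

lemma norm_sq_coeffSpace (x : CoeffSpace) : ‖x‖ ^ 2 = ∑' i, ‖x i‖ ^ 2 := by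
  have h := lp.norm_rpow_eq_tsum (p := 2) (by norm_num) x
  simpa using h

lemma summable_coeffSpace (x : CoeffSpace) : Summable fun i => ‖x i‖ ^ 2 := by
  simpa using (lp.memℓp x).summable (by norm_num)

lemma norm_coeffMap {r : ℝ} (hr : 0 < r) (f : HDiamond r 2) : ‖coeffMap r f‖ = ‖f‖ := by
  rw [← sq_eq_sq₀ (norm_nonneg _) (norm_nonneg _), norm_sq_coeffSpace, norm_sq_eq_tsum_posIndex hr]
  refine tsum_congr fun i => ?_
  rw [coeffMap_apply, norm_mul, mul_pow, Complex.norm_real,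
    Real.norm_of_nonneg (eigenvalue_nonneg _ _)]
  norm_num

/-- Injectivity is completeness of the harmonics. For surjectivity, x is divided by the eigenvalues,
extended by zero to the index (0, 0) and synthesized in the Hilbert basis; the spectral gap λ ≥ 2/r²
keeps all sums finite. -/
lemma coeffMap_bijective {r : ℝ} (hr : 0 < r) : Function.Bijective (coeffMap r) := by
  constructor
  · rw [← LinearMap.ker_eq_bot, LinearMap.ker_eq_bot']
    intro f hf
    have h0 : ∀ i, harmonicCoeff r f.toFun i = 0 := by
      intro i
      by_cases hi : 1 ≤ i.1.1
      · have := congrArg (fun x : CoeffSpace => x ⟨i, hi⟩) hf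
        simp only [coeffMap_apply] at this
        have h2 : (eigenvalue r i : ℂ) ≠ 0 := by
          exact_mod_cast (eigenvalue_pos hr ⟨i, hi⟩).ne'
        exact (mul_eq_zero.1 this).resolve_left h2
      · rw [eq_zeroIndex hi, f.harmonicCoeff_zeroIndex hr]
    have h1 := ae_eq_zero_of_harmonicCoeff_eq_zero hr (Lp.memLp f.1) h0
    exact Subtype.ext ((Lp.eq_zero_iff_ae_eq_zero).2 h1)
  · intro x
    let c : HarmonicIndex → ℂ := fun i =>
      if h : 1 ≤ i.1.1 then (eigenvalue r i : ℂ)⁻¹ * x ⟨i, h⟩ else 0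
    have hsum : ∀ w : HarmonicIndex → ℝ, (∃ K, ∀ i : PosIndex, ‖w i.1 * (eigenvalue r i.1)⁻¹ ^ 2‖ ≤ K)
        → Summable fun i => w i * ‖c i‖ ^ 2 := by
      rintro w ⟨K, hK⟩
      rw [← (Subtype.val_injective (p := fun i : HarmonicIndex => 1 ≤ i.1.1)).summable_iff]
      · refine Summable.of_norm_bounded ((summable_coeffSpace x).mul_left K) fun i => ?_
        have h1 : c i.1 = (eigenvalue r i.1 : ℂ)⁻¹ * x i := by
          simp only [c]; rw [dif_pos i.2]
        simp only [Function.comp, h1, norm_mul, mul_pow, norm_inv, Complex.norm_real,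
          Real.norm_of_nonneg (eigenvalue_nonneg r i.1)]
        rw [← mul_assoc, Real.norm_of_nonneg (sq_nonneg ‖x i‖), ← norm_mul]
        exact mul_le_mul_of_nonneg_right (hK i) (sq_nonneg _)
      · intro i hi
        have h : ¬ 1 ≤ i.1.1 := fun h => hi ⟨⟨i, h⟩, rfl⟩
        simp [c, h]
    have hinv : ∀ i : PosIndex, (eigenvalue r i.1)⁻¹ ≤ r ^ 2 / 2 := by
      intro i
      rw [← inv_div]
      exact inv_anti₀ (by positivity) (two_div_le_eigenvalue hr i)
    have hc : Memℓp c 2 := by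
      refine memℓp_gen ?_
      have := hsum 1 ⟨(r ^ 2 / 2) ^ 2, fun i => by
        have h1 := hinv i
        have h2 := inv_nonneg.2 (eigenvalue_nonneg r i.1)
        rw [Pi.one_apply, one_mul, Real.norm_of_nonneg (by positivity)]
        gcongr⟩
      simpa using this
    let F : Lp ℂ 2 (sphereMeasure r) := (harmonicBasis hr).repr.symm ⟨c, hc⟩
    have hF : ∀ i, harmonicCoeff r F i = c i := by
      intro i
      rw [← harmonicBasis_repr hr]
      simp [F]
    refine ⟨⟨F, ⟨⟨Lp.memLp _, ?_⟩, ?_⟩⟩, ?_⟩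
    · simp_rw [hF]
      -- The ratio ((1 + λ)/λ)² = (1/λ + 1)² is bounded by means of λ ≥ 2/r².
      refine hsum _ ⟨(r ^ 2 / 2 + 1) ^ 2, fun i => ?_⟩
      have h1 := hinv i
      have h2 := eigenvalue_pos hr i
      have h3 : (1 + eigenvalue r i.1) ^ (((2 : ℝ≥0)) : ℝ) * (eigenvalue r i.1)⁻¹ ^ 2
          = ((eigenvalue r i.1)⁻¹ + 1) ^ 2 := by
        rw [NNReal.coe_ofNat, Real.rpow_ofNat, ← mul_pow]
        congr 1
        field_simp
      rw [h3, Real.norm_of_nonneg (by positivity)]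
      gcongr
    · rw [← harmonicCoeff_zeroIndex_eq_zero_iff hr, hF]
      simp [c, zeroIndex]
    · ext i
      change (eigenvalue r i.1 : ℂ) * harmonicCoeff r F i.1 = x i
      have h2 : (eigenvalue r i.1 : ℂ) ≠ 0 := by exact_mod_cast (eigenvalue_pos hr i).ne'
      simp only [hF, c]
      rw [dif_pos i.2, mul_inv_cancel_left₀ h2]

/-- The isometric isomorphism of `H²_⋄` onto the space of the coefficients of `-Δ_h f`. -/
def coeffEquiv {r : ℝ} (hr : 0 < r) : HDiamond r 2 ≃ₗᵢ[ℂ] CoeffSpace where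
  toLinearEquiv := LinearEquiv.ofBijective (coeffMap r) (coeffMap_bijective hr)
  norm_map' := norm_coeffMap hr

lemma coeffEquiv_apply {r : ℝ} (hr : 0 < r) (f : HDiamond r 2) (i : PosIndex) :
    coeffEquiv hr f i = (eigenvalue r i.1 : ℂ) * harmonicCoeff r f.toFun i.1 := rfl

/-! ### Zonal functions of class `H¹` -/

lemma restrict_coordDomain_absolutelyContinuous {r : ℝ} (hr : 0 < r) :
    volume.restrict coordDomain ≪ sphereMeasure r := by
  refine withDensity_absolutelyContinuous' (by fun_prop) ?_
  filter_upwards [ae_restrict_mem measurableSet_coordDomain] with p hp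
  have := sin_pos_of_mem_coordDomain hp
  rw [Ne, ENNReal.ofReal_eq_zero, not_le]
  positivity

lemma restrict_coordDomain_eq :
    volume.restrict coordDomain = (volume.restrict (Set.Ioc 0 Real.pi)).prod
      (volume.restrict (Set.Ioc 0 (2 * Real.pi))) := by
  unfold coordDomain
  rw [Measure.volume_eq_prod, ← Measure.prod_restrict, restrict_Ioo_eq_restrict_Ioc,
    restrict_Ioo_eq_restrict_Ioc]

lemma restrict_Ioc_two_pi_ne_zero : volume.restrict (Set.Ioc 0 (2 * Real.pi)) ≠ 0 := by
  have := Real.pi_pos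
  simp [Measure.restrict_eq_zero, Real.pi_pos]

variable {r : ℝ} {Ω : ℝ → ℝ}

lemma aestronglyMeasurable_of_zonal (hr : 0 < r)
    (hΩ : AEStronglyMeasurable (zonal Ω) (sphereMeasure r)) :
    AEStronglyMeasurable Ω (volume.restrict (Set.Ioc 0 Real.pi)) := by
  have h1 := hΩ.mono_ac (restrict_coordDomain_absolutelyContinuous hr)
  rw [restrict_coordDomain_eq] at h1
  have h2 : AEStronglyMeasurable (fun p : ℝ × ℝ => Ω p.1) ((volume.restrict (Set.Ioc 0 Real.pi)).prod
      (volume.restrict (Set.Ioc 0 (2 * Real.pi)))) := by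
    simpa [zonal] using Complex.continuous_re.comp_aestronglyMeasurable h1
  exact h2.of_comp_fst restrict_Ioc_two_pi_ne_zero

lemma integrableOn_sq_mul_sin_of_zonal (hr : 0 < r) (hΩ : MemLp (zonal Ω) 2 (sphereMeasure r)) :
    IntegrableOn (fun θ => Ω θ ^ 2 * Real.sin θ) (Set.Ioc 0 Real.pi) := by
  have h1 := hΩ.integrable_norm_pow (by norm_num)
  unfold sphereMeasure at h1
  rw [integrable_withDensity_iff_integrable_smul' (by fun_prop) (by simp),
    restrict_coordDomain_eq] at h1
  have h2 : Integrable (fun p : ℝ × ℝ => r ^ 2 * (Ω p.1 ^ 2 * Real.sin p.1))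
      ((volume.restrict (Set.Ioc 0 Real.pi)).prod
      (volume.restrict (Set.Ioc 0 (2 * Real.pi)))) := by
    refine h1.congr ?_
    rw [← restrict_coordDomain_eq]
    filter_upwards [ae_restrict_mem measurableSet_coordDomain] with p hp
    have := sin_pos_of_mem_coordDomain hp
    rw [ENNReal.toReal_ofReal (by positivity)]
    simp [zonal]
    ring
  have h3 := Integrable.of_comp_fst (f := fun θ => r ^ 2 * (Ω θ ^ 2 * Real.sin θ)) h2
    restrict_Ioc_two_pi_ne_zero
  have hr' : r ^ 2 ≠ 0 := by positivity
  exact (integrable_const_mul_iff (IsUnit.mk0 _ hr') _).1 h3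

lemma integral_norm_zonal_sq (r : ℝ) (Ω : ℝ → ℝ) :
    ∫ p, (‖zonal Ω p‖ ^ 2 : ℝ) ∂(sphereMeasure r) = 2 * Real.pi * r ^ 2 * sinNorm Ω ^ 2 := by
  have h := integral_sphereMeasure_mul_exp r (fun θ => ((Ω θ ^ 2 : ℝ) : ℂ)) 0
  have h2 : ∀ p : ℝ × ℝ, ((Ω p.1 ^ 2 : ℝ) : ℂ) * Complex.exp (Complex.I * (0 : ℤ) * p.2)
      = ((‖zonal Ω p‖ ^ 2 : ℝ) : ℂ) := by
    intro p
    simp [zonal, -Complex.ofReal_pow]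
  simp_rw [h2] at h
  rw [integral_complex_ofReal, if_pos trivial] at h
  have h3 : ∫ θ in (0 : ℝ)..Real.pi, ((Ω θ ^ 2 : ℝ) : ℂ) * Real.sin θ = (sinNorm Ω ^ 2 : ℝ) := by
    rw [sinNorm_sq, ← intervalIntegral.integral_ofReal]
    simp
  rw [h3] at h
  exact_mod_cast h

lemma integral_norm_sq_eq_tsum (hr : 0 < r) {f : ℝ × ℝ → ℂ} (hf : MemLp f 2 (sphereMeasure r)) :
    Summable (fun i => ‖harmonicCoeff r f i‖ ^ 2) ∧
    ∫ p, (‖f p‖ ^ 2 : ℝ) ∂(sphereMeasure r) = ∑' i, ‖harmonicCoeff r f i‖ ^ 2 := by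
  have h0 : ∀ i, (harmonicBasis hr).repr (hf.toLp f) i = harmonicCoeff r f i := fun i => by
    rw [harmonicBasis_repr, harmonicCoeff_congr r hf.coeFn_toLp]
  have h1 := lp.norm_rpow_eq_tsum (p := 2) (by norm_num) ((harmonicBasis hr).repr (hf.toLp f))
  have h2 := (lp.memℓp ((harmonicBasis hr).repr (hf.toLp f))).summable (by norm_num)
  rw [LinearIsometryEquiv.norm_map] at h1
  simp only [ENNReal.toReal_ofNat, Real.rpow_ofNat, h0] at h1 h2
  refine ⟨h2, ?_⟩
  rw [← h1]
  have h3 := L2.inner_def (𝕜 := ℂ) (hf.toLp f) (hf.toLp f)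
  rw [inner_self_eq_norm_sq_to_K] at h3
  have h4 : ∫ p, inner ℂ (hf.toLp f p) (hf.toLp f p) ∂(sphereMeasure r)
      = ((∫ p, (‖f p‖ ^ 2 : ℝ) ∂(sphereMeasure r) : ℝ) : ℂ) := by
    rw [← integral_complex_ofReal]
    refine integral_congr_ae ?_
    filter_upwards [hf.coeFn_toLp] with p hp
    rw [hp, inner_self_eq_norm_sq_to_K]
    simp
  rw [h4] at h3
  exact (Complex.ofReal_injective (by simpa using h3)).symm

lemma sinNorm_sq_le_sobolevNorm_sq (hr : 0 < r) (hΩ : MemSobolev r 1 (zonal Ω)) :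
    2 * Real.pi * r ^ 2 * sinNorm Ω ^ 2 ≤ sobolevNorm r 1 (zonal Ω) ^ 2 := by
  obtain ⟨h1, h2⟩ := integral_norm_sq_eq_tsum hr hΩ.1
  rw [← integral_norm_zonal_sq, h2]
  unfold sobolevNorm
  have h0 : ∀ i, 0 ≤ (1 + eigenvalue r i) ^ ((1 : ℝ≥0) : ℝ) * ‖harmonicCoeff r (zonal Ω) i‖ ^ 2 := by
    intro i
    have := eigenvalue_nonneg r i
    positivity
  rw [Real.sq_sqrt (tsum_nonneg h0)]
  refine h1.tsum_le_tsum (fun i => ?_) hΩ.2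
  have := eigenvalue_nonneg r i
  refine le_mul_of_one_le_left (sq_nonneg _) ?_
  simpa using this

lemma harmonicCoeff_const (hr : 0 < r) (a : ℂ) {i : HarmonicIndex} (hi : i ≠ zeroIndex) :
    harmonicCoeff r (fun _ => a) i = 0 := by
  have h := harmonicCoeff_sphericalHarmonic hr i zeroIndex
  rw [if_neg hi] at h
  have hs : ((Real.sqrt (1 / (4 * Real.pi)) : ℝ) : ℂ) ≠ 0 := by
    have : 0 < Real.sqrt (1 / (4 * Real.pi)) := by
      have := Real.pi_pos
      positivity
    exact_mod_cast this.ne'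
  unfold harmonicCoeff at h ⊢
  simp_rw [sphericalHarmonic_zeroIndex] at h
  rw [integral_mul_const] at h ⊢
  rw [(mul_eq_zero.1 h).resolve_right hs, zero_mul]

lemma MemSobolev.zonal_sub_const (hr : 0 < r) (hΩ : MemSobolev r 1 (zonal Ω)) (a : ℝ) :
    MemSobolev r 1 (zonal fun θ => Ω θ - a) := by
  have e : zonal (fun θ => Ω θ - a) = fun p => zonal Ω p - (a : ℂ) := by
    funext p; simp [zonal]
  have hm : MemLp (zonal fun θ => Ω θ - a) 2 (sphereMeasure r) := by
    rw [e]
    exact hΩ.1.sub (memLp_const _)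
  refine ⟨hm, ?_⟩
  refine (summable_congr_cofinite ?_).1 hΩ.2
  filter_upwards [(Set.finite_singleton zeroIndex).compl_mem_cofinite] with i hi
  have : harmonicCoeff r (zonal fun θ => Ω θ - a) i = harmonicCoeff r (zonal Ω) i := by
    have h1 : harmonicCoeff r (zonal fun θ => Ω θ - a) i
        = harmonicCoeff r (zonal Ω) i - harmonicCoeff r (fun _ => (a : ℂ)) i := by
      unfold harmonicCoeff
      rw [← integral_sub (integrable_harmonic_mul r hΩ.1 i)
        (integrable_harmonic_mul r (memLp_const _) i)]
      simp_rw [e, mul_sub]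
    rw [h1, harmonicCoeff_const hr _ hi, sub_zero]
  rw [this]

/-! ### Parseval identities in the polar angle -/

lemma integral_sum_profile_comp_mul {ι : Type*} {k : ι → HarmonicIndex} (hk : k.Injective)
    (t : Finset ι) (a b : ι → ℝ) {m : ℤ} (ht : ∀ i ∈ t, (k i).1.2 = m) :
    ∫ θ in (0 : ℝ)..Real.pi,
        (∑ i ∈ t, a i * profile (k i) θ) * (∑ i ∈ t, b i * profile (k i) θ) * Real.sin θ
      = (∑ i ∈ t, a i * b i) / (2 * Real.pi) := by
  have hc : ∀ i j, Continuous (fun θ => a i * b j * (profile (k i) θ * profile (k j) θ * Real.sin θ)) := by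
    intro i j
    have h1 := continuous_profile (k i)
    have h2 := continuous_profile (k j)
    fun_prop
  have e : ∀ θ, (∑ i ∈ t, a i * profile (k i) θ) * (∑ i ∈ t, b i * profile (k i) θ) * Real.sin θ
      = ∑ i ∈ t, ∑ j ∈ t, a i * b j * (profile (k i) θ * profile (k j) θ * Real.sin θ) := by
    intro θ
    rw [Finset.sum_mul_sum, Finset.sum_mul]
    refine Finset.sum_congr rfl fun i _ => ?_
    rw [Finset.sum_mul]
    exact Finset.sum_congr rfl fun j _ => by ring
  simp_rw [e]
  rw [intervalIntegral.integral_finsetSum fun i _ =>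
    (continuous_finsetSum _ fun j _ => hc i j).intervalIntegrable _ _, Finset.sum_div]
  refine Finset.sum_congr rfl fun i hi => ?_
  rw [intervalIntegral.integral_finsetSum fun j _ => (hc i j).intervalIntegrable _ _]
  rw [Finset.sum_eq_single_of_mem i hi]
  · rw [intervalIntegral.integral_const_mul, integral_profile_mul (k i) (k i) rfl, if_pos rfl]; ring
  · intro j hj hji
    rw [intervalIntegral.integral_const_mul, integral_profile_mul (k i) (k j) (by rw [ht i hi, ht j hj]),
      if_neg fun h => hji (hk h).symm, mul_zero]

lemma integral_sum_profile_mul (t : Finset HarmonicIndex) (a b : HarmonicIndex → ℝ) {m : ℤ}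
    (ht : ∀ i ∈ t, i.1.2 = m) :
    ∫ θ in (0 : ℝ)..Real.pi, (∑ i ∈ t, a i * profile i θ) * (∑ i ∈ t, b i * profile i θ) * Real.sin θ
      = (∑ i ∈ t, a i * b i) / (2 * Real.pi) :=
  integral_sum_profile_comp_mul Function.injective_id t a b ht

/-- A Hardy inequality that removes the weight sin θ. The derivative of g² sin θ cos θ integrates to
zero and contains g² (1 - 2 sin² θ), which supplies the unweighted square; the cross term is
absorbed by completing a square. -/
lemma integral_sq_le {g : ℝ → ℝ} (hg : ContDiff ℝ 1 g) :
    ∫ θ in (0 : ℝ)..Real.pi, g θ ^ 2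
      ≤ 3 * (∫ θ in (0 : ℝ)..Real.pi, g θ ^ 2 * Real.sin θ)
        + ∫ θ in (0 : ℝ)..Real.pi, deriv g θ ^ 2 * Real.sin θ := by
  have h0 := hg.continuous
  have h1 : Continuous (deriv g) := hg.continuous_deriv le_rfl
  have hd : ∀ θ ∈ Set.uIcc 0 Real.pi, HasDerivAt (fun t => g t ^ 2 * (Real.sin t * Real.cos t))
      (2 * g θ * deriv g θ * (Real.sin θ * Real.cos θ) + g θ ^ 2 * (1 - 2 * Real.sin θ ^ 2)) θ := by
    intro θ _
    have h2 := (hg.differentiable (by norm_num) θ).hasDerivAt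
    refine ((h2.fun_pow 2).mul ((Real.hasDerivAt_sin θ).mul (Real.hasDerivAt_cos θ))).congr_deriv ?_
    simp only [Pi.mul_apply]
    push_cast
    nlinarith [Real.sin_sq_add_cos_sq θ]
  have h3 := intervalIntegral.integral_eq_sub_of_hasDerivAt hd
    (Continuous.intervalIntegrable (by fun_prop) _ _)
  simp only [Real.sin_pi, Real.sin_zero, zero_mul, mul_zero, sub_zero] at h3
  have i1 : IntervalIntegrable (fun θ => g θ ^ 2) volume 0 Real.pi :=
    Continuous.intervalIntegrable (by fun_prop) _ _
  have i2 : IntervalIntegrable (fun θ => g θ ^ 2 * Real.sin θ) volume 0 Real.pi :=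
    Continuous.intervalIntegrable (by fun_prop) _ _
  have i3 : IntervalIntegrable (fun θ => deriv g θ ^ 2 * Real.sin θ) volume 0 Real.pi :=
    Continuous.intervalIntegrable (by fun_prop) _ _
  have h4 : (∫ θ in (0 : ℝ)..Real.pi, g θ ^ 2 - (3 * (g θ ^ 2 * Real.sin θ)
      + deriv g θ ^ 2 * Real.sin θ)) ≤ 0 := by
    refine le_of_le_of_eq ?_ h3
    refine intervalIntegral.integral_mono_on Real.pi_pos.le (i1.sub ((i2.const_mul 3).add i3))
      (Continuous.intervalIntegrable (u := fun θ => 2 * g θ * deriv g θ * (Real.sin θ * Real.cos θ)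
        + g θ ^ 2 * (1 - 2 * Real.sin θ ^ 2)) (by fun_prop) _ _) fun θ hθ => ?_
    have hs := Real.sin_nonneg_of_nonneg_of_le_pi hθ.1 hθ.2
    have hs1 := Real.sin_le_one θ
    have hk : 0 ≤ (g θ + deriv g θ * Real.cos θ) ^ 2 * Real.sin θ := by positivity
    have hk2 : 0 ≤ deriv g θ ^ 2 * Real.sin θ * (1 - Real.cos θ ^ 2) :=
      mul_nonneg (by positivity) (by nlinarith [Real.cos_le_one θ, Real.neg_one_le_cos θ])
    have hk3 : 0 ≤ g θ ^ 2 * Real.sin θ * (1 - Real.sin θ) :=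
      mul_nonneg (by positivity) (by linarith)
    nlinarith
  rw [intervalIntegral.integral_sub i1 ((i2.const_mul 3).add i3),
    intervalIntegral.integral_add (i2.const_mul 3) i3, intervalIntegral.integral_const_mul] at h4
  linarith

/-- The unit eigenvalue `l(l+1)`. -/
def unitEigenvalue (i : HarmonicIndex) : ℝ := (i.1.1 : ℝ) * (i.1.1 + 1)

lemma unitEigenvalue_nonneg (i : HarmonicIndex) : 0 ≤ unitEigenvalue i := by
  unfold unitEigenvalue; positivity

lemma eigenvalue_eq (r : ℝ) (i : HarmonicIndex) : eigenvalue r i = unitEigenvalue i / r ^ 2 := rfl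

lemma contDiff_sum_profile (t : Finset HarmonicIndex) (a : HarmonicIndex → ℝ) {n : WithTop ℕ∞} :
    ContDiff ℝ n (fun θ => ∑ i ∈ t, a i * profile i θ) :=
  ContDiff.sum fun i _ => contDiff_const.mul (contDiff_profile i)

/-- Integration by parts with the Sturm-Liouville equation for m = 0, followed by orthogonality. -/
lemma integral_deriv_sum_profile_sq (t : Finset HarmonicIndex) (a : HarmonicIndex → ℝ)
    (ht : ∀ i ∈ t, i.1.2 = 0) :
    ∫ θ in (0 : ℝ)..Real.pi, deriv (fun θ => ∑ i ∈ t, a i * profile i θ) θ ^ 2 * Real.sin θ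
      = (∑ i ∈ t, unitEigenvalue i * a i ^ 2) / (2 * Real.pi) := by
  set g := fun θ => ∑ i ∈ t, a i * profile i θ with hg
  have hgc : ContDiff ℝ 2 g := contDiff_sum_profile t a
  have h0 : Continuous g := hgc.continuous
  have h1 : Continuous (deriv g) := hgc.continuous_deriv (by norm_num)
  set k := fun θ => ∑ i ∈ t, (unitEigenvalue i * a i) * profile i θ with hk
  have hkc : Continuous k := (contDiff_sum_profile t _ (n := 0)).continuous
  have hd1 : ∀ θ, deriv g θ = ∑ i ∈ t, a i * deriv (profile i) θ := by
    intro θ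
    rw [hg, deriv_fun_sum fun i _ => ((contDiff_profile i (n := 1)).differentiable
      (by norm_num) θ).const_mul _]
    refine Finset.sum_congr rfl fun i _ => ?_
    rw [deriv_const_mul _ ((contDiff_profile i (n := 1)).differentiable (by norm_num) θ)]
  have hd2 : ∀ θ ∈ Set.Ioo 0 Real.pi,
      HasDerivAt (fun t => Real.sin t * deriv g t) (-(k θ * Real.sin θ)) θ := by
    intro θ hθ
    have hs := Real.sin_pos_of_mem_Ioo hθ
    have e : (fun t => Real.sin t * deriv g t)
        = fun x => ∑ i ∈ t, a i * (Real.sin x * deriv (profile i) x) := by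
      funext x
      rw [hd1, Finset.mul_sum]
      exact Finset.sum_congr rfl fun i _ => by ring
    rw [e]
    have : ∀ i ∈ t, HasDerivAt (fun x => a i * (Real.sin x * deriv (profile i) x))
        (-(unitEigenvalue i * a i * profile i θ * Real.sin θ)) θ := by
      intro i hi
      have hdiff : DifferentiableAt ℝ (fun x => Real.sin x * deriv (profile i) x) θ :=
        (Real.differentiable_sin θ).mul
          (((contDiff_profile i (n := 2)).deriv' (n := 1)).differentiable (by norm_num) θ)
      have h2 := sturmLiouville_legendre i.1.1 i.1.2.natAbs θ
      rw [ht i hi] at h2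
      have h3 : deriv (fun x => Real.sin x * deriv (profile i) x) θ
          = -(unitEigenvalue i * profile i θ * Real.sin θ) := by
        refine mul_left_cancel₀ hs.ne' ?_
        unfold profile unitEigenvalue
        rw [ht i hi, h2]
        simp
        ring
      refine (hdiff.hasDerivAt.const_mul (a i)).congr_deriv ?_
      rw [h3]; ring
    refine (HasDerivAt.fun_sum this).congr_deriv ?_
    rw [hk, Finset.sum_mul, Finset.sum_neg_distrib]
  have hd3 : ∀ θ ∈ Set.Ioo 0 Real.pi, HasDerivAt (fun t => g t * (Real.sin t * deriv g t))
      (deriv g θ * (Real.sin θ * deriv g θ) + g θ * (-(k θ * Real.sin θ))) θ := fun θ hθ =>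
    (hgc.differentiable (by norm_num) θ).hasDerivAt.mul (hd2 θ hθ)
  have h3 := intervalIntegral.integral_eq_sub_of_hasDerivAt_of_le Real.pi_pos.le
    (Continuous.continuousOn (by fun_prop)) hd3 (Continuous.intervalIntegrable (by fun_prop) _ _)
  simp only [Real.sin_pi, Real.sin_zero, zero_mul, mul_zero, sub_zero] at h3
  rw [intervalIntegral.integral_add (Continuous.intervalIntegrable (by fun_prop) _ _)
    (Continuous.intervalIntegrable (by fun_prop) _ _)] at h3
  have h4 := integral_sum_profile_mul t a (fun i => unitEigenvalue i * a i) ht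
  have h5 : ∫ θ in (0 : ℝ)..Real.pi, g θ * (-(k θ * Real.sin θ))
      = -∫ θ in (0 : ℝ)..Real.pi, g θ * k θ * Real.sin θ := by
    rw [← intervalIntegral.integral_neg]
    congr 1; ext θ; ring
  have h6 : ∫ θ in (0 : ℝ)..Real.pi, deriv g θ * (Real.sin θ * deriv g θ)
      = ∫ θ in (0 : ℝ)..Real.pi, deriv g θ ^ 2 * Real.sin θ := by
    congr 1; ext θ; ring
  rw [h5, h6, h4] at h3
  rw [show (∑ i ∈ t, unitEigenvalue i * a i ^ 2) = ∑ i ∈ t, a i * (unitEigenvalue i * a i) from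
    Finset.sum_congr rfl fun i _ => by ring]
  linarith

/-- This is what the H¹ regularity of Ω is for, besides the norms in the frequency bound. In the
α-pairing Ω stands against functions that need not vanish at the poles, so it must be integrable for
dθ and not only for sin θ dθ. The Hardy inequality `integral_sq_le` bounds the partial sums of the
harmonic expansion uniformly, and Fatou's lemma passes to the limit. -/
lemma memLp_two_of_zonal (hr : 0 < r) (hΩ : MemSobolev r 1 (zonal Ω)) :
    MemLp (fun p : ℝ × ℝ => Ω p.1) 2 (volume.restrict coordDomain) := by
  have hac := restrict_coordDomain_absolutelyContinuous hr
  have hm : AEStronglyMeasurable (fun p : ℝ × ℝ => Ω p.1) (volume.restrict coordDomain) := by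
    simpa [zonal] using Complex.continuous_re.comp_aestronglyMeasurable (hΩ.1.1.mono_ac hac)
  set c := harmonicCoeff r (zonal Ω) with hc
  -- A zonal function has no coefficients of azimuthal order m ≠ 0.
  have hcm : ∀ i : HarmonicIndex, i.1.2 ≠ 0 → c i = 0 := by
    intro i hi
    have h := integral_sphereMeasure_mul_exp r
      (fun θ => (r : ℂ)⁻¹ * (profile i θ * Ω θ)) (-i.1.2)
    rw [if_neg (by omega)] at h
    rw [hc, harmonicCoeff, ← h]
    congr 1; ext p
    rw [sphericalHarmonic_eq_profile, map_div₀, map_mul, Complex.conj_ofReal, Complex.conj_ofReal,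
      ← Complex.exp_conj]
    simp [zonal]
    ring
  -- the real parts of the partial sums of the expansion
  let g : Finset HarmonicIndex → ℝ → ℝ := fun t θ =>
    ∑ i ∈ t with i.1.2 = 0, ((c i).re / r) * profile i θ
  set K := ∑' i, (1 + eigenvalue r i) ^ ((1 : ℝ≥0) : ℝ) * ‖c i‖ ^ 2 with hK
  have h0 : ∀ i, 0 ≤ (1 + eigenvalue r i) ^ ((1 : ℝ≥0) : ℝ) * ‖c i‖ ^ 2 := by
    intro i
    have := eigenvalue_nonneg r i
    positivity
  have hK0 : 0 ≤ K := tsum_nonneg h0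
  have hbound : ∀ t, ∫ θ in (0 : ℝ)..Real.pi, g t θ ^ 2
      ≤ (3 / r ^ 2 + 1) * K / (2 * Real.pi) := by
    intro t
    have ht : ∀ i ∈ t.filter (fun i => i.1.2 = 0), i.1.2 = 0 := fun i hi => (Finset.mem_filter.1 hi).2
    have h1 := integral_sq_le (contDiff_sum_profile (t.filter (fun i => i.1.2 = 0))
      (fun i => (c i).re / r))
    have h2 := integral_sum_profile_mul _ (fun i => (c i).re / r) (fun i => (c i).re / r) ht
    simp_rw [← sq] at h2
    rw [h2, integral_deriv_sum_profile_sq _ _ ht, ← mul_div_assoc, ← add_div] at h1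
    refine h1.trans ?_
    refine div_le_div_of_nonneg_right ?_ (by positivity)
    rw [Finset.mul_sum, ← Finset.sum_add_distrib]
    have h3 : ∑ i ∈ t with i.1.2 = 0, (1 + eigenvalue r i) ^ ((1 : ℝ≥0) : ℝ) * ‖c i‖ ^ 2 ≤ K :=
      Summable.sum_le_tsum _ (fun i _ => h0 i) hΩ.2
    refine le_trans ?_ (mul_le_mul_of_nonneg_left h3 (by positivity))
    rw [Finset.mul_sum]
    refine Finset.sum_le_sum fun i _ => ?_
    have h4 : (c i).re ^ 2 ≤ ‖c i‖ ^ 2 := by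
      rw [sq_le_sq, abs_norm]
      exact Complex.abs_re_le_norm _
    have h5 := eigenvalue_nonneg r i
    have h6 : unitEigenvalue i * ((c i).re / r) ^ 2 = eigenvalue r i * (c i).re ^ 2 := by
      rw [eigenvalue_eq, div_pow]; field_simp
    rw [h6, div_pow, NNReal.coe_one, Real.rpow_one]
    have h7 : (3 / r ^ 2 + eigenvalue r i) * (c i).re ^ 2
        ≤ (3 / r ^ 2 + eigenvalue r i) * ‖c i‖ ^ 2 := by gcongr
    have h8 : (3 / r ^ 2 + eigenvalue r i) * ‖c i‖ ^ 2
        ≤ ((3 / r ^ 2 + 1) * (1 + eigenvalue r i)) * ‖c i‖ ^ 2 := by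
      gcongr
      have : 0 ≤ 3 / r ^ 2 * eigenvalue r i := by positivity
      nlinarith
    calc _ = (3 / r ^ 2 + eigenvalue r i) * (c i).re ^ 2 := by ring
      _ ≤ _ := h7.trans h8
      _ = _ := by ring
  -- convergence almost everywhere along a subsequence
  have hsum := (harmonicBasis hr).hasSum_repr (hΩ.1.toLp (zonal Ω))
  obtain ⟨ts, -, hts⟩ := (tendstoInMeasure_of_tendsto_Lp hsum).exists_seq_tendsto_ae'
  have hcoe : ∀ t : Finset HarmonicIndex,
      (↑(∑ i ∈ t, (harmonicBasis hr).repr (hΩ.1.toLp (zonal Ω)) i • (harmonicBasis hr) i) :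
        ℝ × ℝ → ℂ) =ᵐ[sphereMeasure r] fun p => ∑ i ∈ t, c i * (sphericalHarmonic i p / r) := by
    intro t
    have h1 : ∀ i, (harmonicBasis hr).repr (hΩ.1.toLp (zonal Ω)) i • (harmonicBasis hr) i
        = c i • harmonicLp r i := by
      intro i
      rw [harmonicBasis_repr, harmonicCoeff_congr r hΩ.1.coeFn_toLp, harmonicBasis,
        HilbertBasis.coe_mkOfOrthogonalEqBot]
    simp_rw [h1]
    have h2 : ∀ i, ↑(c i • harmonicLp r i) =ᵐ[sphereMeasure r]
        fun p => c i * (sphericalHarmonic i p / r) := by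
      intro i
      filter_upwards [Lp.coeFn_smul (c i) (harmonicLp r i), coeFn_harmonicLp r i] with p h3 h4
      rw [h3, Pi.smul_apply, h4, smul_eq_mul]
    have h3 : ∀ᵐ p ∂(sphereMeasure r), ∀ i ∈ t,
        (c i • harmonicLp r i : Lp ℂ 2 (sphereMeasure r)) p = c i * (sphericalHarmonic i p / r) :=
      (Finset.eventually_all t).2 fun i _ => h2 i
    filter_upwards [Lp.coeFn_finsetSum t (fun i => c i • harmonicLp r i), h3] with p h4 h5
    rw [h4, Finset.sum_apply]
    exact Finset.sum_congr rfl h5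
  have hre : ∀ t : Finset HarmonicIndex, ∀ p : ℝ × ℝ,
      (∑ i ∈ t, c i * (sphericalHarmonic i p / r)).re = g t p.1 := by
    intro t p
    simp only [g]
    rw [Complex.re_sum, Finset.sum_filter]
    refine Finset.sum_congr rfl fun i _ => ?_
    split_ifs with hi
    · rw [sphericalHarmonic_eq_profile, hi]
      have : (profile i p.1 : ℂ) * Complex.exp (Complex.I * ((0 : ℤ) : ℂ) * p.2) / (r : ℂ)
          = ((profile i p.1 / r : ℝ) : ℂ) := by
        simp
      rw [this, Complex.re_mul_ofReal]
      ring
    · rw [hcm i hi]; simp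
  have hlim : ∀ᵐ p ∂(volume.restrict coordDomain),
      Filter.Tendsto (fun n => g (ts n) p.1) Filter.atTop (nhds (Ω p.1)) := by
    refine hac.ae_le ?_
    filter_upwards [hts, ae_all_iff.2 fun n => hcoe (ts n), hΩ.1.coeFn_toLp] with p h1 h2 h3
    rw [h3] at h1
    simp_rw [h2] at h1
    have h4 := (Complex.continuous_re.tendsto _).comp h1
    simpa [Function.comp_def, hre, zonal] using h4
  -- Fatou
  have hgc : ∀ t, Continuous (g t) := fun t => (contDiff_sum_profile _ _ (n := 0)).continuous
  refine ⟨hm, ?_⟩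
  set M := ENNReal.ofReal (2 * Real.pi * ((3 / r ^ 2 + 1) * K / (2 * Real.pi))) ^ (1 / 2 : ℝ) with hM
  have hle : ∀ n, eLpNorm (fun p : ℝ × ℝ => g (ts n) p.1) 2 (volume.restrict coordDomain) ≤ M := by
    intro n
    rw [eLpNorm_eq_lintegral_rpow_enorm_toReal (by norm_num) (by norm_num)]
    simp only [ENNReal.toReal_ofNat]
    refine ENNReal.rpow_le_rpow ?_ (by norm_num)
    have h1 : ∀ p : ℝ × ℝ, ‖g (ts n) p.1‖ₑ ^ (2 : ℝ) = ENNReal.ofReal (g (ts n) p.1 ^ 2) := by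
      intro p
      rw [Real.enorm_eq_ofReal_abs, ENNReal.ofReal_rpow_of_nonneg (abs_nonneg _) (by norm_num)]
      norm_num
    simp_rw [h1]
    have hci : Integrable (fun p : ℝ × ℝ => g (ts n) p.1 ^ 2) (volume.restrict coordDomain) := by
      rw [restrict_coordDomain_eq]
      exact Integrable.comp_fst (f := fun θ => g (ts n) θ ^ 2)
        (Continuous.integrableOn_zero_pi ((hgc _).pow 2)) _
    rw [← ofReal_integral_eq_lintegral_ofReal hci (Filter.Eventually.of_forall fun p => sq_nonneg _)]
    refine ENNReal.ofReal_le_ofReal ?_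
    have h2 : ∫ p in coordDomain, g (ts n) p.1 ^ 2
        = (∫ θ in (0 : ℝ)..Real.pi, g (ts n) θ ^ 2) * (2 * Real.pi) := by
      rw [restrict_coordDomain_eq]
      rw [integral_fun_fst (f := fun θ => g (ts n) θ ^ 2), intervalIntegral.integral_of_le Real.pi_pos.le]
      simp [Real.pi_pos.le, mul_comm]
    rw [h2, mul_comm]
    exact mul_le_mul_of_nonneg_left (hbound _) (by positivity)
  have hfin : M < ∞ := ENNReal.rpow_lt_top_of_nonneg (by norm_num) ENNReal.ofReal_ne_top
  refine lt_of_le_of_lt ?_ hfin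
  refine (Lp.eLpNorm_lim_le_liminf_eLpNorm (fun n => ?_) _ hlim).trans
    (Filter.liminf_le_of_le (by isBoundedDefault) fun b hb => ?_)
  · exact ((hgc _).comp continuous_fst).aestronglyMeasurable
  · obtain ⟨n, hn⟩ := hb.exists
    exact hn.trans (hle n)

lemma integrableOn_of_zonal (hr : 0 < r) (hΩ : MemSobolev r 1 (zonal Ω)) :
    IntegrableOn Ω (Set.Ioc 0 Real.pi) := by
  have h := memLp_two_of_zonal hr hΩ
  rw [restrict_coordDomain_eq] at h
  exact Integrable.of_comp_fst (f := Ω) (h.integrable (by norm_num)) restrict_Ioc_two_pi_ne_zero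

/-! ### The pairing in terms of coefficients -/

/-- A finite combination of mean-zero spherical harmonics. -/
def finiteSum (t : Finset PosIndex) (a : PosIndex → ℂ) (p : ℝ × ℝ) : ℂ :=
  ∑ i ∈ t, a i * sphericalHarmonic i.1 p

lemma harmonicSum_eq_finiteSum (c : PosIndex →₀ ℂ) : harmonicSum c = finiteSum c.support c :=
  funext (harmonicSum_apply c)

lemma differentiable_profile (i : HarmonicIndex) : Differentiable ℝ (profile i) :=
  (contDiff_profile i (n := 1)).differentiable (by norm_num)

lemma differentiable_deriv_profile (i : HarmonicIndex) : Differentiable ℝ (deriv (profile i)) :=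
  ((contDiff_profile i (n := 2)).deriv' (n := 1)).differentiable (by norm_num)

lemma hasDerivAt_sphericalHarmonic_phi (i : HarmonicIndex) (θ φ : ℝ) :
    HasDerivAt (fun t : ℝ => sphericalHarmonic i (θ, t))
      (Complex.I * i.1.2 * sphericalHarmonic i (θ, φ)) φ := by
  have h1 : HasDerivAt (fun t : ℝ => Complex.I * i.1.2 * (t : ℂ)) (Complex.I * i.1.2) φ := by
    simpa using (Complex.ofRealCLM.hasDerivAt (x := φ)).const_mul (Complex.I * i.1.2)
  have h2 := (h1.cexp).const_mul (profile i θ : ℂ)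
  simp_rw [sphericalHarmonic_eq_profile]
  exact h2.congr_deriv (by ring)

lemma dPhi_finiteSum (t : Finset PosIndex) (a : PosIndex → ℂ) :
    dPhi (finiteSum t a) = finiteSum t fun i => Complex.I * i.1.1.2 * a i := by
  funext p
  unfold dPhi finiteSum
  refine (HasDerivAt.fun_sum fun i _ =>
    (hasDerivAt_sphericalHarmonic_phi i.1 p.1 p.2).const_mul (a i)).deriv.trans ?_
  exact Finset.sum_congr rfl fun i _ => by ring

lemma hasDerivAt_sphericalHarmonic_theta (i : HarmonicIndex) (θ φ : ℝ) :
    HasDerivAt (fun t : ℝ => sphericalHarmonic i (t, φ))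
      (((deriv (profile i) θ : ℝ) : ℂ) * Complex.exp (Complex.I * i.1.2 * φ)) θ := by
  simp_rw [sphericalHarmonic_eq_profile]
  exact (differentiable_profile i θ).hasDerivAt.ofReal_comp.mul_const _

lemma dTheta_finiteSum (t : Finset PosIndex) (a : PosIndex → ℂ) (p : ℝ × ℝ) :
    dTheta (finiteSum t a) p = ∑ i ∈ t, a i *
      (((deriv (profile i.1) p.1 : ℝ) : ℂ) * Complex.exp (Complex.I * i.1.1.2 * p.2)) :=
  (HasDerivAt.fun_sum fun i _ =>
    (hasDerivAt_sphericalHarmonic_theta i.1 p.1 p.2).const_mul (a i)).deriv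

lemma deriv_sin_mul_deriv_profile (i : HarmonicIndex) {θ : ℝ} (hθ : Real.sin θ ≠ 0) :
    deriv (fun t => Real.sin t * deriv (profile i) t) θ
      = (i.1.2 ^ 2 / Real.sin θ - unitEigenvalue i * Real.sin θ) * profile i θ := by
  refine mul_left_cancel₀ hθ ?_
  have h := sturmLiouville_legendre i.1.1 i.1.2.natAbs θ
  change Real.sin θ * deriv (fun t => Real.sin t * deriv (profile i) t) θ = _ * profile i θ at h
  have h2 : ((i.1.2.natAbs : ℕ) : ℝ) ^ 2 = (i.1.2 : ℝ) ^ 2 := by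
    rw [Nat.cast_natAbs, Int.cast_abs, sq_abs]
  rw [h, h2]
  unfold unitEigenvalue
  field_simp

lemma laplaceBeltrami_finiteSum {r : ℝ} (hr : 0 < r) (t : Finset PosIndex) (a : PosIndex → ℂ)
    {p : ℝ × ℝ} (hp : p.1 ∈ Set.Ioo 0 Real.pi) :
    laplaceBeltrami r (finiteSum t a) p = finiteSum t (fun i => -eigenvalue r i.1 * a i) p := by
  have hs := (Real.sin_pos_of_mem_Ioo hp).ne'
  have hs' : (Real.sin p.1 : ℂ) ≠ 0 := by exact_mod_cast hs
  have hr' : (r : ℂ) ≠ 0 := by exact_mod_cast hr.ne'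
  unfold laplaceBeltrami
  rw [dPhi_finiteSum, dPhi_finiteSum]
  have h1 : dTheta (fun q => (Real.sin q.1 : ℂ) * dTheta (finiteSum t a) q) p
      = ∑ i ∈ t, a i * (((i.1.1.2 ^ 2 / Real.sin p.1 - unitEigenvalue i.1 * Real.sin p.1)
        * profile i.1 p.1 : ℝ) * Complex.exp (Complex.I * i.1.1.2 * p.2)) := by
    unfold dTheta
    have e : (fun x : ℝ => (Real.sin (x, p.2).1 : ℂ) * deriv (fun t' => finiteSum t a (t', (x, p.2).2)) (x, p.2).1)
        = fun x => ∑ i ∈ t, a i * (((Real.sin x * deriv (profile i.1) x : ℝ) : ℂ)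
          * Complex.exp (Complex.I * i.1.1.2 * p.2)) := by
      funext x
      have := dTheta_finiteSum t a (x, p.2)
      unfold dTheta at this
      rw [this, Finset.mul_sum]
      exact Finset.sum_congr rfl fun i _ => by push_cast; ring
    rw [e]
    refine (HasDerivAt.fun_sum fun i _ => HasDerivAt.const_mul (a i)
      (HasDerivAt.mul_const (HasDerivAt.ofReal_comp ?_) _)).deriv
    rw [← deriv_sin_mul_deriv_profile i.1 hs]
    exact ((Real.differentiable_sin p.1).mul (differentiable_deriv_profile i.1 p.1)).hasDerivAt
  rw [h1]
  unfold finiteSum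
  rw [Finset.mul_sum, Finset.mul_sum, ← Finset.sum_add_distrib]
  refine Finset.sum_congr rfl fun i _ => ?_
  simp only [sphericalHarmonic_eq_profile, eigenvalue_eq]
  have hI : Complex.I * i.1.1.2 * (Complex.I * i.1.1.2 * a i) = -(i.1.1.2 : ℂ) ^ 2 * a i := by
    linear_combination ((i.1.1.2 : ℂ) ^ 2 * a i) * Complex.I_sq
  rw [hI]
  simp only [Complex.ofReal_mul, Complex.ofReal_sub, Complex.ofReal_div, Complex.ofReal_pow,
    Complex.ofReal_intCast]
  field_simp
  ring

/-- The eigenvalue relation holds only for θ in (0, π), where sin θ ≠ 0. Locality of the operator is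
needed to apply it a second time in Δ_h². -/
lemma laplaceBeltrami_congr (r : ℝ) {f g : ℝ × ℝ → ℂ}
    (h : ∀ q : ℝ × ℝ, q.1 ∈ Set.Ioo 0 Real.pi → f q = g q) {p : ℝ × ℝ}
    (hp : p.1 ∈ Set.Ioo 0 Real.pi) : laplaceBeltrami r f p = laplaceBeltrami r g p := by
  have h1 : ∀ f g : ℝ × ℝ → ℂ, (∀ q : ℝ × ℝ, q.1 ∈ Set.Ioo 0 Real.pi → f q = g q) →
      ∀ q : ℝ × ℝ, q.1 ∈ Set.Ioo 0 Real.pi → dTheta f q = dTheta g q := by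
    intro f g h q hq
    refine Filter.EventuallyEq.deriv_eq ?_
    filter_upwards [isOpen_Ioo.mem_nhds hq] with x hx
    exact h (x, q.2) hx
  have h2 : ∀ f g : ℝ × ℝ → ℂ, (∀ q : ℝ × ℝ, q.1 ∈ Set.Ioo 0 Real.pi → f q = g q) →
      ∀ q : ℝ × ℝ, q.1 ∈ Set.Ioo 0 Real.pi → dPhi f q = dPhi g q := by
    intro f g h q hq
    unfold dPhi
    congr 1
    funext x
    exact h (q.1, x) hq
  unfold laplaceBeltrami
  rw [h2 _ _ (h2 _ _ h) p hp, h1 _ _ (fun q hq => by rw [h1 _ _ h q hq]) p hp]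

/-- The coefficients of multiplication by a zonal function. -/
def zonalEntry (u : ℝ → ℝ) (i j : HarmonicIndex) : ℝ :=
  ∫ θ in (0 : ℝ)..Real.pi, u θ * (profile i θ * profile j θ) * Real.sin θ

/-- The coefficients of multiplication by `α_Ω`. -/
def alphaEntry (Ω : ℝ → ℝ) (i j : HarmonicIndex) : ℝ :=
  ∫ θ in (0 : ℝ)..Real.pi, Ω θ * alphaOp (fun t => profile i t * profile j t) θ

lemma finiteSum_mul_conj (t t' : Finset PosIndex) (a b : PosIndex → ℂ) (p : ℝ × ℝ) :
    finiteSum t a p * starRingEnd ℂ (finiteSum t' b p)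
      = ∑ i ∈ t, ∑ j ∈ t', a i * starRingEnd ℂ (b j) *
        (((profile i.1 p.1 * profile j.1 p.1 : ℝ) : ℂ)
          * Complex.exp (Complex.I * (i.1.1.2 - j.1.1.2 : ℤ) * p.2)) := by
  unfold finiteSum
  rw [map_sum, Finset.sum_mul_sum]
  refine Finset.sum_congr rfl fun i _ => Finset.sum_congr rfl fun j _ => ?_
  rw [sphericalHarmonic_eq_profile, sphericalHarmonic_eq_profile, ← conj_exp_mul_exp, map_mul,
    map_mul, Complex.conj_ofReal]
  push_cast; ring

lemma integral_zonal_mul {r : ℝ} {u : ℝ → ℝ} (hu : MemLp (zonal u) 2 (sphereMeasure r))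
    (t t' : Finset PosIndex) (a b : PosIndex → ℂ) :
    Integrable (fun p => (u p.1 : ℂ) * (finiteSum t a p * starRingEnd ℂ (finiteSum t' b p)))
      (sphereMeasure r) ∧
    ∫ p, (u p.1 : ℂ) * (finiteSum t a p * starRingEnd ℂ (finiteSum t' b p)) ∂(sphereMeasure r)
      = ∑ i ∈ t, ∑ j ∈ t', a i * starRingEnd ℂ (b j) *
        if i.1.1.2 = j.1.1.2 then 2 * Real.pi * r ^ 2 * (zonalEntry u i.1 j.1 : ℂ) else 0 := by
  have e : ∀ p : ℝ × ℝ, (u p.1 : ℂ) * (finiteSum t a p * starRingEnd ℂ (finiteSum t' b p))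
      = ∑ i ∈ t, ∑ j ∈ t', a i * starRingEnd ℂ (b j) *
        (((u p.1 * (profile i.1 p.1 * profile j.1 p.1) : ℝ) : ℂ)
          * Complex.exp (Complex.I * (i.1.1.2 - j.1.1.2 : ℤ) * p.2)) := by
    intro p
    rw [finiteSum_mul_conj, Finset.mul_sum]
    refine Finset.sum_congr rfl fun i _ => ?_
    rw [Finset.mul_sum]
    refine Finset.sum_congr rfl fun j _ => ?_
    push_cast; ring
  have hi : ∀ i j : PosIndex, Integrable (fun p : ℝ × ℝ => a i * starRingEnd ℂ (b j) *
        (((u p.1 * (profile i.1 p.1 * profile j.1 p.1) : ℝ) : ℂ)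
          * Complex.exp (Complex.I * (i.1.1.2 - j.1.1.2 : ℤ) * p.2))) (sphereMeasure r) := by
    intro i j
    refine Integrable.const_mul ?_ _
    have h1 := (memLp_sphericalHarmonic r i.1 ⊤).star.mul (memLp_sphericalHarmonic r j.1 ⊤)
      (r := ⊤)
    have h2 := (hu.integrable (by norm_num)).mul_of_top_right
      ((memLp_sphericalHarmonic r j.1 ⊤).star.mul (memLp_sphericalHarmonic r i.1 ⊤) (r := ⊤))
    refine h2.congr (Filter.Eventually.of_forall fun p => ?_)
    simp only [Pi.mul_apply, Pi.star_apply, sphericalHarmonic_eq_profile, zonal,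
      ← conj_exp_mul_exp, RCLike.star_def, map_mul, Complex.conj_ofReal]
    push_cast; ring
  simp_rw [e]
  refine ⟨integrable_finsetSum _ fun i _ => integrable_finsetSum _ fun j _ => hi i j, ?_⟩
  rw [integral_finsetSum _ fun i _ => integrable_finsetSum _ fun j _ => hi i j]
  refine Finset.sum_congr rfl fun i _ => ?_
  rw [integral_finsetSum _ fun j _ => hi i j]
  refine Finset.sum_congr rfl fun j _ => ?_
  rw [integral_const_mul, integral_sphereMeasure_mul_exp r
    (fun θ => ((u θ * (profile i.1 θ * profile j.1 θ) : ℝ) : ℂ))]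
  congr 1
  simp only [sub_eq_zero]
  split_ifs
  · unfold zonalEntry
    rw [← intervalIntegral.integral_ofReal]
    push_cast; rfl
  · rfl

lemma zonalEntry_one (i j : HarmonicIndex) (h : i.1.2 = j.1.2) :
    zonalEntry (fun _ => 1) i j = if i = j then 1 / (2 * Real.pi) else 0 := by
  unfold zonalEntry
  simp_rw [one_mul]
  exact integral_profile_mul i j h

lemma integral_finiteSum_mul_conj (r : ℝ) (t t' : Finset PosIndex)
    (a b : PosIndex → ℂ) :
    ∫ p, finiteSum t a p * starRingEnd ℂ (finiteSum t' b p) ∂(sphereMeasure r)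
      = ∑ i ∈ t, ∑ j ∈ t', a i * starRingEnd ℂ (b j) * if i = j then (r : ℂ) ^ 2 else 0 := by
  have h := (integral_zonal_mul (r := r) (u := fun _ => 1) (memLp_const (1 : ℂ)) t t' a b).2
  simp only [Complex.ofReal_one, one_mul] at h
  rw [h]
  refine Finset.sum_congr rfl fun i _ => Finset.sum_congr rfl fun j _ => ?_
  congr 1
  by_cases hm : i.1.1.2 = j.1.1.2
  · rw [if_pos hm, zonalEntry_one _ _ hm]
    have : (Real.pi : ℂ) ≠ 0 := by exact_mod_cast Real.pi_ne_zero
    by_cases hij : i = j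
    · rw [if_pos hij, if_pos (by rw [hij])]
      push_cast; field_simp
    · rw [if_neg hij, if_neg fun h => hij (Subtype.ext h)]; simp
  · rw [if_neg hm, if_neg fun h => hm (by rw [h])]

lemma contDiff_profile_mul (i j : HarmonicIndex) {n : WithTop ℕ∞} :
    ContDiff ℝ n (fun t => profile i t * profile j t) :=
  (contDiff_profile i).mul (contDiff_profile j)

lemma continuous_alphaOp {h : ℝ → ℝ} (hh : ContDiff ℝ 2 h) : Continuous (alphaOp h) := by
  have h1 : Continuous (deriv h) := hh.continuous_deriv (by norm_num)
  have h2 : Continuous (deriv (deriv h)) := (hh.deriv' (n := 1)).continuous_deriv (by norm_num)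
  unfold alphaOp
  fun_prop

lemma dTheta_sum_sum (t t' : Finset PosIndex) (K : PosIndex → PosIndex → ℂ)
    (w w' : PosIndex → PosIndex → ℝ → ℝ) (E : PosIndex → PosIndex → ℝ → ℂ) (p : ℝ × ℝ)
    (h : ∀ i j, HasDerivAt (w i j) (w' i j p.1) p.1) :
    dTheta (fun q => ∑ i ∈ t, ∑ j ∈ t', K i j * ((w i j q.1 : ℂ) * E i j q.2)) p
      = ∑ i ∈ t, ∑ j ∈ t', K i j * ((w' i j p.1 : ℂ) * E i j p.2) :=
  (HasDerivAt.fun_sum fun i _ => HasDerivAt.fun_sum fun j _ =>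
    ((h i j).ofReal_comp.mul_const (E i j p.2)).const_mul (K i j)).deriv

/-- The factor sin² θ cancels the denominators of ((sin θ)⁻¹ h')' and leaves `alphaOp`, which is
continuous up to the poles. The φ-integral then keeps only the pairs of equal azimuthal order. -/
lemma alphaPairing_finiteSum {Ω : ℝ → ℝ} (hΩ : IntegrableOn Ω (Set.Ioc 0 Real.pi))
    (t t' : Finset PosIndex) (a b : PosIndex → ℂ) :
    alphaPairing Ω (fun p => finiteSum t a p * starRingEnd ℂ (finiteSum t' b p))
      = ∑ i ∈ t, ∑ j ∈ t', a i * starRingEnd ℂ (b j) *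
        if i.1.1.2 = j.1.1.2 then 2 * Real.pi * (alphaEntry Ω i.1 j.1 : ℂ) else 0 := by
  unfold alphaPairing
  simp_rw [finiteSum_mul_conj]
  have h1 : ∀ q : ℝ × ℝ, dTheta (fun p => ∑ i ∈ t, ∑ j ∈ t', a i * starRingEnd ℂ (b j) *
        (((profile i.1 p.1 * profile j.1 p.1 : ℝ) : ℂ)
          * Complex.exp (Complex.I * (i.1.1.2 - j.1.1.2 : ℤ) * p.2))) q
      = ∑ i ∈ t, ∑ j ∈ t', a i * starRingEnd ℂ (b j) *
        (((deriv (fun x => profile i.1 x * profile j.1 x) q.1 : ℝ) : ℂ)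
          * Complex.exp (Complex.I * (i.1.1.2 - j.1.1.2 : ℤ) * q.2)) := by
    intro q
    refine dTheta_sum_sum t t' (fun i j => a i * starRingEnd ℂ (b j))
      (fun i j x => profile i.1 x * profile j.1 x)
      (fun i j => deriv fun x => profile i.1 x * profile j.1 x)
      (fun i j φ => Complex.exp (Complex.I * (i.1.1.2 - j.1.1.2 : ℤ) * φ)) q fun i j => ?_
    exact ((contDiff_profile_mul i.1 j.1 (n := 1)).differentiable (by norm_num) q.1).hasDerivAt
  simp_rw [h1]
  have h2 : ∀ p ∈ coordDomain, ((Ω p.1 * Real.sin p.1 ^ 2 : ℝ) : ℂ) *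
      dTheta (fun q => 1 / (Real.sin q.1 : ℂ) * ∑ i ∈ t, ∑ j ∈ t', a i * starRingEnd ℂ (b j) *
        (((deriv (fun x => profile i.1 x * profile j.1 x) q.1 : ℝ) : ℂ)
          * Complex.exp (Complex.I * (i.1.1.2 - j.1.1.2 : ℤ) * q.2))) p
      = ∑ i ∈ t, ∑ j ∈ t', a i * starRingEnd ℂ (b j) *
        (((Ω p.1 * alphaOp (fun x => profile i.1 x * profile j.1 x) p.1 : ℝ) : ℂ)
          * Complex.exp (Complex.I * (i.1.1.2 - j.1.1.2 : ℤ) * p.2)) := by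
    intro p hp
    have hs := (sin_pos_of_mem_coordDomain hp).ne'
    have hs' : (Real.sin p.1 : ℂ) ≠ 0 := by exact_mod_cast hs
    have e : (fun q : ℝ × ℝ => 1 / (Real.sin q.1 : ℂ) * ∑ i ∈ t, ∑ j ∈ t', a i * starRingEnd ℂ (b j) *
        (((deriv (fun x => profile i.1 x * profile j.1 x) q.1 : ℝ) : ℂ)
          * Complex.exp (Complex.I * (i.1.1.2 - j.1.1.2 : ℤ) * q.2)))
        = fun q => ∑ i ∈ t, ∑ j ∈ t', a i * starRingEnd ℂ (b j) *
        (((deriv (fun x => profile i.1 x * profile j.1 x) q.1 / Real.sin q.1 : ℝ) : ℂ)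
          * Complex.exp (Complex.I * (i.1.1.2 - j.1.1.2 : ℤ) * q.2)) := by
      funext q
      rw [Finset.mul_sum]
      refine Finset.sum_congr rfl fun i _ => ?_
      rw [Finset.mul_sum]
      refine Finset.sum_congr rfl fun j _ => ?_
      push_cast; ring
    rw [e]
    have h3 : dTheta (fun q => ∑ i ∈ t, ∑ j ∈ t', a i * starRingEnd ℂ (b j) *
        (((deriv (fun x => profile i.1 x * profile j.1 x) q.1 / Real.sin q.1 : ℝ) : ℂ)
          * Complex.exp (Complex.I * (i.1.1.2 - j.1.1.2 : ℤ) * q.2))) p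
        = ∑ i ∈ t, ∑ j ∈ t', a i * starRingEnd ℂ (b j) *
        (((alphaOp (fun x => profile i.1 x * profile j.1 x) p.1 / Real.sin p.1 ^ 2 : ℝ) : ℂ)
          * Complex.exp (Complex.I * (i.1.1.2 - j.1.1.2 : ℤ) * p.2)) := by
      refine dTheta_sum_sum t t' (fun i j => a i * starRingEnd ℂ (b j))
        (fun i j x => deriv (fun x => profile i.1 x * profile j.1 x) x / Real.sin x)
        (fun i j x => alphaOp (fun x => profile i.1 x * profile j.1 x) x / Real.sin x ^ 2)
        (fun i j φ => Complex.exp (Complex.I * (i.1.1.2 - j.1.1.2 : ℤ) * φ)) p fun i j => ?_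
      have h4 := (((contDiff_profile_mul i.1 j.1 (n := 2)).deriv' (n := 1)).differentiable
        (by norm_num) p.1).hasDerivAt.div (Real.hasDerivAt_sin p.1) hs
      refine h4.congr_deriv ?_
      unfold alphaOp
      ring
    rw [h3, Finset.mul_sum]
    refine Finset.sum_congr rfl fun i _ => ?_
    rw [Finset.mul_sum]
    refine Finset.sum_congr rfl fun j _ => ?_
    simp only [Complex.ofReal_mul, Complex.ofReal_div, Complex.ofReal_pow]
    field_simp
  rw [setIntegral_congr_fun measurableSet_coordDomain h2]
  have hi : ∀ i j : PosIndex, Integrable (fun p : ℝ × ℝ => a i * starRingEnd ℂ (b j) *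
        (((Ω p.1 * alphaOp (fun x => profile i.1 x * profile j.1 x) p.1 : ℝ) : ℂ)
          * Complex.exp (Complex.I * (i.1.1.2 - j.1.1.2 : ℤ) * p.2)))
        (volume.restrict coordDomain) := by
    intro i j
    refine Integrable.const_mul ?_ _
    rw [restrict_coordDomain_eq]
    refine Integrable.mul_prod (f := fun θ => ((Ω θ * alphaOp
      (fun x => profile i.1 x * profile j.1 x) θ : ℝ) : ℂ))
      (g := fun φ : ℝ => Complex.exp (Complex.I * (i.1.1.2 - j.1.1.2 : ℤ) * φ)) ?_ ?_
    · have hc := continuous_alphaOp (contDiff_profile_mul i.1 j.1)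
      rw [← intervalIntegrable_iff_integrableOn_Ioc_of_le Real.pi_pos.le] at hΩ
      exact (hΩ.mul_continuousOn hc.continuousOn).1.ofReal
    · exact ((by fun_prop : Continuous fun φ : ℝ =>
        Complex.exp (Complex.I * (i.1.1.2 - j.1.1.2 : ℤ) * φ)).intervalIntegrable 0 _).1
  rw [integral_finsetSum _ fun i _ => integrable_finsetSum _ fun j _ => hi i j]
  refine Finset.sum_congr rfl fun i _ => ?_
  rw [integral_finsetSum _ fun j _ => hi i j]
  refine Finset.sum_congr rfl fun j _ => ?_
  rw [integral_const_mul, integral_coordDomain_mul (fun θ => ((Ω θ * alphaOp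
      (fun x => profile i.1 x * profile j.1 x) θ : ℝ) : ℂ))
      (fun φ : ℝ => Complex.exp (Complex.I * (i.1.1.2 - j.1.1.2 : ℤ) * φ)), integral_exp_int,
      intervalIntegral.integral_ofReal]
  congr 1
  simp only [sub_eq_zero]
  split_ifs
  · unfold alphaEntry; push_cast; ring
  · simp

/-- The skew part of the coefficients of the pairing. -/
def skewEntry (β Ω : ℝ → ℝ) (i j : PosIndex) : ℂ :=
  if i.1.1.2 = j.1.1.2 then
    2 * Real.pi * Complex.I * i.1.1.2
      * (unitEigenvalue i.1 * zonalEntry β i.1 j.1 + alphaEntry Ω i.1 j.1 : ℝ)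
  else 0

/-- The coefficients of the pairing. -/
def pairingEntry (r γ ω : ℝ) (β Ω : ℝ → ℝ) (i j : PosIndex) : ℂ :=
  (if i = j then
    (γ * unitEigenvalue i.1 ^ 2 / r ^ 2 - Complex.I * ω * unitEigenvalue i.1 : ℂ) else 0)
    + skewEntry β Ω i j

lemma inertialPairing_finiteSum {r : ℝ} (hr : 0 < r) (γ ω Ωref : ℝ) {Ω : ℝ → ℝ}
    (hΩ : MemSobolev r 1 (zonal Ω)) (t t' : Finset PosIndex) (a b : PosIndex → ℂ) :
    inertialPairing r γ ω Ωref Ω (finiteSum t a) (finiteSum t' b)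
      = ∑ i ∈ t, ∑ j ∈ t', a i * starRingEnd ℂ (b j)
        * pairingEntry r γ ω (fun θ => Ω θ - Ωref) Ω i j := by
  have hβ := (hΩ.zonal_sub_const hr Ωref).1
  have hr' : (r : ℂ) ≠ 0 := by exact_mod_cast hr.ne'
  unfold inertialPairing
  rw [dPhi_finiteSum, alphaPairing_finiteSum (integrableOn_of_zonal hr hΩ)]
  set a1 : PosIndex → ℂ := fun i =>
    (γ * eigenvalue r i.1 ^ 2 - Complex.I * ω * eigenvalue r i.1) * a i with ha1
  set a2 : PosIndex → ℂ := fun i => Complex.I * i.1.1.2 * eigenvalue r i.1 * a i with ha2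
  have h1 : ∫ p, ((γ : ℂ) * laplaceBeltrami r (laplaceBeltrami r (finiteSum t a)) p
        + Complex.I * ω * laplaceBeltrami r (finiteSum t a) p
        - ((Ω p.1 - Ωref : ℝ) : ℂ) * laplaceBeltrami r
          (finiteSum t fun i => Complex.I * i.1.1.2 * a i) p)
      * starRingEnd ℂ (finiteSum t' b p) ∂(sphereMeasure r)
      = ∫ p, (((1 : ℝ) : ℂ) * (finiteSum t a1 p * starRingEnd ℂ (finiteSum t' b p))
        + ((Ω p.1 - Ωref : ℝ) : ℂ) * (finiteSum t a2 p * starRingEnd ℂ (finiteSum t' b p)))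
          ∂(sphereMeasure r) := by
    refine integral_congr_ae ?_
    filter_upwards [ae_mem_coordDomain r] with p hp
    have hL : ∀ a, ∀ q : ℝ × ℝ, q.1 ∈ Set.Ioo 0 Real.pi →
      laplaceBeltrami r (finiteSum t a) q = finiteSum t (fun i => -eigenvalue r i.1 * a i) q :=
      fun a q hq => laplaceBeltrami_finiteSum hr t a hq
    rw [laplaceBeltrami_congr r (hL a) hp.1, hL _ _ hp.1, hL _ _ hp.1, hL _ _ hp.1]
    have e1 : finiteSum t a1 p = γ * finiteSum t (fun i => -eigenvalue r i.1
        * (-eigenvalue r i.1 * a i)) p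
        + Complex.I * ω * finiteSum t (fun i => -eigenvalue r i.1 * a i) p := by
      unfold finiteSum
      rw [Finset.mul_sum, Finset.mul_sum, ← Finset.sum_add_distrib]
      exact Finset.sum_congr rfl fun i _ => by simp only [ha1]; ring
    have e2 : finiteSum t a2 p
        = -finiteSum t (fun i => -eigenvalue r i.1 * (Complex.I * i.1.1.2 * a i)) p := by
      unfold finiteSum
      rw [← Finset.sum_neg_distrib]
      exact Finset.sum_congr rfl fun i _ => by simp only [ha2]; ring
    rw [e1, e2]
    push_cast; ring
  rw [h1]
  obtain ⟨i1, s1⟩ := integral_zonal_mul (r := r) (u := fun _ => 1) (memLp_const (1 : ℂ)) t t' a1 b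
  obtain ⟨i2, s2⟩ := integral_zonal_mul hβ t t' a2 b
  have s3 := integral_finiteSum_mul_conj r t t' a1 b
  rw [integral_add i1 i2, s2]
  simp only [Complex.ofReal_one, one_mul]
  rw [s3, ← Finset.sum_add_distrib, ← Finset.sum_add_distrib]
  refine Finset.sum_congr rfl fun i _ => ?_
  rw [← Finset.sum_add_distrib, ← Finset.sum_add_distrib]
  refine Finset.sum_congr rfl fun j _ => ?_
  unfold pairingEntry skewEntry
  simp only [ha1, ha2, eigenvalue_eq]
  split_ifs <;> push_cast <;> field_simp <;> ring

/-! ### Combinations of spherical harmonics of one azimuthal order -/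

/-- The profile of the spherical harmonic `Y_{lm}`, divided by `sin θ`. -/
def profileDiv (i : HarmonicIndex) (θ : ℝ) : ℝ :=
  Real.sqrt ((2 * i.1.1 + 1) / (4 * Real.pi)
    * ((i.1.1 - i.1.2.natAbs).factorial / (i.1.1 + i.1.2.natAbs).factorial))
    / (2 ^ i.1.1 * i.1.1.factorial)
    * polar (i.1.2.natAbs - 1) (rodrigues i.1.1 (i.1.1 + i.1.2.natAbs)) θ

lemma contDiff_profileDiv (i : HarmonicIndex) {n : WithTop ℕ∞} : ContDiff ℝ n (profileDiv i) :=
  contDiff_const.mul (contDiff_polar _ _)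

lemma profile_eq_sin_mul (i : HarmonicIndex) (hi : i.1.2 ≠ 0) (θ : ℝ) :
    profile i θ = Real.sin θ * profileDiv i θ := by
  obtain ⟨k, hk⟩ : ∃ k, i.1.2.natAbs = k + 1 := Nat.exists_eq_succ_of_ne_zero (by omega)
  unfold profile profileDiv legendre polar
  rw [hk, Nat.add_sub_cancel, pow_succ]
  ring

/-- For m ≠ 0 a profile contains a factor sin θ. Splitting it off leaves a function smooth up to the
poles, so the one-dimensional estimates have no singular boundary terms. The order m = 0 is not
needed, as ∂_φ kills it. -/
lemma isModeLaplacian_profileDiv (i : HarmonicIndex) (hi : i.1.2 ≠ 0) :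
    IsModeLaplacian i.1.2.natAbs (profileDiv i) (fun θ => -unitEigenvalue i * profile i θ) := by
  refine ⟨by omega, contDiff_profileDiv i, continuous_const.mul (continuous_profile i), ?_⟩
  intro θ hθ
  have hs := Real.sin_pos_of_mem_Ioo hθ
  have hd : ∀ t, HasDerivAt (profileDiv i) (deriv (profileDiv i) t) t := fun t =>
    ((contDiff_profileDiv i (n := 1)).differentiable (by norm_num) t).hasDerivAt
  have hd2 : HasDerivAt (deriv (profileDiv i)) (deriv (deriv (profileDiv i)) θ) θ :=
    (((contDiff_profileDiv i (n := 2)).deriv' (n := 1)).differentiable (by norm_num) θ).hasDerivAt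
  have h1 : deriv (profile i)
      = fun t => Real.cos t * profileDiv i t + Real.sin t * deriv (profileDiv i) t := by
    funext t
    rw [funext (profile_eq_sin_mul i hi)]
    exact ((Real.hasDerivAt_sin t).mul (hd t)).deriv
  have h2 := deriv_sin_mul_deriv_profile i hs.ne'
  rw [h1] at h2
  have h3 := ((Real.hasDerivAt_sin θ).mul (((Real.hasDerivAt_cos θ).mul (hd θ)).add
    ((Real.hasDerivAt_sin θ).mul hd2))).deriv
  simp only [Pi.add_apply, Pi.mul_apply] at h3
  have h4 := h3.symm.trans h2
  have hm : ((i.1.2.natAbs : ℕ) : ℝ) ^ 2 = (i.1.2 : ℝ) ^ 2 := by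
    rw [Nat.cast_natAbs, Int.cast_abs, sq_abs]
  rw [hm]
  rw [profile_eq_sin_mul i hi] at h4 ⊢
  field_simp at h4
  have h5 := Real.sin_sq_add_cos_sq θ
  linear_combination -h4 + profileDiv i θ * h5

lemma IsModeLaplacian.sum {ι : Type*} {m : ℕ} (hm : 1 ≤ m) (t : Finset ι) (a : ι → ℝ)
    {F G : ι → ℝ → ℝ} (h : ∀ i ∈ t, IsModeLaplacian m (F i) (G i)) :
    IsModeLaplacian m (fun θ => ∑ i ∈ t, a i * F i θ) (fun θ => ∑ i ∈ t, a i * G i θ) := by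
  have d1 : ∀ θ, deriv (fun θ => ∑ i ∈ t, a i * F i θ) θ = ∑ i ∈ t, a i * deriv (F i) θ := fun θ =>
    (HasDerivAt.fun_sum fun i hi => ((h i hi).hasDerivAt θ).const_mul (a i)).deriv
  have d2 : ∀ θ, deriv (deriv (fun θ => ∑ i ∈ t, a i * F i θ)) θ
      = ∑ i ∈ t, a i * deriv (deriv (F i)) θ := fun θ => by
    rw [funext d1]
    exact (HasDerivAt.fun_sum fun i hi => ((h i hi).hasDerivAt_deriv θ).const_mul (a i)).deriv
  refine ⟨hm, ContDiff.sum fun i hi => contDiff_const.mul (h i hi).contDiff,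
    continuous_finsetSum _ fun i hi => continuous_const.mul (h i hi).continuous, fun θ hθ => ?_⟩
  rw [d1, d2]
  simp only [Finset.mul_sum, ← Finset.sum_add_distrib]
  refine Finset.sum_congr rfl fun i hi => ?_
  linear_combination a i * (h i hi).eq θ hθ

/-- The weighted norm of `(λ a)` over a finite set of indices. -/
def lapNorm (t : Finset PosIndex) (a : PosIndex → ℂ) : ℝ :=
  Real.sqrt (∑ i ∈ t, unitEigenvalue i.1 ^ 2 * ‖a i‖ ^ 2)

/-- The weighted norm of `(λ^{1/2} a)` over a finite set of indices. -/
def energyNorm (t : Finset PosIndex) (a : PosIndex → ℂ) : ℝ :=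
  Real.sqrt (∑ i ∈ t, unitEigenvalue i.1 * ‖a i‖ ^ 2)

lemma lapNorm_sq (t : Finset PosIndex) (a : PosIndex → ℂ) :
    lapNorm t a ^ 2 = ∑ i ∈ t, unitEigenvalue i.1 ^ 2 * ‖a i‖ ^ 2 :=
  Real.sq_sqrt (Finset.sum_nonneg fun _ _ => by positivity)

lemma energyNorm_sq (t : Finset PosIndex) (a : PosIndex → ℂ) :
    energyNorm t a ^ 2 = ∑ i ∈ t, unitEigenvalue i.1 * ‖a i‖ ^ 2 :=
  Real.sq_sqrt (Finset.sum_nonneg fun _ _ => mul_nonneg (unitEigenvalue_nonneg _) (sq_nonneg _))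

lemma lapNorm_nonneg (t : Finset PosIndex) (a : PosIndex → ℂ) : 0 ≤ lapNorm t a :=
  Real.sqrt_nonneg _

lemma energyNorm_nonneg (t : Finset PosIndex) (a : PosIndex → ℂ) : 0 ≤ energyNorm t a :=
  Real.sqrt_nonneg _

section Mode

variable {t : Finset PosIndex} {m : ℤ} (hm : m ≠ 0) (ht : ∀ i ∈ t, i.1.1.2 = m)
include ht

lemma two_pi_mul_sinNorm_sq (a : PosIndex → ℝ) :
    2 * Real.pi * sinNorm (fun θ => ∑ i ∈ t, a i * (-unitEigenvalue i.1 * profile i.1 θ)) ^ 2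
      = lapNorm t (fun i => a i) ^ 2 := by
  have h := integral_sum_profile_comp_mul (k := fun i : PosIndex => i.1) Subtype.val_injective t
    (fun i => a i * -unitEigenvalue i.1) (fun i => a i * -unitEigenvalue i.1) ht
  simp_rw [← sq, mul_assoc] at h
  rw [sinNorm_sq, h, lapNorm_sq]
  have := Real.pi_pos
  field_simp
  refine Finset.sum_congr rfl fun i _ => ?_
  rw [Complex.norm_real, Real.norm_eq_abs, sq_abs]; ring

/-- Every harmonic of order m has l ≥ |m|. This trades azimuthal derivatives for powers of the
Laplacian, uniformly in m. -/
lemma natAbs_mul_energyNorm_sq_le (a : PosIndex → ℂ) :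
    m.natAbs * (m.natAbs + 1) * energyNorm t a ^ 2 ≤ lapNorm t a ^ 2 := by
  rw [energyNorm_sq, lapNorm_sq, Finset.mul_sum]
  refine Finset.sum_le_sum fun i hi => ?_
  have h1 : m.natAbs ≤ i.1.1.1 := by rw [← ht i hi]; exact i.1.2
  have h2 : (m.natAbs : ℝ) * (m.natAbs + 1) ≤ unitEigenvalue i.1 := by
    have h3 : (m.natAbs : ℝ) ≤ i.1.1.1 := by exact_mod_cast h1
    unfold unitEigenvalue
    gcongr
  have h4 := unitEigenvalue_nonneg i.1
  calc _ ≤ unitEigenvalue i.1 * (unitEigenvalue i.1 * ‖a i‖ ^ 2) := by gcongr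
    _ = _ := by ring

lemma natAbs_mul_energyNorm_le (a : PosIndex → ℂ) :
    m.natAbs * energyNorm t a ≤ lapNorm t a := by
  refine abs_le_of_sq_le_sq' ?_ (lapNorm_nonneg t a) |>.2
  refine le_trans ?_ (natAbs_mul_energyNorm_sq_le ht a)
  have h0 : (0 : ℝ) ≤ m.natAbs := Nat.cast_nonneg _
  nlinarith [mul_nonneg h0 (sq_nonneg (energyNorm t a))]

/-- The factor √|m| left over in the β-estimate is absorbed here, which turns the product of the two
norms a and n into a √(an). -/
lemma sqrt_natAbs_mul_energyNorm_le (a : PosIndex → ℂ) :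
    Real.sqrt m.natAbs * energyNorm t a ≤ Real.sqrt (lapNorm t a * energyNorm t a) := by
  rw [← Real.sqrt_sq (energyNorm_nonneg t a), ← Real.sqrt_mul (Nat.cast_nonneg _),
    Real.sqrt_sq (energyNorm_nonneg t a)]
  refine Real.sqrt_le_sqrt ?_
  nlinarith [natAbs_mul_energyNorm_le ht a, energyNorm_nonneg t a]

include hm

lemma isModeLaplacian_sum (a : PosIndex → ℝ) :
    IsModeLaplacian m.natAbs (fun θ => ∑ i ∈ t, a i * profileDiv i.1 θ)
      (fun θ => ∑ i ∈ t, a i * (-unitEigenvalue i.1 * profile i.1 θ)) :=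
  IsModeLaplacian.sum (by omega) t a fun i hi => by
    rw [← ht i hi]
    exact isModeLaplacian_profileDiv i.1 (by rw [ht i hi]; exact hm)

lemma sin_mul_sum_profileDiv (a : PosIndex → ℝ) (θ : ℝ) :
    Real.sin θ * ∑ i ∈ t, a i * profileDiv i.1 θ = ∑ i ∈ t, a i * profile i.1 θ := by
  rw [Finset.mul_sum]
  refine Finset.sum_congr rfl fun i hi => ?_
  rw [profile_eq_sin_mul i.1 (by rw [ht i hi]; exact hm)]; ring

lemma two_pi_mul_gradNorm_sq (a : PosIndex → ℝ) :
    2 * Real.pi * gradNorm m.natAbs (fun θ => ∑ i ∈ t, a i * profileDiv i.1 θ) ^ 2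
      = energyNorm t (fun i => a i) ^ 2 := by
  have h := integral_sum_profile_comp_mul (k := fun i : PosIndex => i.1) Subtype.val_injective t
    a (fun i => a i * -unitEigenvalue i.1) ht
  simp_rw [mul_assoc (a _) (-_)] at h
  rw [(isModeLaplacian_sum hm ht a).integral_gradSq_mul_sin]
  simp_rw [sin_mul_sum_profileDiv hm ht]
  rw [h, energyNorm_sq]
  have := Real.pi_pos
  field_simp
  rw [← Finset.sum_neg_distrib]
  refine Finset.sum_congr rfl fun i _ => ?_
  rw [Complex.norm_real, Real.norm_eq_abs, sq_abs]; ring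

/-- The double sum is an integral of β against the Laplacian of one mode times the other mode.
Cauchy-Schwarz takes β in L², and `IsModeLaplacian.mul_sq_le` takes the undifferentiated mode in
L^∞; of the factor m, its m^{-1/2} leaves √m. -/
lemma natAbs_mul_abs_integral_le {β : ℝ → ℝ}
    (hβ : AEStronglyMeasurable β (volume.restrict (Set.Ioc 0 Real.pi)))
    (hβ2 : IntegrableOn (fun θ => β θ ^ 2 * Real.sin θ) (Set.Ioc 0 Real.pi)) (a b : PosIndex → ℝ) :
    2 * Real.pi * (m.natAbs * |∑ i ∈ t, ∑ j ∈ t, a i * b j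
        * (unitEigenvalue i.1 * zonalEntry β i.1 j.1)|)
      ≤ sinNorm β / Real.sqrt 2 * (Real.sqrt m.natAbs
        * (lapNorm t (fun i => a i) * energyNorm t (fun i => b i))) := by
  set g := fun θ => ∑ i ∈ t, a i * (-unitEigenvalue i.1 * profile i.1 θ) with hg
  set u := fun θ => ∑ i ∈ t, b i * profile i.1 θ with hu
  have hc1 : ∀ i : PosIndex, Continuous (profile i.1) := fun i => continuous_profile i.1
  have hgc : Continuous g := by fun_prop
  have huc : Continuous u := by fun_prop
  have h1 : ∑ i ∈ t, ∑ j ∈ t, a i * b j * (unitEigenvalue i.1 * zonalEntry β i.1 j.1)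
      = -∫ θ in (0 : ℝ)..Real.pi, β θ * (g θ * u θ) * Real.sin θ := by
    have hi : ∀ i j : PosIndex, IntervalIntegrable (fun θ => a i * b j * unitEigenvalue i.1
        * (β θ * (profile i.1 θ * profile j.1 θ) * Real.sin θ)) volume 0 Real.pi := by
      intro i j
      refine IntervalIntegrable.const_mul ?_ _
      rw [intervalIntegrable_iff_integrableOn_Ioc_of_le Real.pi_pos.le]
      exact integrableOn_mul_mul_sin hβ hβ2 (by fun_prop)
    have e : ∀ θ, -(β θ * (g θ * u θ) * Real.sin θ) = ∑ i ∈ t, ∑ j ∈ t,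
        a i * b j * unitEigenvalue i.1 * (β θ * (profile i.1 θ * profile j.1 θ) * Real.sin θ) := by
      intro θ
      simp only [hg, hu]
      rw [Finset.sum_mul_sum, Finset.mul_sum, Finset.sum_mul, ← Finset.sum_neg_distrib]
      refine Finset.sum_congr rfl fun i _ => ?_
      rw [Finset.mul_sum, Finset.sum_mul, ← Finset.sum_neg_distrib]
      exact Finset.sum_congr rfl fun j _ => by ring
    rw [← intervalIntegral.integral_neg]
    simp_rw [e]
    rw [intervalIntegral.integral_finsetSum fun i _ => by
      simpa only [Finset.sum_fn] using IntervalIntegrable.sum t fun j _ => hi i j]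
    refine Finset.sum_congr rfl fun i _ => ?_
    rw [intervalIntegral.integral_finsetSum fun j _ => hi i j]
    refine Finset.sum_congr rfl fun j _ => ?_
    rw [intervalIntegral.integral_const_mul]
    unfold zonalEntry
    ring
  have h2 : |∫ θ in (0 : ℝ)..Real.pi, β θ * (g θ * u θ) * Real.sin θ|
      ≤ sinNorm β * sinNorm (fun θ => g θ * u θ) :=
    abs_integral_mul_mul_sin_le hβ hβ2 (hgc.mul huc)
  set f := fun θ => ∑ i ∈ t, b i * profileDiv i.1 θ with hf
  have hL := isModeLaplacian_sum hm ht b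
  have h3 : m.natAbs * sinNorm (fun θ => g θ * u θ) ^ 2
      ≤ gradNorm m.natAbs f ^ 2 / 2 * sinNorm g ^ 2 := by
    rw [sinNorm_sq, sinNorm_sq, ← intervalIntegral.integral_const_mul,
      ← intervalIntegral.integral_const_mul]
    refine intervalIntegral.integral_mono_on Real.pi_pos.le
      (Continuous.intervalIntegrable (by fun_prop) _ _)
      (Continuous.intervalIntegrable (by fun_prop) _ _) fun θ hθ => ?_
    have h4 := hL.mul_sq_le hθ
    rw [sin_mul_sum_profileDiv hm ht] at h4
    have h5 : 0 ≤ g θ ^ 2 * Real.sin θ :=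
      mul_nonneg (sq_nonneg _) (Real.sin_nonneg_of_nonneg_of_le_pi hθ.1 hθ.2)
    have h6 := mul_le_mul_of_nonneg_right h4 h5
    simp only [hu] at h6 ⊢
    linarith
  have h7 := two_pi_mul_sinNorm_sq ht a
  have h8 := two_pi_mul_gradNorm_sq hm ht b
  rw [h1, abs_neg]
  have hπ := Real.pi_pos
  have h9 : 2 * Real.pi * (m.natAbs * sinNorm (fun θ => g θ * u θ))
      ≤ Real.sqrt m.natAbs * (lapNorm t (fun i => a i) * energyNorm t (fun i => b i))
        / Real.sqrt 2 := by
    refine abs_le_of_sq_le_sq' ?_ (div_nonneg (mul_nonneg (Real.sqrt_nonneg _)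
      (mul_nonneg (lapNorm_nonneg _ _) (energyNorm_nonneg _ _))) (Real.sqrt_nonneg _)) |>.2
    rw [div_pow, mul_pow (Real.sqrt _), mul_pow (lapNorm _ _), Real.sq_sqrt (Nat.cast_nonneg _),
      Real.sq_sqrt (by norm_num), ← h7, ← h8]
    have h10 := mul_le_mul_of_nonneg_left h3
      (by positivity : 0 ≤ (2 * Real.pi) ^ 2 * (m.natAbs : ℝ))
    calc _ = (2 * Real.pi) ^ 2 * (m.natAbs : ℝ)
          * (m.natAbs * sinNorm (fun θ => g θ * u θ) ^ 2) := by ring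
      _ ≤ _ := h10
      _ = _ := by ring
  calc _ ≤ 2 * Real.pi * (m.natAbs * (sinNorm β * sinNorm (fun θ => g θ * u θ))) := by gcongr
    _ = sinNorm β * (2 * Real.pi * (m.natAbs * sinNorm (fun θ => g θ * u θ))) := by ring
    _ ≤ sinNorm β * (Real.sqrt m.natAbs * (lapNorm t (fun i => a i) * energyNorm t (fun i => b i))
        / Real.sqrt 2) := mul_le_mul_of_nonneg_left h9 (sinNorm_nonneg _)
    _ = _ := by ring

/-- The double sum is the pairing of Ω with `alphaOp` of a squared mode, so
`IsModeLaplacian.mul_abs_integral_alphaOp_le` applies. The factor 2π comes from the normalization of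
the profiles; both sides are quadratic in a. -/
lemma natAbs_mul_abs_sum_alphaEntry_le {Ω : ℝ → ℝ}
    (hΩ1 : IntegrableOn Ω (Set.Ioc 0 Real.pi))
    (hΩ2 : IntegrableOn (fun θ => Ω θ ^ 2 * Real.sin θ) (Set.Ioc 0 Real.pi)) (a : PosIndex → ℝ) :
    2 * Real.pi * (m.natAbs * |∑ i ∈ t, ∑ j ∈ t, a i * a j * alphaEntry Ω i.1 j.1|)
      ≤ 12.1 * sinNorm Ω * (lapNorm t (fun i => a i)
        * Real.sqrt (lapNorm t (fun i => a i) * energyNorm t (fun i => a i))) := by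
  have hL := isModeLaplacian_sum hm ht a
  have h7 := two_pi_mul_sinNorm_sq ht a
  have h8 := two_pi_mul_gradNorm_sq hm ht a
  have hπ := Real.pi_pos
  have h1 := hL.mul_abs_integral_alphaOp_le hΩ1.1 hΩ2 (by
    have := natAbs_mul_energyNorm_sq_le ht (fun i => (a i : ℂ))
    rw [← h7, ← h8] at this
    refine le_of_mul_le_mul_left ?_ (by positivity : 0 < 2 * Real.pi)
    linarith)
  set A := sinNorm (fun θ => ∑ i ∈ t, a i * (-unitEigenvalue i.1 * profile i.1 θ)) with hA
  set B := gradNorm m.natAbs (fun θ => ∑ i ∈ t, a i * profileDiv i.1 θ) with hB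
  have hA0 : 0 ≤ A := sinNorm_nonneg _
  have hB0 : 0 ≤ B := gradNorm_nonneg _ _
  have hlA : lapNorm t (fun i => a i) = Real.sqrt (2 * Real.pi) * A := by
    rw [← Real.sqrt_sq (lapNorm_nonneg t fun i => (a i : ℂ)), ← h7, Real.sqrt_mul (by positivity),
      Real.sqrt_sq hA0]
  have hlB : energyNorm t (fun i => a i) = Real.sqrt (2 * Real.pi) * B := by
    rw [← Real.sqrt_sq (energyNorm_nonneg t fun i => (a i : ℂ)), ← h8, Real.sqrt_mul (by positivity),
      Real.sqrt_sq hB0]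
  have hsq : Real.sqrt (2 * Real.pi) * Real.sqrt (2 * Real.pi) = 2 * Real.pi :=
    Real.mul_self_sqrt (by positivity)
  have e1 : lapNorm t (fun i => a i)
        * Real.sqrt (lapNorm t (fun i => a i) * energyNorm t (fun i => a i))
      = 2 * Real.pi * (A * Real.sqrt (A * B)) := by
    rw [hlA, hlB]
    have hS0 := Real.sqrt_nonneg (2 * Real.pi)
    generalize Real.sqrt (2 * Real.pi) = S at hsq hS0 ⊢
    rw [show S * A * (S * B) = S ^ 2 * (A * B) by ring, Real.sqrt_mul (sq_nonneg S),
      Real.sqrt_sq hS0]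
    linear_combination (A * Real.sqrt (A * B)) * hsq
  have e2 : ∑ i ∈ t, ∑ j ∈ t, a i * a j * alphaEntry Ω i.1 j.1
      = ∫ θ in (0 : ℝ)..Real.pi, Ω θ * alphaOp (fun x =>
        (Real.sin x * ∑ i ∈ t, a i * profileDiv i.1 x) ^ 2) θ := by
    have h3 : (fun x => (Real.sin x * ∑ i ∈ t, a i * profileDiv i.1 x) ^ 2)
        = fun x => ∑ i ∈ t, ∑ j ∈ t, a i * a j * (profile i.1 x * profile j.1 x) := by
      funext x
      rw [sin_mul_sum_profileDiv hm ht, sq, Finset.sum_mul_sum]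
      exact Finset.sum_congr rfl fun i _ => Finset.sum_congr rfl fun j _ => by ring
    have h4 : ∀ θ, alphaOp (fun x =>
        ∑ i ∈ t, ∑ j ∈ t, a i * a j * (profile i.1 x * profile j.1 x)) θ
        = ∑ i ∈ t, ∑ j ∈ t, a i * a j * alphaOp (fun x => profile i.1 x * profile j.1 x) θ := by
      intro θ
      have d1 : deriv (fun x => ∑ i ∈ t, ∑ j ∈ t, a i * a j * (profile i.1 x * profile j.1 x))
          = fun x => ∑ i ∈ t, ∑ j ∈ t, a i * a j
            * deriv (fun x => profile i.1 x * profile j.1 x) x := by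
        funext x
        exact (HasDerivAt.fun_sum fun i _ => HasDerivAt.fun_sum fun j _ =>
          ((contDiff_profile_mul i.1 j.1 (n := 1)).differentiable
            (by norm_num) x).hasDerivAt.const_mul _).deriv
      have d2 : deriv (fun x => ∑ i ∈ t, ∑ j ∈ t, a i * a j
            * deriv (fun x => profile i.1 x * profile j.1 x) x) θ
          = ∑ i ∈ t, ∑ j ∈ t, a i * a j
            * deriv (deriv (fun x => profile i.1 x * profile j.1 x)) θ :=
        (HasDerivAt.fun_sum fun i _ => HasDerivAt.fun_sum fun j _ =>
          (((contDiff_profile_mul i.1 j.1 (n := 2)).deriv' (n := 1)).differentiable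
            (by norm_num) θ).hasDerivAt.const_mul _).deriv
      unfold alphaOp
      rw [d1, d2]
      simp only [Finset.mul_sum, ← Finset.sum_sub_distrib]
      exact Finset.sum_congr rfl fun i _ => Finset.sum_congr rfl fun j _ => by ring
    have hi : ∀ i j : PosIndex, IntervalIntegrable (fun θ => a i * a j
        * (Ω θ * alphaOp (fun x => profile i.1 x * profile j.1 x) θ)) volume 0 Real.pi := by
      intro i j
      refine IntervalIntegrable.const_mul ?_ _
      have hc := continuous_alphaOp (contDiff_profile_mul i.1 j.1)
      rw [← intervalIntegrable_iff_integrableOn_Ioc_of_le Real.pi_pos.le] at hΩ1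
      exact hΩ1.mul_continuousOn hc.continuousOn
    rw [h3]
    simp_rw [h4]
    have e : ∀ θ, Ω θ * ∑ i ∈ t, ∑ j ∈ t, a i * a j
          * alphaOp (fun x => profile i.1 x * profile j.1 x) θ
        = ∑ i ∈ t, ∑ j ∈ t, a i * a j
          * (Ω θ * alphaOp (fun x => profile i.1 x * profile j.1 x) θ) := by
      intro θ
      simp only [Finset.mul_sum]
      exact Finset.sum_congr rfl fun i _ => Finset.sum_congr rfl fun j _ => by ring
    simp_rw [e]
    rw [intervalIntegral.integral_finsetSum fun i _ => by
      simpa only [Finset.sum_fn] using IntervalIntegrable.sum t fun j _ => hi i j]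
    refine Finset.sum_congr rfl fun i _ => ?_
    rw [intervalIntegral.integral_finsetSum fun j _ => hi i j]
    refine Finset.sum_congr rfl fun j _ => ?_
    rw [intervalIntegral.integral_const_mul]
    rfl
  rw [e1, e2]
  calc _ ≤ 2 * Real.pi * (12.1 * sinNorm Ω * (A * Real.sqrt (A * B))) := by gcongr
    _ = _ := by ring

end Mode

/-! ### Bounds of the skew part -/

/-- Cauchy-Schwarz twice. It adds up estimates over the azimuthal orders, and over real and
imaginary parts, with no loss in the constant. -/
lemma sum_mul_sqrt_mul_le {ι : Type*} (s : Finset ι) {A B : ι → ℝ} (hA : ∀ i, 0 ≤ A i)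
    (hB : ∀ i, 0 ≤ B i) :
    ∑ i ∈ s, A i * Real.sqrt (A i * B i)
      ≤ Real.sqrt (∑ i ∈ s, A i ^ 2)
        * Real.sqrt (Real.sqrt (∑ i ∈ s, A i ^ 2) * Real.sqrt (∑ i ∈ s, B i ^ 2)) := by
  refine (Real.sum_mul_le_sqrt_mul_sqrt s A _).trans ?_
  refine mul_le_mul_of_nonneg_left (Real.sqrt_le_sqrt ?_) (Real.sqrt_nonneg _)
  simp_rw [fun i => Real.sq_sqrt (mul_nonneg (hA i) (hB i))]
  exact Real.sum_mul_le_sqrt_mul_sqrt s A B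

lemma lapNorm_re_im (t : Finset PosIndex) (c : PosIndex → ℂ) :
    lapNorm t c ^ 2 = lapNorm t (fun i => (c i).re) ^ 2 + lapNorm t (fun i => (c i).im) ^ 2 := by
  simp_rw [lapNorm_sq]
  rw [← Finset.sum_add_distrib]
  refine Finset.sum_congr rfl fun i _ => ?_
  rw [← Complex.normSq_eq_norm_sq, Complex.normSq_apply, Complex.norm_real, Complex.norm_real,
    Real.norm_eq_abs, Real.norm_eq_abs, sq_abs, sq_abs]
  ring

lemma energyNorm_re_im (t : Finset PosIndex) (c : PosIndex → ℂ) :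
    energyNorm t c ^ 2
      = energyNorm t (fun i => (c i).re) ^ 2 + energyNorm t (fun i => (c i).im) ^ 2 := by
  simp_rw [energyNorm_sq]
  rw [← Finset.sum_add_distrib]
  refine Finset.sum_congr rfl fun i _ => ?_
  rw [← Complex.normSq_eq_norm_sq, Complex.normSq_apply, Complex.norm_real, Complex.norm_real,
    Real.norm_eq_abs, Real.norm_eq_abs, sq_abs, sq_abs]
  ring

lemma mul_add_mul_le_of_sq {A B a₁ a₂ b₁ b₂ : ℝ} (hA : 0 ≤ A) (hB : 0 ≤ B)
    (h1 : A ^ 2 = a₁ ^ 2 + a₂ ^ 2) (h2 : B ^ 2 = b₁ ^ 2 + b₂ ^ 2) :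
    a₁ * b₁ + a₂ * b₂ ≤ A * B := by
  refine abs_le_of_sq_le_sq' ?_ (mul_nonneg hA hB) |>.2
  rw [mul_pow, h1, h2]
  nlinarith [sq_nonneg (a₁ * b₂ - a₂ * b₁)]

lemma mul_sqrt_add_mul_sqrt_le {A B a₁ a₂ b₁ b₂ : ℝ} (hA : 0 ≤ A) (hB : 0 ≤ B) (ha₁ : 0 ≤ a₁)
    (ha₂ : 0 ≤ a₂) (hb₁ : 0 ≤ b₁) (hb₂ : 0 ≤ b₂)
    (h1 : A ^ 2 = a₁ ^ 2 + a₂ ^ 2) (h2 : B ^ 2 = b₁ ^ 2 + b₂ ^ 2) :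
    a₁ * Real.sqrt (a₁ * b₁) + a₂ * Real.sqrt (a₂ * b₂) ≤ A * Real.sqrt (A * B) := by
  have h := sum_mul_sqrt_mul_le (Finset.univ : Finset Bool) (A := fun k => if k then a₁ else a₂)
    (B := fun k => if k then b₁ else b₂) (fun k => by cases k <;> simpa)
    (fun k => by cases k <;> simpa)
  simp only [Fintype.sum_bool, if_true, Bool.false_eq_true, if_false, ← h1, ← h2,
    Real.sqrt_sq hA, Real.sqrt_sq hB] at h
  exact h

lemma alphaEntry_comm (Ω : ℝ → ℝ) (i j : HarmonicIndex) : alphaEntry Ω i j = alphaEntry Ω j i := by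
  unfold alphaEntry
  simp_rw [mul_comm (profile i _)]

/-- The skew part of the pairing on a finite set of indices. -/
def skewForm (β Ω : ℝ → ℝ) (t : Finset PosIndex) (c : PosIndex → ℂ) : ℂ :=
  ∑ i ∈ t, ∑ j ∈ t, c i * starRingEnd ℂ (c j) * skewEntry β Ω i j

/-- The α-entries are real and symmetric and carry the factor i m, so they contribute to the
imaginary part only. The β-entries, weighted by the eigenvalue of one index, are not symmetric and
contribute to both. -/
lemma skewForm_eq (β Ω : ℝ → ℝ) {t : Finset PosIndex} {m : ℤ} (ht : ∀ i ∈ t, i.1.1.2 = m)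
    (c : PosIndex → ℂ) :
    (skewForm β Ω t c).re = 2 * Real.pi * m *
      ((∑ i ∈ t, ∑ j ∈ t, (c i).re * (c j).im * (unitEigenvalue i.1 * zonalEntry β i.1 j.1))
        - ∑ i ∈ t, ∑ j ∈ t, (c i).im * (c j).re * (unitEigenvalue i.1 * zonalEntry β i.1 j.1)) ∧
    (skewForm β Ω t c).im = 2 * Real.pi * m *
      ((∑ i ∈ t, ∑ j ∈ t, (c i).re * (c j).re * (unitEigenvalue i.1 * zonalEntry β i.1 j.1))
        + (∑ i ∈ t, ∑ j ∈ t, (c i).im * (c j).im * (unitEigenvalue i.1 * zonalEntry β i.1 j.1))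
        + (∑ i ∈ t, ∑ j ∈ t, (c i).re * (c j).re * alphaEntry Ω i.1 j.1)
        + ∑ i ∈ t, ∑ j ∈ t, (c i).im * (c j).im * alphaEntry Ω i.1 j.1) := by
  have h1 : skewForm β Ω t c = 2 * Real.pi * Complex.I * m * ∑ i ∈ t, ∑ j ∈ t,
      c i * starRingEnd ℂ (c j)
        * (unitEigenvalue i.1 * zonalEntry β i.1 j.1 + alphaEntry Ω i.1 j.1 : ℝ) := by
    unfold skewForm
    rw [Finset.mul_sum]
    refine Finset.sum_congr rfl fun i hi => ?_
    rw [Finset.mul_sum]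
    refine Finset.sum_congr rfl fun j hj => ?_
    unfold skewEntry
    rw [if_pos (by rw [ht i hi, ht j hj]), ht i hi]
    ring
  have h2 : ∑ i ∈ t, ∑ j ∈ t, (c i).re * (c j).im * alphaEntry Ω i.1 j.1
      = ∑ i ∈ t, ∑ j ∈ t, (c i).im * (c j).re * alphaEntry Ω i.1 j.1 := by
    rw [Finset.sum_comm]
    refine Finset.sum_congr rfl fun i _ => Finset.sum_congr rfl fun j _ => ?_
    rw [alphaEntry_comm]; ring
  set S := ∑ i ∈ t, ∑ j ∈ t, c i * starRingEnd ℂ (c j)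
        * (unitEigenvalue i.1 * zonalEntry β i.1 j.1 + alphaEntry Ω i.1 j.1 : ℝ) with hS
  have h3 : (skewForm β Ω t c).re = 2 * Real.pi * m * -S.im := by
    rw [h1]
    simp
  have h4 : (skewForm β Ω t c).im = 2 * Real.pi * m * S.re := by
    rw [h1]
    simp
  rw [h3, h4]
  constructor
  · congr 1
    rw [hS, Complex.im_sum, ← sub_eq_zero]
    simp_rw [Complex.im_sum]
    have : ∀ i j : PosIndex, (c i * starRingEnd ℂ (c j)
        * (unitEigenvalue i.1 * zonalEntry β i.1 j.1 + alphaEntry Ω i.1 j.1 : ℝ)).im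
        = (c i).im * (c j).re * (unitEigenvalue i.1 * zonalEntry β i.1 j.1)
          - (c i).re * (c j).im * (unitEigenvalue i.1 * zonalEntry β i.1 j.1)
          + ((c i).im * (c j).re * alphaEntry Ω i.1 j.1
          - (c i).re * (c j).im * alphaEntry Ω i.1 j.1) := by
      intro i j
      rw [Complex.im_mul_ofReal, Complex.mul_im, Complex.conj_re, Complex.conj_im]
      ring
    simp_rw [this, Finset.sum_add_distrib, Finset.sum_sub_distrib]
    rw [h2]; ring
  · congr 1
    rw [hS, Complex.re_sum]
    simp_rw [Complex.re_sum]
    have : ∀ i j : PosIndex, (c i * starRingEnd ℂ (c j)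
        * (unitEigenvalue i.1 * zonalEntry β i.1 j.1 + alphaEntry Ω i.1 j.1 : ℝ)).re
        = (c i).re * (c j).re * (unitEigenvalue i.1 * zonalEntry β i.1 j.1)
          + (c i).im * (c j).im * (unitEigenvalue i.1 * zonalEntry β i.1 j.1)
          + (c i).re * (c j).re * alphaEntry Ω i.1 j.1
          + (c i).im * (c j).im * alphaEntry Ω i.1 j.1 := by
      intro i j
      rw [Complex.re_mul_ofReal, Complex.mul_re, Complex.conj_re, Complex.conj_im]
      ring
    simp_rw [this, Finset.sum_add_distrib]

section

variable {β Ω : ℝ → ℝ} (hβ : AEStronglyMeasurable β (volume.restrict (Set.Ioc 0 Real.pi)))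
  (hβ2 : IntegrableOn (fun θ => β θ ^ 2 * Real.sin θ) (Set.Ioc 0 Real.pi))
include hβ hβ2

lemma abs_re_skewForm_mode_le {t : Finset PosIndex} {m : ℤ} (ht : ∀ i ∈ t, i.1.1.2 = m)
    (c : PosIndex → ℂ) :
    |(skewForm β Ω t c).re| ≤ sinNorm β / Real.sqrt 2
      * (lapNorm t c * Real.sqrt (lapNorm t c * energyNorm t c)) := by
  have hK : 0 ≤ sinNorm β / Real.sqrt 2 := div_nonneg (sinNorm_nonneg _) (Real.sqrt_nonneg _)
  rw [(skewForm_eq β Ω ht c).1]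
  by_cases hm : m = 0
  · subst hm
    simp only [Int.cast_zero, mul_zero, zero_mul, abs_zero]
    exact mul_nonneg hK (mul_nonneg (lapNorm_nonneg _ _) (Real.sqrt_nonneg _))
  have h1 := natAbs_mul_abs_integral_le hm ht hβ hβ2 (fun i => (c i).re) (fun i => (c i).im)
  have h2 := natAbs_mul_abs_integral_le hm ht hβ hβ2 (fun i => (c i).im) (fun i => (c i).re)
  set X := ∑ i ∈ t, ∑ j ∈ t, (c i).re * (c j).im * (unitEigenvalue i.1 * zonalEntry β i.1 j.1)
  set Y := ∑ i ∈ t, ∑ j ∈ t, (c i).im * (c j).re * (unitEigenvalue i.1 * zonalEntry β i.1 j.1)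
  -- The real part couples the real coefficients with the imaginary ones, so the two components of
  -- the energy norm are swapped.
  have h3 := mul_add_mul_le_of_sq (lapNorm_nonneg t c) (energyNorm_nonneg t c) (lapNorm_re_im t c)
    ((energyNorm_re_im t c).trans (add_comm _ _))
  have h4 := sqrt_natAbs_mul_energyNorm_le ht c
  have hma : |(m : ℝ)| = m.natAbs := by rw [Nat.cast_natAbs, Int.cast_abs]
  rw [abs_mul, abs_mul, hma, abs_of_nonneg (by positivity : 0 ≤ 2 * Real.pi)]
  have h5 : |X - Y| ≤ |X| + |Y| := abs_sub X Y
  have h6 : 2 * Real.pi * m.natAbs * |X - Y| ≤ 2 * Real.pi * m.natAbs * (|X| + |Y|) := by gcongr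
  refine h6.trans ?_
  calc _ ≤ sinNorm β / Real.sqrt 2 * (Real.sqrt m.natAbs * (lapNorm t c * energyNorm t c)) := by
        have h7 := mul_le_mul_of_nonneg_left h3 (mul_nonneg hK (Real.sqrt_nonneg (m.natAbs : ℝ)))
        linarith
    _ ≤ _ := by
        refine mul_le_mul_of_nonneg_left ?_ hK
        nlinarith [lapNorm_nonneg t c]

variable (hΩ1 : IntegrableOn Ω (Set.Ioc 0 Real.pi))
  (hΩ2 : IntegrableOn (fun θ => Ω θ ^ 2 * Real.sin θ) (Set.Ioc 0 Real.pi))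
include hΩ1 hΩ2

lemma abs_im_skewForm_mode_le {t : Finset PosIndex} {m : ℤ} (ht : ∀ i ∈ t, i.1.1.2 = m)
    (c : PosIndex → ℂ) :
    |(skewForm β Ω t c).im| ≤ (sinNorm β / Real.sqrt 2 + 12.1 * sinNorm Ω)
      * (lapNorm t c * Real.sqrt (lapNorm t c * energyNorm t c)) := by
  have hK : 0 ≤ sinNorm β / Real.sqrt 2 := div_nonneg (sinNorm_nonneg _) (Real.sqrt_nonneg _)
  have hK' : 0 ≤ 12.1 * sinNorm Ω := mul_nonneg (by norm_num) (sinNorm_nonneg _)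
  rw [(skewForm_eq β Ω ht c).2]
  by_cases hm : m = 0
  · subst hm
    simp only [Int.cast_zero, mul_zero, zero_mul, abs_zero]
    exact mul_nonneg (add_nonneg hK hK') (mul_nonneg (lapNorm_nonneg _ _) (Real.sqrt_nonneg _))
  have h1 := natAbs_mul_abs_integral_le hm ht hβ hβ2 (fun i => (c i).re) (fun i => (c i).re)
  have h2 := natAbs_mul_abs_integral_le hm ht hβ hβ2 (fun i => (c i).im) (fun i => (c i).im)
  have h1' := natAbs_mul_abs_sum_alphaEntry_le hm ht hΩ1 hΩ2 (fun i => (c i).re)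
  have h2' := natAbs_mul_abs_sum_alphaEntry_le hm ht hΩ1 hΩ2 (fun i => (c i).im)
  set X := ∑ i ∈ t, ∑ j ∈ t, (c i).re * (c j).re * (unitEigenvalue i.1 * zonalEntry β i.1 j.1)
  set Y := ∑ i ∈ t, ∑ j ∈ t, (c i).im * (c j).im * (unitEigenvalue i.1 * zonalEntry β i.1 j.1)
  set X' := ∑ i ∈ t, ∑ j ∈ t, (c i).re * (c j).re * alphaEntry Ω i.1 j.1
  set Y' := ∑ i ∈ t, ∑ j ∈ t, (c i).im * (c j).im * alphaEntry Ω i.1 j.1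
  have h3 := mul_add_mul_le_of_sq (lapNorm_nonneg t c) (energyNorm_nonneg t c) (lapNorm_re_im t c)
    (energyNorm_re_im t c)
  have h3' := mul_sqrt_add_mul_sqrt_le (lapNorm_nonneg t c) (energyNorm_nonneg t c)
    (lapNorm_nonneg t _) (lapNorm_nonneg t _) (energyNorm_nonneg t _) (energyNorm_nonneg t _)
    (lapNorm_re_im t c) (energyNorm_re_im t c)
  have h4 := sqrt_natAbs_mul_energyNorm_le ht c
  have hma : |(m : ℝ)| = m.natAbs := by rw [Nat.cast_natAbs, Int.cast_abs]
  rw [abs_mul, abs_mul, hma, abs_of_nonneg (by positivity : 0 ≤ 2 * Real.pi)]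
  have h5 : |X + Y + X' + Y'| ≤ |X| + |Y| + |X'| + |Y'| := by
    have a1 := abs_add_le (X + Y + X') Y'
    have a2 := abs_add_le (X + Y) X'
    have a3 := abs_add_le X Y
    linarith
  have h6 : 2 * Real.pi * m.natAbs * |X + Y + X' + Y'|
      ≤ 2 * Real.pi * m.natAbs * (|X| + |Y| + |X'| + |Y'|) := by gcongr
  refine h6.trans ?_
  have h7 := mul_le_mul_of_nonneg_left h3 (mul_nonneg hK (Real.sqrt_nonneg (m.natAbs : ℝ)))
  have h8 := mul_le_mul_of_nonneg_left h3' hK'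
  have h9 : sinNorm β / Real.sqrt 2 * (Real.sqrt m.natAbs * (lapNorm t c * energyNorm t c))
      ≤ sinNorm β / Real.sqrt 2 * (lapNorm t c * Real.sqrt (lapNorm t c * energyNorm t c)) := by
    refine mul_le_mul_of_nonneg_left ?_ hK
    nlinarith [lapNorm_nonneg t c]
  linarith

-- Multiplication by zonal functions does not mix azimuthal orders, so the form is block diagonal
-- and the single-order estimates can be summed.
omit hβ hβ2 hΩ1 hΩ2 in
lemma skewForm_eq_sum (t : Finset PosIndex) (c : PosIndex → ℂ) :
    skewForm β Ω t c = ∑ m ∈ t.image (fun i => i.1.1.2),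
      skewForm β Ω (t.filter fun i => i.1.1.2 = m) c := by
  unfold skewForm
  rw [← Finset.sum_fiberwise_of_maps_to (t := t.image (fun i => i.1.1.2))
    (g := fun i : PosIndex => i.1.1.2) (fun i hi => Finset.mem_image_of_mem _ hi)]
  refine Finset.sum_congr rfl fun m _ => Finset.sum_congr rfl fun i hi => ?_
  rw [Finset.sum_filter]
  refine Finset.sum_congr rfl fun j _ => ?_
  split_ifs with h
  · rfl
  · unfold skewEntry
    rw [if_neg, mul_zero]
    rw [(Finset.mem_filter.1 hi).2]
    exact fun h' => h h'.symm

omit hβ hβ2 hΩ1 hΩ2 in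
lemma sum_mode_le (t : Finset PosIndex) (c : PosIndex → ℂ) :
    ∑ m ∈ t.image (fun i => i.1.1.2), lapNorm (t.filter fun i => i.1.1.2 = m) c
        * Real.sqrt (lapNorm (t.filter fun i => i.1.1.2 = m) c
          * energyNorm (t.filter fun i => i.1.1.2 = m) c)
      ≤ lapNorm t c * Real.sqrt (lapNorm t c * energyNorm t c) := by
  have h := sum_mul_sqrt_mul_le (t.image (fun i => i.1.1.2))
    (fun m => lapNorm_nonneg (t.filter fun i => i.1.1.2 = m) c)
    (fun m => energyNorm_nonneg (t.filter fun i => i.1.1.2 = m) c)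
  simp_rw [lapNorm_sq, energyNorm_sq] at h
  have hf : ∀ F : PosIndex → ℝ, ∑ m ∈ t.image (fun i => i.1.1.2), ∑ i ∈ t with i.1.1.2 = m, F i
      = ∑ i ∈ t, F i := fun F => Finset.sum_fiberwise_of_maps_to
    (fun i hi => Finset.mem_image_of_mem (fun i : PosIndex => i.1.1.2) hi) F
  rw [hf, hf] at h
  exact h

omit hΩ1 hΩ2 in
lemma abs_re_skewForm_le (t : Finset PosIndex) (c : PosIndex → ℂ) :
    |(skewForm β Ω t c).re| ≤ sinNorm β / Real.sqrt 2
      * (lapNorm t c * Real.sqrt (lapNorm t c * energyNorm t c)) := by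
  rw [skewForm_eq_sum, Complex.re_sum]
  refine (Finset.abs_sum_le_sum_abs _ _).trans ?_
  refine (Finset.sum_le_sum fun m _ => abs_re_skewForm_mode_le hβ hβ2 (m := m)
    (fun i hi => (Finset.mem_filter.1 hi).2) c).trans ?_
  rw [← Finset.mul_sum]
  exact mul_le_mul_of_nonneg_left (sum_mode_le t c)
    (div_nonneg (sinNorm_nonneg _) (Real.sqrt_nonneg _))

lemma abs_im_skewForm_le (t : Finset PosIndex) (c : PosIndex → ℂ) :
    |(skewForm β Ω t c).im| ≤ (sinNorm β / Real.sqrt 2 + 12.1 * sinNorm Ω)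
      * (lapNorm t c * Real.sqrt (lapNorm t c * energyNorm t c)) := by
  rw [skewForm_eq_sum, Complex.im_sum]
  refine (Finset.abs_sum_le_sum_abs _ _).trans ?_
  refine (Finset.sum_le_sum fun m _ => abs_im_skewForm_mode_le hβ hβ2 hΩ1 hΩ2 (m := m)
    (fun i hi => (Finset.mem_filter.1 hi).2) c).trans ?_
  rw [← Finset.mul_sum]
  exact mul_le_mul_of_nonneg_left (sum_mode_le t c)
    (add_nonneg (div_nonneg (sinNorm_nonneg _) (Real.sqrt_nonneg _))
      (mul_nonneg (by norm_num) (sinNorm_nonneg _)))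

end

/-! ### Lower bounds of the embedding constants -/

lemma rodrigues_zero (l : ℕ) : rodrigues l 0 = (X ^ 2 - 1) ^ l := rfl

lemma eval_rodrigues_one (x : ℝ) : (rodrigues 1 1).eval x = 2 * x := by
  rw [← derivative_rodrigues, rodrigues_zero]
  simp [one_add_one_eq_two]

lemma eval_rodrigues_two (x : ℝ) : (rodrigues 2 2).eval x = 12 * x ^ 2 - 4 := by
  rw [← derivative_rodrigues, ← derivative_rodrigues, rodrigues_zero]
  simp [derivative_pow]; ring

lemma eval_rodrigues_three (x : ℝ) : (rodrigues 3 3).eval x = 120 * x ^ 3 - 72 * x := by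
  rw [← derivative_rodrigues, ← derivative_rodrigues, ← derivative_rodrigues, rodrigues_zero]
  simp [derivative_pow]; ring

lemma eval_rodrigues_four (x : ℝ) :
    (rodrigues 4 4).eval x = 1680 * x ^ 4 - 1440 * x ^ 2 + 144 := by
  rw [← derivative_rodrigues, ← derivative_rodrigues, ← derivative_rodrigues,
    ← derivative_rodrigues, rodrigues_zero]
  simp [derivative_pow]; ring

/-- The index `(n + 1, 0)`. -/
def zonalIndex (n : ℕ) : PosIndex := ⟨⟨(n + 1, 0), by simp⟩, by simp⟩

lemma zonalIndex_injective : zonalIndex.Injective := by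
  intro a b h
  simpa [zonalIndex] using h

lemma unitEigenvalue_zonalIndex (n : ℕ) :
    unitEigenvalue (zonalIndex n).1 = (n + 1) * (n + 2) := by
  simp only [unitEigenvalue, zonalIndex]; push_cast; ring

lemma sphericalHarmonic_zonalIndex (n : ℕ) (p : ℝ × ℝ) :
    ((Real.sqrt (4 * Real.pi / (2 * n + 3)) : ℝ) : ℂ) * sphericalHarmonic (zonalIndex n).1 p
      = (((rodrigues (n + 1) (n + 1)).eval (Real.cos p.1)
        / (2 ^ (n + 1) * (n + 1).factorial) : ℝ) : ℂ) := by
  have hπ := Real.pi_pos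
  have h1 : Real.sqrt (4 * Real.pi / (2 * n + 3)) * Real.sqrt ((2 * n + 3) / (4 * Real.pi)) = 1 := by
    rw [← Real.sqrt_mul (by positivity)]
    rw [show 4 * Real.pi / (2 * n + 3) * ((2 * n + 3) / (4 * Real.pi)) = 1 by field_simp,
      Real.sqrt_one]
  rw [sphericalHarmonic_eq_profile]
  have h2 : profile (zonalIndex n).1 p.1 = Real.sqrt ((2 * n + 3) / (4 * Real.pi))
      * ((rodrigues (n + 1) (n + 1)).eval (Real.cos p.1)
        / (2 ^ (n + 1) * (n + 1).factorial)) := by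
    have hf : ((n + 1).factorial : ℝ) ≠ 0 := by positivity
    simp only [profile, legendre, polar, zonalIndex, Int.natAbs_zero, Nat.sub_zero, Nat.add_zero,
      pow_zero, one_mul]
    rw [div_self hf, mul_one]
    push_cast
    rw [show 2 * ((n : ℝ) + 1) + 1 = 2 * n + 3 by ring]
    ring
  rw [h2]
  simp only [zonalIndex, Int.cast_zero, mul_zero, zero_mul, Complex.exp_zero, mul_one]
  rw [← Complex.ofReal_mul, ← mul_assoc, h1, one_mul]

/-- The coefficients of `∑ a_k P_{k+1}(cos θ)`. -/
def zonalCoeff (N : ℕ) (a : ℕ → ℝ) : PosIndex →₀ ℂ :=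
  ∑ n ∈ Finset.range N,
    Finsupp.single (zonalIndex n) ((a n * Real.sqrt (4 * Real.pi / (2 * n + 3)) : ℝ) : ℂ)

lemma harmonicSum_zonalCoeff (N : ℕ) (a : ℕ → ℝ) (p : ℝ × ℝ) :
    harmonicSum (zonalCoeff N a) p = ((∑ n ∈ Finset.range N,
      a n * ((rodrigues (n + 1) (n + 1)).eval (Real.cos p.1)
        / (2 ^ (n + 1) * (n + 1).factorial)) : ℝ) : ℂ) := by
  unfold harmonicSum zonalCoeff
  rw [map_sum, Finset.sum_apply, Complex.ofReal_sum]
  refine Finset.sum_congr rfl fun n _ => ?_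
  rw [Finsupp.linearCombination_single, Pi.smul_apply, smul_eq_mul, Complex.ofReal_mul, mul_assoc,
    sphericalHarmonic_zonalIndex, ← Complex.ofReal_mul]

lemma zonalCoeff_apply_zonalIndex (N : ℕ) (a : ℕ → ℝ) {n : ℕ} (hn : n ∈ Finset.range N) :
    zonalCoeff N a (zonalIndex n) = ((a n * Real.sqrt (4 * Real.pi / (2 * n + 3)) : ℝ) : ℂ) := by
  unfold zonalCoeff
  rw [Finsupp.finsetSum_apply, Finset.sum_eq_single_of_mem n hn, Finsupp.single_eq_same]
  intro k _ hk
  exact Finsupp.single_eq_of_ne fun h => hk (zonalIndex_injective h).symm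

lemma norm_sq_of_ae_eq_harmonicSum {r : ℝ} (hr : 0 < r) (s : ℝ≥0) (N : ℕ) (a : ℕ → ℝ)
    {Ψ : HDiamond r s} (hΨ : Ψ.toFun =ᵐ[sphereMeasure r] harmonicSum (zonalCoeff N a)) :
    ‖Ψ‖ ^ 2 = ∑ n ∈ Finset.range N, (((n : ℝ) + 1) * (n + 2) / r ^ 2) ^ (s : ℝ)
      * (r ^ 2 * (a n ^ 2 * (4 * Real.pi / (2 * n + 3)))) := by
  have hπ := Real.pi_pos
  rw [norm_sq_eq_tsum_posIndex hr]
  have hc : ∀ i : PosIndex, harmonicCoeff r Ψ.toFun i.1 = r * zonalCoeff N a i := by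
    intro i
    rw [harmonicCoeff_congr r hΨ, harmonicCoeff_harmonicSum hr, dif_pos i.2]
  simp_rw [hc]
  rw [tsum_eq_sum (s := (Finset.range N).image zonalIndex), Finset.sum_image
    zonalIndex_injective.injOn]
  · refine Finset.sum_congr rfl fun n hn => ?_
    rw [eigenvalue_eq, unitEigenvalue_zonalIndex, zonalCoeff_apply_zonalIndex N a hn,
      ← Complex.ofReal_mul, Complex.norm_real, Real.norm_eq_abs, sq_abs, mul_pow, mul_pow,
      Real.sq_sqrt (by positivity)]
  · intro i hi
    have : zonalCoeff N a i = 0 := by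
      unfold zonalCoeff
      rw [Finsupp.finsetSum_apply]
      refine Finset.sum_eq_zero fun n hn => Finsupp.single_eq_of_ne fun h => hi ?_
      rw [h]
      exact Finset.mem_image_of_mem _ hn
    rw [this]
    simp

lemma eLpNorm_div_le_embeddingConst {r : ℝ} {s : ℝ≥0} {p : ℝ≥0∞} (f : HDiamond r s) :
    eLpNorm f.toFun p (sphereMeasure r) / ‖f‖ₑ ≤ embeddingConst r s p :=
  le_sInf fun _ hC => ENNReal.div_le_of_le_mul (hC f)

lemma integral_comp_fst_sphereMeasure (r : ℝ) (u : ℝ → ℝ) :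
    ∫ p, u p.1 ∂(sphereMeasure r)
      = 2 * Real.pi * r ^ 2 * ∫ θ in (0 : ℝ)..Real.pi, u θ * Real.sin θ := by
  have h := integral_sphereMeasure_mul_exp r (fun θ => ((u θ : ℝ) : ℂ)) 0
  simp only [Int.cast_zero, mul_zero, zero_mul, Complex.exp_zero, mul_one, if_true] at h
  rw [integral_complex_ofReal] at h
  have h3 : ∫ θ in (0 : ℝ)..Real.pi, ((u θ : ℝ) : ℂ) * Real.sin θ
      = ((∫ θ in (0 : ℝ)..Real.pi, u θ * Real.sin θ : ℝ) : ℂ) := by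
    rw [← intervalIntegral.integral_ofReal]
    simp
  rw [h3] at h
  exact_mod_cast h

lemma integral_comp_cos_mul_sin {g : ℝ → ℝ} (hg : Continuous g) :
    ∫ θ in (0 : ℝ)..Real.pi, g (Real.cos θ) * Real.sin θ = ∫ x in (-1 : ℝ)..1, g x := by
  have h := intervalIntegral.integral_comp_mul_deriv (a := 0) (b := Real.pi)
    (fun x _ => Real.hasDerivAt_cos x) Real.continuous_sin.neg.continuousOn hg
  rw [Real.cos_zero, Real.cos_pi, intervalIntegral.integral_symm (-1) 1] at h
  simp only [Function.comp, mul_neg, intervalIntegral.integral_neg] at h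
  linarith

/-- A combination of Legendre polynomials bounds the embedding constant from below. -/
lemma exists_le_embeddingConst {r : ℝ} (hr : 0 < r) (s : ℝ≥0) {k : ℕ} (hk : k ≠ 0) (N : ℕ)
    (a : ℕ → ℝ) {g : ℝ → ℝ} (hg : Continuous g) (hga : ∀ x, g x = ∑ n ∈ Finset.range N,
      a n * ((rodrigues (n + 1) (n + 1)).eval x / (2 ^ (n + 1) * (n + 1).factorial)))
    (hpos : 0 < ∑ n ∈ Finset.range N, (((n : ℝ) + 1) * (n + 2) / r ^ 2) ^ (s : ℝ)
      * (r ^ 2 * (a n ^ 2 * (4 * Real.pi / (2 * n + 3))))) :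
    ∃ L : ℝ, 0 ≤ L ∧ ENNReal.ofReal L ≤ embeddingConst r s k ∧
      (L ^ 2) ^ k * (∑ n ∈ Finset.range N, (((n : ℝ) + 1) * (n + 2) / r ^ 2) ^ (s : ℝ)
        * (r ^ 2 * (a n ^ 2 * (4 * Real.pi / (2 * n + 3))))) ^ k
        = (2 * Real.pi * r ^ 2 * ∫ x in (-1 : ℝ)..1, |g x| ^ k) ^ 2 := by
  obtain ⟨Ψ, hΨ⟩ := exists_hDiamond_eq hr s (zonalCoeff N a)
  have hn := norm_sq_of_ae_eq_harmonicSum hr s N a hΨ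
  rw [← hn] at hpos ⊢
  have hn0 : 0 < ‖Ψ‖ := by
    rcases (norm_nonneg Ψ).eq_or_lt with h | h
    · rw [← h] at hpos; norm_num at hpos
    · exact h
  have h1 := eLpNorm_div_le_embeddingConst (p := k) Ψ
  have hkr : ((k : ℝ≥0∞)).toReal = k := ENNReal.toReal_natCast k
  rw [eLpNorm_congr_ae hΨ, (memLp_harmonicSum r _ k).eLpNorm_eq_integral_rpow_norm
    (by exact_mod_cast hk) (ENNReal.natCast_ne_top k), ← ofReal_norm,
    ← ENNReal.ofReal_div_of_pos hn0, hkr] at h1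
  have h2 : ∫ p, ‖harmonicSum (zonalCoeff N a) p‖ ^ (k : ℝ) ∂(sphereMeasure r)
      = 2 * Real.pi * r ^ 2 * ∫ x in (-1 : ℝ)..1, |g x| ^ k := by
    rw [← integral_comp_cos_mul_sin (by fun_prop), ← integral_comp_fst_sphereMeasure r
      (fun θ => |g (Real.cos θ)| ^ k)]
    congr 1; ext p
    rw [harmonicSum_zonalCoeff, ← hga, Complex.norm_real, Real.rpow_natCast, Real.norm_eq_abs]
  rw [h2] at h1
  have hI : 0 ≤ 2 * Real.pi * r ^ 2 * ∫ x in (-1 : ℝ)..1, |g x| ^ k := by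
    have h3 : 0 ≤ ∫ x in (-1 : ℝ)..1, |g x| ^ k :=
      intervalIntegral.integral_nonneg (by norm_num) fun x _ => by positivity
    have := Real.pi_pos
    positivity
  -- The bound L is the quotient of the two norms of the test function. Its defining identity is
  -- raised to the power 2k, so that only the k-th power integral and the squared Sobolev norm
  -- enter.
  refine ⟨_, div_nonneg (Real.rpow_nonneg hI _) hn0.le, h1, ?_⟩
  rw [← mul_pow, div_pow, div_mul_cancel₀ _ (by positivity), ← pow_mul, mul_comm 2 k, pow_mul,
    Real.rpow_inv_natCast_pow hI hk]

lemma integral_abs_pow_three : ∫ x in (-1 : ℝ)..1, |x| ^ 3 = 1 / 2 := by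
  have hc : ∀ a b : ℝ, IntervalIntegrable (fun x : ℝ => |x| ^ 3) volume a b := fun a b =>
    Continuous.intervalIntegrable (by fun_prop) _ _
  have h1 : ∫ x in (0 : ℝ)..1, |x| ^ 3 = 1 / 4 := by
    rw [intervalIntegral.integral_congr (g := fun x : ℝ => x ^ 3), integral_pow]
    · norm_num
    · intro x hx
      rw [Set.uIcc_of_le zero_le_one] at hx
      simp only [abs_of_nonneg hx.1]
  have h2 : ∫ x in (-1 : ℝ)..0, |x| ^ 3 = ∫ x in (0 : ℝ)..1, |x| ^ 3 := by
    have := intervalIntegral.integral_comp_neg (a := 0) (b := 1) (fun x : ℝ => |x| ^ 3)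
    simp only [abs_neg, neg_zero] at this
    exact this.symm
  rw [← intervalIntegral.integral_add_adjacent_intervals (hc _ 0) (hc _ _), h2, h1]
  norm_num

/-- The even power removes the absolute value. The list `b` holds the coefficients of the sixth
power of the numerator in increasing degree. -/
lemma integral_pow_six : ∫ x in (-1 : ℝ)..1,
    |(35 * x ^ 4 + 20 * x ^ 3 - 6 * x ^ 2 + 20 * x - 5) / 32| ^ 6 = 2280139021 / 713897184 := by
  let b : ℕ → ℝ := fun n => ([15625, -375000, 3862500, -22625000, 85181250, -222525000, 411752500,
    -473355000, 89640375, 856522000, -2034465720, 2115968880, -286487844, -2243727120, 5521868040,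
    -419014000, 2537658375, 11025405000, 5079692500, 9672075000, 14008181250, 7760375000,
    7112962500, 6302625000, 1838265625] : List ℝ).getD n 0
  have h : ∀ x : ℝ, |(35 * x ^ 4 + 20 * x ^ 3 - 6 * x ^ 2 + 20 * x - 5) / 32| ^ 6
      = ∑ n ∈ Finset.range 25, b n / 32 ^ 6 * x ^ n := by
    intro x
    rw [(by decide : Even 6).pow_abs]
    simp only [Finset.sum_range_succ, Finset.sum_range_zero, b, List.getD_cons_zero,
      List.getD_cons_succ]
    ring
  simp_rw [h]
  rw [intervalIntegral.integral_finsetSum fun n _ =>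
    (Continuous.intervalIntegrable (by fun_prop) _ _)]
  simp_rw [intervalIntegral.integral_const_mul, integral_pow]
  simp only [Finset.sum_range_succ, Finset.sum_range_zero, b, List.getD_cons_zero,
      List.getD_cons_succ]
  norm_num

/-- A lower bound of the product of the two embedding constants. -/
lemma exists_le_embeddingConst_mul {r : ℝ} (hr : 0 < r) :
    ∃ L₁ L₂ : ℝ, 0 ≤ L₁ ∧ 0 ≤ L₂ ∧ ENNReal.ofReal L₁ ≤ embeddingConst r 1 6 ∧
      ENNReal.ofReal L₂ ≤ embeddingConst r (1 / 2) 3 ∧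
      2.6 * r ^ 2 ≤ 64 * Real.pi ^ 2 * (L₁ * L₂) ^ 4 := by
  have hπ := Real.pi_pos
  -- The test function for L⁶ is P₁ + P₂/2 + P₃/4 + P₄/4, and for L³ it is P₁. Using P₁ twice would
  -- give only about 1.74 in place of 2.6, less than the roughly 2.47 that the comparison in
  -- `form_const_le` requires.
  let a : ℕ → ℝ := fun n => if n = 0 then 1 else if n = 1 then 1 / 2 else 1 / 4
  have e1 : ∑ n ∈ Finset.range 4, (((n : ℝ) + 1) * (n + 2) / r ^ 2) ^ (((1 : ℝ≥0)) : ℝ)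
      * (r ^ 2 * (a n ^ 2 * (4 * Real.pi / (2 * n + 3)))) = 4 * Real.pi * (382 / 315) := by
    simp [Finset.sum_range_succ, a]
    field_simp
    norm_num
  have e2 : ∑ n ∈ Finset.range 1, (((n : ℝ) + 1) * (n + 2) / r ^ 2) ^ (((1 / 2 : ℝ≥0)) : ℝ)
      * (r ^ 2 * ((fun _ => 1 : ℕ → ℝ) n ^ 2 * (4 * Real.pi / (2 * n + 3))))
      = Real.sqrt 2 * r * (4 * Real.pi / 3) := by
    have : ((2 : ℝ) / r ^ 2) ^ (1 / 2 : ℝ) = Real.sqrt 2 / r := by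
      rw [← Real.sqrt_eq_rpow, Real.sqrt_div (by norm_num), Real.sqrt_sq hr.le]
    simp only [Finset.sum_range_one, Nat.cast_zero, zero_add, one_mul, mul_zero, one_pow,
      NNReal.coe_div, NNReal.coe_one, NNReal.coe_ofNat, this]
    field_simp
  obtain ⟨L₁, hL₁, h1, h1'⟩ := exists_le_embeddingConst hr 1 (k := 6) (by norm_num) 4 a
    (g := fun x => (35 * x ^ 4 + 20 * x ^ 3 - 6 * x ^ 2 + 20 * x - 5) / 32) (by fun_prop)
    (fun x => by
      simp [Finset.sum_range_succ, a, eval_rodrigues_one, eval_rodrigues_two, eval_rodrigues_three,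
        eval_rodrigues_four, Nat.factorial]
      ring) (by rw [e1]; positivity)
  obtain ⟨L₂, hL₂, h2, h2'⟩ := exists_le_embeddingConst hr (1 / 2) (k := 3) (by norm_num) 1
    (fun _ => 1) (g := fun x => x) (by fun_prop)
    (fun x => by simp [eval_rodrigues_one]) (by rw [e2]; positivity)
  rw [e1, integral_pow_six] at h1'
  rw [e2, integral_abs_pow_three] at h2'
  refine ⟨L₁, L₂, hL₁, hL₂, by exact_mod_cast h1, by exact_mod_cast h2, ?_⟩
  -- Cubing turns (L₁ L₂)⁴ into twelfth powers, for which the test functions give explicit values: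
  -- rational up to powers of r and π.
  refine le_of_pow_le_pow_left₀ (n := 3) (by norm_num) (by positivity) ?_
  have h3 : Real.sqrt 2 ^ 6 = 8 := by
    have h3' : Real.sqrt 2 ^ 2 = 2 := Real.sq_sqrt (by norm_num)
    calc Real.sqrt 2 ^ 6 = (Real.sqrt 2 ^ 2) ^ 3 := by ring
      _ = 8 := by rw [h3']; norm_num
  have h4 : L₁ ^ 12 = r ^ 4 * (2280139021 / 713897184) ^ 2 / (1024 * (382 / 315) ^ 6 * Real.pi ^ 4) := by
    rw [eq_div_iff (by positivity)]
    have : L₁ ^ 12 * (1024 * (382 / 315) ^ 6 * Real.pi ^ 4) * (4 * Real.pi ^ 2)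
        = r ^ 4 * (2280139021 / 713897184) ^ 2 * (4 * Real.pi ^ 2) := by
      linear_combination h1'
    exact mul_right_cancel₀ (by positivity) this
  have h5 : L₂ ^ 12 = r ^ 2 * 729 / (32768 * Real.pi ^ 2) := by
    rw [eq_div_iff (by positivity)]
    have h6 : (L₂ ^ 6 * (Real.sqrt 2 * r * (4 * Real.pi / 3)) ^ 3) ^ 2 = (Real.pi ^ 2 * r ^ 4) ^ 2 := by
      rw [show L₂ ^ 6 = (L₂ ^ 2) ^ 3 by ring, h2']; ring
    have h7 : L₂ ^ 12 * (32768 * Real.pi ^ 2) * (r ^ 6 * Real.pi ^ 4)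
        = r ^ 2 * 729 * (r ^ 6 * Real.pi ^ 4) := by
      have : (L₂ ^ 6 * (Real.sqrt 2 * r * (4 * Real.pi / 3)) ^ 3) ^ 2
          = L₂ ^ 12 * Real.sqrt 2 ^ 6 * r ^ 6 * (4 * Real.pi / 3) ^ 6 := by ring
      rw [this, h3] at h6
      linear_combination 729 * h6
    exact mul_right_cancel₀ (by positivity) h7
  have h8 : (64 * Real.pi ^ 2 * (L₁ * L₂) ^ 4) ^ 3
      = 64 ^ 3 * Real.pi ^ 6 * (L₁ ^ 12 * L₂ ^ 12) := by ring
  rw [h8, h4, h5, show (2.6 * r ^ 2) ^ 3 = 2.6 ^ 3 * r ^ 6 by ring]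
  have h9 : 64 ^ 3 * Real.pi ^ 6 * (r ^ 4 * (2280139021 / 713897184) ^ 2
      / (1024 * (382 / 315) ^ 6 * Real.pi ^ 4) * (r ^ 2 * 729 / (32768 * Real.pi ^ 2)))
      = 64 ^ 3 * ((2280139021 / 713897184) ^ 2 / (1024 * (382 / 315) ^ 6) * (729 / 32768))
        * r ^ 6 := by
    field_simp
  rw [h9]
  gcongr
  norm_num

/-! ### Finite rank perturbations of isomorphisms -/

section Index

variable {k V : Type*} [Field k] [AddCommGroup V] [Module k V] (F : V →ₗ[k] V)

lemma ker_id_sub_le : (LinearMap.id - F).ker ≤ F.range := by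
  intro x hx
  have : x - F x = 0 := by simpa using hx
  exact ⟨x, (sub_eq_zero.1 this).symm⟩

lemma surjective_mkQ_comp_subtype :
    Function.Surjective ((LinearMap.id - F).range.mkQ ∘ₗ F.range.subtype) := by
  intro q
  obtain ⟨x, rfl⟩ := Submodule.mkQ_surjective _ q
  refine ⟨⟨F x, x, rfl⟩, ?_⟩
  simp only [LinearMap.comp_apply, Submodule.subtype_apply, Submodule.mkQ_apply]
  rw [Submodule.Quotient.eq]
  exact ⟨-x, by simp; abel⟩

variable [FiniteDimensional k F.range]

instance finiteDimensional_ker_id_sub : FiniteDimensional k (LinearMap.id - F).ker :=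
  Submodule.finiteDimensional_of_le (ker_id_sub_le F)

instance finiteDimensional_coker_id_sub : FiniteDimensional k (V ⧸ (LinearMap.id - F).range) :=
  Module.Finite.of_surjective _ (surjective_mkQ_comp_subtype F)

/-- A finite rank perturbation of the identity has index zero. -/
lemma index_id_sub : (LinearMap.id - F).index = 0 := by
  have hmap : ∀ x ∈ F.range, (LinearMap.id - F : V →ₗ[k] V) x ∈ F.range := fun x hx =>
    Submodule.sub_mem _ hx ⟨x, rfl⟩
  -- Kernel and cokernel of id - F are those of its restriction to the finite-dimensional range of
  -- F. There rank-nullity makes their dimensions equal.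
  set T := (LinearMap.id - F).restrict hmap with hT
  set g := (LinearMap.id - F).range.mkQ ∘ₗ F.range.subtype with hg
  have h1 : Module.finrank k (LinearMap.id - F).ker = Module.finrank k T.ker := by
    have : T.ker.map F.range.subtype = (LinearMap.id - F).ker := by
      ext x
      simp only [Submodule.mem_map, LinearMap.mem_ker, Submodule.subtype_apply]
      constructor
      · rintro ⟨y, hy, rfl⟩
        exact congrArg Subtype.val hy
      · intro hx
        exact ⟨⟨x, ker_id_sub_le F hx⟩, Subtype.ext hx, rfl⟩
    rw [← this, Submodule.finrank_map_subtype_eq]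
  have h2 : g.ker = T.range := by
    ext w
    simp only [hg, LinearMap.mem_ker, LinearMap.comp_apply, Submodule.subtype_apply,
      Submodule.mkQ_apply, Submodule.Quotient.mk_eq_zero, LinearMap.mem_range]
    constructor
    · rintro ⟨x, hx⟩
      have hxw : x ∈ F.range := by
        have : x = w + F x := by rw [← hx]; simp
        rw [this]
        exact Submodule.add_mem _ w.2 ⟨x, rfl⟩
      exact ⟨⟨x, hxw⟩, Subtype.ext hx⟩
    · rintro ⟨x, rfl⟩
      exact ⟨x, rfl⟩
  have h3 := LinearMap.finrank_range_add_finrank_ker g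
  have h4 := LinearMap.finrank_range_add_finrank_ker T
  rw [LinearMap.range_eq_top.2 (surjective_mkQ_comp_subtype F), finrank_top, h2] at h3
  rw [LinearMap.index_eq_finrank_sub, h1]
  omega

end Index

open scoped LinearMap.FiniteRangeSetoid in
/-- A finite rank perturbation of an isomorphism is a Fredholm operator of index zero. -/
lemma isFredholm_of_eq_sub {X Y : Type*} [AddCommGroup X] [Module ℂ X] [TopologicalSpace X]
    [IsTopologicalAddGroup X] [ContinuousSMul ℂ X] [T2Space X]
    [AddCommGroup Y] [Module ℂ Y] [TopologicalSpace Y]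
    [IsTopologicalAddGroup Y] [ContinuousSMul ℂ Y] [T2Space Y] {B : X →L[ℂ] Y} (L : X ≃L[ℂ] Y)
    {G : X →L[ℂ] Y} [FiniteDimensional ℂ G.toLinearMap.range]
    (hB : B = (L : X →L[ℂ] Y) - G) : B.IsFredholm ∧ B.toLinearMap.index = 0 := by
  -- Factoring B = L ∘ (id - L⁻¹G) reduces the index to that of a finite rank perturbation of the
  -- identity.
  set F : X →ₗ[ℂ] X := L.symm.toLinearMap ∘ₗ G.toLinearMap with hF
  have hfin : FiniteDimensional ℂ F.range := by
    rw [hF, LinearMap.range_comp]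
    infer_instance
  have hcomp : B.toLinearMap = L.toLinearEquiv.toLinearMap ∘ₗ (LinearMap.id - F) := by
    ext x
    simp [hB, hF]
  constructor
  · refine ContinuousLinearMap.IsFredholm.of_isQuasiInverse (v := (L.symm : Y →L[ℂ] X)) ?_
    refine (LinearEquiv.isQuasiInverse L.toLinearEquiv).congr (Setoid.refl _) ?_
    rw [LinearMap.FiniteRangeSetoid.equiv_iff_hasFiniteRange]
    have : B.toLinearMap - L.toLinearEquiv.toLinearMap = -G.toLinearMap := by
      ext x
      simp [hB]
    change (B.toLinearMap - L.toLinearEquiv.toLinearMap).HasFiniteRange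
    rw [this]
    exact LinearMap.HasFiniteRange.neg (Module.Finite.iff_fg.1 inferInstance)
  · have : FiniteDimensional ℂ L.toLinearEquiv.toLinearMap.ker := by
      rw [LinearEquiv.ker]; infer_instance
    have : FiniteDimensional ℂ (Y ⧸ L.toLinearEquiv.toLinearMap.range) := by
      rw [LinearEquiv.range]; infer_instance
    rw [hcomp, LinearMap.index_comp, index_id_sub, LinearEquiv.index_eq_zero, add_zero]

/-! ### Operators on a Hilbert space -/

/-- The Lax-Milgram argument: coercivity bounds A from below, so A is injective with closed range,
and a vector z orthogonal to the range satisfies ⟨z, A z⟩ = 0, hence z = 0. -/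
lemma exists_equiv_of_coercive {E : Type*} [NormedAddCommGroup E] [InnerProductSpace ℂ E]
    [CompleteSpace E] (A : E →L[ℂ] E) {c : ℝ} (hc : 0 < c)
    (h : ∀ x, c * ‖x‖ ^ 2 ≤ (inner ℂ x (A x)).re) : ∃ L : E ≃L[ℂ] E, (L : E →L[ℂ] E) = A := by
  have hb : ∀ x, c * ‖x‖ ≤ ‖A x‖ := by
    intro x
    rcases (norm_nonneg x).eq_or_lt with hx | hx
    · rw [← hx, mul_zero]; exact norm_nonneg _
    · have h1 := (h x).trans ((Complex.re_le_norm _).trans (norm_inner_le_norm x (A x)))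
      refine le_of_mul_le_mul_left ?_ hx
      linarith
  have ha : AntilipschitzWith (Real.toNNReal c⁻¹) A := by
    refine A.antilipschitz_of_bound fun x => ?_
    rw [Real.coe_toNNReal _ (by positivity), inv_mul_eq_div, le_div_iff₀ hc, mul_comm]
    exact hb x
  have hclosed : IsClosed (A.toLinearMap.range : Set E) := by
    rw [LinearMap.coe_range]
    exact ha.isClosed_range A.uniformContinuous
  have htop : A.toLinearMap.range = ⊤ := by
    have : CompleteSpace A.toLinearMap.range := hclosed.completeSpace_coe
    rw [← Submodule.orthogonal_eq_bot_iff, Submodule.eq_bot_iff]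
    intro z hz
    have h1 := (Submodule.mem_orthogonal' _ _).1 hz (A z) ⟨z, rfl⟩
    have h2 := h z
    rw [h1, Complex.zero_re] at h2
    have h3 : ‖z‖ ^ 2 ≤ 0 := by nlinarith
    exact norm_eq_zero.1 (pow_eq_zero_iff two_ne_zero |>.1 (le_antisymm h3 (sq_nonneg _)))
  exact ⟨ContinuousLinearEquiv.ofBijective A (LinearMap.ker_eq_bot.2 ha.injective) htop,
    ContinuousLinearEquiv.coe_ofBijective _ _ _⟩

section Form

variable {ι : Type*}

/-- The sesquilinear form with the given coefficients on finitely supported sequences. -/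
def finForm (P : ι → ι → ℂ) (c d : ι →₀ ℂ) : ℂ :=
  d.sum fun j b => starRingEnd ℂ b * Finsupp.linearCombination ℂ (fun i => P i j) c

variable (P : ι → ι → ℂ)

lemma finForm_eq_sum (c d : ι →₀ ℂ) :
    finForm P c d
      = ∑ i ∈ c.support, ∑ j ∈ d.support, c i * starRingEnd ℂ (d j) * P i j := by
  unfold finForm
  rw [Finset.sum_comm, Finsupp.sum]
  refine Finset.sum_congr rfl fun j _ => ?_
  rw [Finsupp.linearCombination_apply, Finsupp.sum, Finset.mul_sum]
  refine Finset.sum_congr rfl fun i _ => ?_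
  rw [smul_eq_mul]; ring

lemma finForm_add_left (c c' d : ι →₀ ℂ) : finForm P (c + c') d = finForm P c d + finForm P c' d := by
  unfold finForm
  rw [← Finsupp.sum_add]
  exact Finsupp.sum_congr fun j _ => by rw [map_add, mul_add]

lemma finForm_smul_left (a : ℂ) (c d : ι →₀ ℂ) : finForm P (a • c) d = a * finForm P c d := by
  unfold finForm
  rw [Finsupp.mul_sum]
  exact Finsupp.sum_congr fun j _ => by rw [map_smul, smul_eq_mul]; ring

lemma finForm_add_right (c d d' : ι →₀ ℂ) : finForm P c (d + d') = finForm P c d + finForm P c d' :=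
  Finsupp.sum_add_index' (by simp) (by intros; rw [map_add, add_mul])

lemma finForm_smul_right (a : ℂ) (c d : ι →₀ ℂ) :
    finForm P c (a • d) = starRingEnd ℂ a * finForm P c d := by
  unfold finForm
  rw [Finsupp.sum_smul_index (by simp), Finsupp.mul_sum]
  exact Finsupp.sum_congr fun j _ => by rw [map_mul]; ring

/-- The unit vectors of `ℓ²`. -/
def unitVec (i : ι) : lp (fun _ : ι => ℂ) 2 := by
  classical exact lp.single 2 i 1

/-- The finitely supported sequences as elements of `ℓ²`. -/
def finEmb : (ι →₀ ℂ) →ₗ[ℂ] lp (fun _ : ι => ℂ) 2 := Finsupp.linearCombination ℂ unitVec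

lemma inner_unitVec (i : ι) (x : lp (fun _ : ι => ℂ) 2) : inner ℂ (unitVec i) x = x i := by
  classical
  have := lp.inner_single_left (𝕜 := ℂ) (G := fun _ : ι => ℂ) i (1 : ℂ) x
  simpa [unitVec] using this

lemma inner_finEmb (d : ι →₀ ℂ) (x : lp (fun _ : ι => ℂ) 2) :
    inner ℂ (finEmb d) x = ∑ j ∈ d.support, starRingEnd ℂ (d j) * x j := by
  rw [finEmb, Finsupp.linearCombination_apply, Finsupp.sum, sum_inner]
  exact Finset.sum_congr rfl fun j _ => by rw [inner_smul_left, inner_unitVec]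

lemma finEmb_apply (c : ι →₀ ℂ) (i : ι) : finEmb c i = c i := by
  classical
  rw [← inner_unitVec, ← inner_conj_symm, inner_finEmb]
  simp only [unitVec, lp.single_apply, Pi.single_apply]
  simp
  split_ifs with h <;> simp [h]

lemma norm_sq_finEmb (c : ι →₀ ℂ) : ‖finEmb c‖ ^ 2 = ∑ i ∈ c.support, ‖c i‖ ^ 2 := by
  have h := inner_self_eq_norm_sq_to_K (𝕜 := ℂ) (finEmb c)
  rw [inner_finEmb] at h
  simp_rw [finEmb_apply] at h
  have h2 : ∀ i, starRingEnd ℂ (c i) * c i = ((‖c i‖ ^ 2 : ℝ) : ℂ) := fun i => by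
    rw [Complex.conj_mul']; push_cast; rfl
  simp_rw [h2] at h
  rw [← Complex.ofReal_sum] at h
  exact (Complex.ofReal_injective (by simpa using h)).symm

lemma denseRange_finEmb : DenseRange (finEmb : (ι →₀ ℂ) → lp (fun _ : ι => ℂ) 2) := by
  classical
  intro x
  refine mem_closure_of_tendsto (lp.hasSum_single (by norm_num) x)
    (Filter.Eventually.of_forall fun s => ?_)
  refine ⟨∑ i ∈ s, Finsupp.single i (x i), ?_⟩
  rw [map_sum]
  refine Finset.sum_congr rfl fun i _ => ?_
  rw [finEmb, Finsupp.linearCombination_single, unitVec, ← lp.single_smul, smul_eq_mul, mul_one]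

/-- Complex polarization and two parallelogram laws. The bounds of the two parts of the form are
available on the diagonal only. -/
lemma norm_finForm_le_add {K : ℝ} (h : ∀ c, ‖finForm P c c‖ ≤ K * ‖finEmb c‖ ^ 2)
    (c d : ι →₀ ℂ) : ‖finForm P c d‖ ≤ K * (‖finEmb c‖ ^ 2 + ‖finEmb d‖ ^ 2) := by
  have hpol : 4 * finForm P c d = finForm P (c + d) (c + d) - finForm P (c - d) (c - d)
      + Complex.I * finForm P (c + Complex.I • d) (c + Complex.I • d)
      - Complex.I * finForm P (c - Complex.I • d) (c - Complex.I • d) := by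
    simp only [sub_eq_add_neg, ← neg_one_smul ℂ d, ← neg_one_smul ℂ (Complex.I • d),
      finForm_add_left, finForm_add_right, finForm_smul_left, finForm_smul_right, Complex.conj_I,
      map_neg, map_one]
    ring_nf
    rw [Complex.I_sq]
    ring
  have h1 := parallelogram_law_with_norm ℂ (finEmb c) (finEmb d)
  have h2 := parallelogram_law_with_norm ℂ (finEmb c) (finEmb (Complex.I • d))
  have hI : ‖finEmb (Complex.I • d)‖ = ‖finEmb d‖ := by
    rw [map_smul, norm_smul, Complex.norm_I, one_mul]
  rw [hI] at h2
  rw [← map_add, ← map_sub] at h1 h2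
  have b1 := h (c + d)
  have b2 := h (c - d)
  have b3 := h (c + Complex.I • d)
  have b4 := h (c - Complex.I • d)
  have h4 : ‖4 * finForm P c d‖ ≤ ‖finForm P (c + d) (c + d)‖ + ‖finForm P (c - d) (c - d)‖
      + ‖finForm P (c + Complex.I • d) (c + Complex.I • d)‖
      + ‖finForm P (c - Complex.I • d) (c - Complex.I • d)‖ := by
    rw [hpol]
    refine (norm_sub_le _ _).trans ?_
    rw [norm_mul, Complex.norm_I, one_mul]
    gcongr
    refine (norm_add_le _ _).trans ?_
    rw [norm_mul, Complex.norm_I, one_mul]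
    gcongr
    exact norm_sub_le _ _
  rw [norm_mul, show ‖(4 : ℂ)‖ = 4 by norm_num] at h4
  have h3 := congrArg (K * ·) h1
  have h5 := congrArg (K * ·) h2
  linarith

/-- Normalizing both arguments to length one turns the sum of squares into a product of norms. -/
lemma norm_finForm_le {K : ℝ} (h : ∀ c, ‖finForm P c c‖ ≤ K * ‖finEmb c‖ ^ 2)
    (c d : ι →₀ ℂ) : ‖finForm P c d‖ ≤ 2 * K * ‖finEmb c‖ * ‖finEmb d‖ := by
  have hz : ∀ c : ι →₀ ℂ, ‖finEmb c‖ = 0 → c = 0 := by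
    intro c hc
    ext i
    rw [← finEmb_apply, norm_eq_zero.1 hc]; rfl
  rcases (norm_nonneg (finEmb c)).eq_or_lt with hc | hc
  · rw [hz c hc.symm]
    simp [finForm]
  rcases (norm_nonneg (finEmb d)).eq_or_lt with hd | hd
  · rw [hz d hd.symm]
    simp [finForm]
  have h1 := norm_finForm_le_add P h (((‖finEmb c‖⁻¹ : ℝ) : ℂ) • c) (((‖finEmb d‖⁻¹ : ℝ) : ℂ) • d)
  rw [finForm_smul_left, finForm_smul_right, map_smul, map_smul, norm_smul, norm_smul, norm_mul,
    norm_mul, Complex.conj_ofReal, Complex.norm_real, Complex.norm_real, Real.norm_of_nonneg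
    (by positivity), Real.norm_of_nonneg (by positivity), inv_mul_cancel₀ hc.ne',
    inv_mul_cancel₀ hd.ne'] at h1
  have h2 : ‖finForm P c d‖ = ‖finEmb c‖ * ‖finEmb d‖
      * (‖finEmb c‖⁻¹ * (‖finEmb d‖⁻¹ * ‖finForm P c d‖)) := by
    field_simp
  rw [h2]
  calc _ ≤ ‖finEmb c‖ * ‖finEmb d‖ * (K * (1 ^ 2 + 1 ^ 2)) := by gcongr
    _ = _ := by ring

/-- A sesquilinear form that is bounded on the diagonal is given by a bounded operator. -/
lemma exists_operator {K : ℝ} (h : ∀ c, ‖finForm P c c‖ ≤ K * ‖finEmb c‖ ^ 2) :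
    ∃ A : lp (fun _ : ι => ℂ) 2 →L[ℂ] lp (fun _ : ι => ℂ) 2,
      ∀ c d, inner ℂ (finEmb d) (A (finEmb c)) = finForm P c d := by
  classical
  let v : (ι →₀ ℂ) → ι → ℂ := fun c j => Finsupp.linearCombination ℂ (fun i => P i j) c
  have hv : ∀ c (s : Finset ι), ∑ j ∈ s, ‖v c j‖ ^ 2 ≤ (2 * K * ‖finEmb c‖) ^ 2 := by
    intro c s
    -- Testing the form against the truncated image sequence itself gives its squared ℓ² norm on the
    -- left.
    set d : ι →₀ ℂ := Finsupp.indicator s fun j _ => v c j with hd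
    have hd1 : ∀ j ∈ s, d j = v c j := fun j hj => by
      rw [hd, Finsupp.indicator_of_mem hj]
    have hsub : d.support ⊆ s := Finsupp.support_indicator_subset _ _
    have h1 : finForm P c d = ((∑ j ∈ s, ‖v c j‖ ^ 2 : ℝ) : ℂ) := by
      unfold finForm
      rw [Finsupp.sum_of_support_subset _ hsub _ (by simp), Complex.ofReal_sum]
      refine Finset.sum_congr rfl fun j hj => ?_
      rw [hd1 j hj, Complex.conj_mul']
      push_cast; rfl
    have h2 : ‖finEmb d‖ ^ 2 = ∑ j ∈ s, ‖v c j‖ ^ 2 := by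
      rw [norm_sq_finEmb, Finset.sum_subset hsub]
      · exact Finset.sum_congr rfl fun j hj => by rw [hd1 j hj]
      · intro j _ hj
        rw [Finsupp.notMem_support_iff.1 hj]; simp
    have h3 := norm_finForm_le P h c d
    rw [h1, Complex.norm_real, Real.norm_of_nonneg (Finset.sum_nonneg fun _ _ => by positivity),
      ← h2] at h3
    rw [← h2]
    rcases (norm_nonneg (finEmb d)).eq_or_lt with h0 | h0
    · rw [← h0]; simpa using sq_nonneg (2 * K * ‖finEmb c‖)
    · have h4 : ‖finEmb d‖ ≤ 2 * K * ‖finEmb c‖ := le_of_mul_le_mul_right (by linarith) h0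
      gcongr
  have hmem : ∀ c, Memℓp (v c) 2 := fun c =>
    memℓp_gen' (C := (2 * K * ‖finEmb c‖) ^ 2) fun s => by simpa using hv c s
  let S : (ι →₀ ℂ) →ₗ[ℂ] lp (fun _ : ι => ℂ) 2 :=
    { toFun := fun c => ⟨v c, hmem c⟩
      map_add' := fun c c' => by
        ext j
        exact map_add (Finsupp.linearCombination ℂ (fun i => P i j)) c c'
      map_smul' := fun a c => by
        ext j
        exact map_smul (Finsupp.linearCombination ℂ (fun i => P i j)) a c }
  have hS : ∀ c, ‖S c‖ ≤ |2 * K| * ‖finEmb c‖ := by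
    intro c
    refine lp.norm_le_of_forall_sum_le (by norm_num) (by positivity) fun s => ?_
    have := hv c s
    rw [← sq_abs (2 * K * _), abs_mul, abs_norm] at this
    simp only [ENNReal.toReal_ofNat, Real.rpow_ofNat]
    exact this
  refine ⟨S.extendOfNorm finEmb, fun c d => ?_⟩
  rw [LinearMap.extendOfNorm_eq denseRange_finEmb ⟨_, hS⟩, inner_finEmb]
  rfl

end Form

/-! ### Coercivity up to finite rank -/

lemma exists_equiv_of_injective {E : Type*} [NormedAddCommGroup E] [NormedSpace ℂ E]
    [CompleteSpace E] {A G : E →L[ℂ] E} {L : E ≃L[ℂ] E} [FiniteDimensional ℂ G.toLinearMap.range]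
    (hA : A = (L : E →L[ℂ] E) - G) (hinj : ∀ x, A x = 0 → x = 0) :
    ∃ L' : E ≃L[ℂ] E, (L' : E →L[ℂ] E) = A := by
  obtain ⟨hF, hi⟩ := isFredholm_of_eq_sub L hA
  have hker : A.toLinearMap.ker = ⊥ := LinearMap.ker_eq_bot'.2 hinj
  have hfin : FiniteDimensional ℂ (E ⧸ A.toLinearMap.range) := hF.finite_coker
  rw [LinearMap.index_of_injective (LinearMap.ker_eq_bot.1 hker), neg_eq_zero, Nat.cast_eq_zero]
    at hi
  have hsub := Module.finrank_zero_iff.1 hi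
  have hr := Submodule.Quotient.subsingleton_iff.1 hsub
  exact ⟨ContinuousLinearEquiv.ofBijective A hker hr, ContinuousLinearEquiv.coe_ofBijective _ _ _⟩

/-- Young's inequality for a^{3/2} n^{1/2}, by cases: either √(an) ≤ δ a, or both δ² a and δ √(an)
are at most n. -/
lemma mul_sqrt_mul_le {a n δ : ℝ} (ha : 0 ≤ a) (hn : 0 ≤ n) (hδ : 0 < δ) :
    a * Real.sqrt (a * n) ≤ δ * a ^ 2 + n ^ 2 / δ ^ 3 := by
  set s := Real.sqrt (a * n) with hs
  have hs0 : 0 ≤ s := Real.sqrt_nonneg _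
  have hs2 : s ^ 2 = a * n := Real.sq_sqrt (mul_nonneg ha hn)
  rcases le_total s (δ * a) with h | h
  · have h1 : 0 ≤ n ^ 2 / δ ^ 3 := by positivity
    nlinarith
  · have h1 : δ * (δ * a) ≤ n := by
      rcases ha.eq_or_lt with h0 | h0
      · rw [← h0]; simpa using hn
      · refine le_of_mul_le_mul_left ?_ h0
        rw [← hs2]
        nlinarith [mul_nonneg hδ.le ha]
    have h2 : δ * s ≤ n := by
      refine abs_le_of_sq_le_sq' ?_ hn |>.2
      rw [mul_pow, hs2]
      nlinarith
    have h3 : a * s ≤ n ^ 2 / δ ^ 3 := by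
      rw [le_div_iff₀ (by positivity)]
      calc a * s * δ ^ 3 = (δ * (δ * a)) * (δ * s) := by ring
        _ ≤ n * n := mul_le_mul h1 h2 (by positivity) hn
        _ = n ^ 2 := by ring
    nlinarith [mul_nonneg hδ.le (sq_nonneg a)]

section Coercive

variable {ι : Type*}

/-- The orthogonal projection onto the span of finitely many unit vectors. -/
def finProj (s : Finset ι) : lp (fun _ : ι => ℂ) 2 →L[ℂ] lp (fun _ : ι => ℂ) 2 :=
  ∑ i ∈ s, (innerSL ℂ (unitVec i)).smulRight (unitVec i)

lemma finProj_apply (s : Finset ι) (x : lp (fun _ : ι => ℂ) 2) :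
    finProj s x = ∑ i ∈ s, x i • unitVec i := by
  simp [finProj, inner_unitVec]

lemma inner_finProj (s : Finset ι) (x : lp (fun _ : ι => ℂ) 2) :
    inner ℂ x (finProj s x) = ((∑ i ∈ s, ‖x i‖ ^ 2 : ℝ) : ℂ) := by
  rw [finProj_apply, inner_sum, Complex.ofReal_sum]
  refine Finset.sum_congr rfl fun i _ => ?_
  rw [inner_smul_right, ← inner_conj_symm, inner_unitVec, Complex.mul_conj']
  push_cast; rfl

instance finiteDimensional_range_smul_finProj (σ : ℂ) (s : Finset ι) :
    FiniteDimensional ℂ (σ • finProj s).toLinearMap.range := by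
  classical
  have := FiniteDimensional.span_finset ℂ (s.image (unitVec : ι → lp (fun _ : ι => ℂ) 2))
  refine Submodule.finiteDimensional_of_le
    (S₂ := Submodule.span ℂ (s.image (unitVec : ι → lp (fun _ : ι => ℂ) 2))) ?_
  rintro _ ⟨x, rfl⟩
  change σ • finProj s x ∈ _
  rw [finProj_apply]
  refine Submodule.smul_mem _ _ (Submodule.sum_mem _ fun i hi => Submodule.smul_mem _ _ ?_)
  exact Submodule.subset_span (Finset.mem_coe.2 (Finset.mem_image_of_mem _ hi))

/-- An operator that is coercive up to a relatively compact form is an isomorphism up to an operator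
of finite rank. -/
lemma exists_equiv_sub_finProj {A M : lp (fun _ : ι => ℂ) 2 →L[ℂ] lp (fun _ : ι => ℂ) 2}
    {r γ K C : ℝ} (hr : 0 < r) (hγ : 0 < γ) (hK : 0 ≤ K) (hM : ∀ x, 0 ≤ (inner ℂ x (M x)).re)
    (hcpt : ∀ ε, 0 < ε → ∃ s : Finset ι, ∀ x,
      (inner ℂ x (M x)).re ≤ ε * ‖x‖ ^ 2 + C * ∑ i ∈ s, ‖x i‖ ^ 2)
    (hA : ∀ x, |(inner ℂ x (A x)).re - γ * ‖x‖ ^ 2| ≤ K * (r * ‖x‖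
      * Real.sqrt (r * ‖x‖ * Real.sqrt (inner ℂ x (M x)).re))) :
    ∃ (L : lp (fun _ : ι => ℂ) 2 ≃L[ℂ] lp (fun _ : ι => ℂ) 2) (σ : ℂ) (s : Finset ι),
      A = (L : lp (fun _ : ι => ℂ) 2 →L[ℂ] lp (fun _ : ι => ℂ) 2) - σ • finProj s := by
  -- This δ, and the ε = γδ³/(4(K + 1)) of the next line, make each of the two error terms at most
  -- γ/4 ‖x‖², so that half of γ‖x‖² survives. The summand 1 in K + 1 covers K = 0.
  set δ := γ / (4 * r ^ 2 * (K + 1)) with hδ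
  have hδ0 : 0 < δ := by positivity
  obtain ⟨s, hs⟩ := hcpt (γ * δ ^ 3 / (4 * (K + 1))) (by positivity)
  set σ := K / δ ^ 3 * C with hσ
  obtain ⟨L, hL⟩ := exists_equiv_of_coercive (A + (σ : ℂ) • finProj s) (half_pos hγ) fun x => by
    have h1 := (abs_le.1 (hA x)).1
    have h2 := mul_sqrt_mul_le (mul_nonneg hr.le (norm_nonneg x)) (Real.sqrt_nonneg
      (inner ℂ x (M x)).re) hδ0
    rw [Real.sq_sqrt (hM x)] at h2
    have h3 : (inner ℂ x ((A + (σ : ℂ) • finProj s) x)).re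
        = (inner ℂ x (A x)).re + σ * ∑ i ∈ s, ‖x i‖ ^ 2 := by
      rw [add_apply, smul_apply, inner_add_right,
        inner_smul_right, inner_finProj, ← Complex.ofReal_mul, Complex.add_re, Complex.ofReal_re]
    rw [h3]
    have h4 := mul_le_mul_of_nonneg_left h2 hK
    have h5 := mul_le_mul_of_nonneg_left (hs x) (show 0 ≤ K / δ ^ 3 by positivity)
    have h6 : K / δ ^ 3 * (γ * δ ^ 3 / (4 * (K + 1)) * ‖x‖ ^ 2) ≤ γ / 4 * ‖x‖ ^ 2 := by
      rw [← mul_assoc]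
      refine mul_le_mul_of_nonneg_right ?_ (sq_nonneg _)
      rw [show K / δ ^ 3 * (γ * δ ^ 3 / (4 * (K + 1))) = γ / 4 * (K / (K + 1)) by field_simp]
      exact mul_le_of_le_one_right (by positivity) ((div_le_one (by positivity)).2 (by linarith))
    have h7 : K * (δ * (r * ‖x‖) ^ 2) ≤ γ / 4 * ‖x‖ ^ 2 := by
      rw [show K * (δ * (r * ‖x‖) ^ 2) = γ / 4 * (K / (K + 1)) * ‖x‖ ^ 2 by
        rw [hδ]; field_simp]
      refine mul_le_mul_of_nonneg_right ?_ (sq_nonneg _)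
      exact mul_le_of_le_one_right (by positivity) ((div_le_one (by positivity)).2 (by linarith))
    have h8 : K * ((inner ℂ x (M x)).re / δ ^ 3) = K / δ ^ 3 * (inner ℂ x (M x)).re := by ring
    rw [mul_add] at h4 h5
    rw [h8] at h4
    have h9 : K / δ ^ 3 * (C * ∑ i ∈ s, ‖x i‖ ^ 2) = σ * ∑ i ∈ s, ‖x i‖ ^ 2 := by
      rw [hσ]; ring
    linarith
  exact ⟨L, σ, s, by rw [hL]; abel⟩

end Coercive

/-- The frequency bound that a nontrivial kernel entails. -/
lemma abs_mul_pow_le_of_form_bounds {a n r γ ω K K' : ℝ} (ha : 0 < a) (hn : 0 ≤ n) (hr : 0 < r)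
    (hγ : 0 < γ) (hK : 0 ≤ K) (hK' : 0 ≤ K') (h1 : γ * a ^ 2 ≤ K * r ^ 2 * (a * Real.sqrt (a * n)))
    (h2 : |ω| * n ^ 2 ≤ K' * (a * Real.sqrt (a * n))) : |ω| * γ ^ 3 ≤ r ^ 6 * (K' * K ^ 3) := by
  set s := Real.sqrt (a * n) with hs
  have hs0 : 0 ≤ s := Real.sqrt_nonneg _
  have hs2 : s ^ 2 = a * n := Real.sq_sqrt (mul_nonneg ha.le hn)
  set κ := K * r ^ 2 with hκ
  have hκ0 : 0 ≤ κ := by positivity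
  -- The first bound is used three times: it gives γ² a ≤ κ² n, then γ s ≤ κ n, and their product
  -- bounds γ³ a s by κ³ n². In the second bound n² then cancels.
  have h3 : γ * a ≤ κ * s := le_of_mul_le_mul_left (by linarith) ha
  have h4 : γ ^ 2 * a ≤ κ ^ 2 * n := by
    refine le_of_mul_le_mul_left ?_ ha
    calc a * (γ ^ 2 * a) = (γ * a) ^ 2 := by ring
      _ ≤ (κ * s) ^ 2 := by gcongr
      _ = a * (κ ^ 2 * n) := by rw [mul_pow, hs2]; ring
  have h5 : γ * s ≤ κ * n := by
    refine abs_le_of_sq_le_sq' ?_ (by positivity) |>.2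
    calc (γ * s) ^ 2 = γ ^ 2 * a * n := by rw [mul_pow, hs2]; ring
      _ ≤ κ ^ 2 * n * n := by gcongr
      _ = (κ * n) ^ 2 := by ring
  have hn0 : 0 < n := by
    refine hn.lt_of_ne fun h => ?_
    rw [← h] at h4
    have : 0 < γ ^ 2 * a := by positivity
    linarith
  have h6 : |ω| * γ ^ 3 * n ^ 2 ≤ K' * κ ^ 3 * n ^ 2 := by
    calc |ω| * γ ^ 3 * n ^ 2 = γ ^ 3 * (|ω| * n ^ 2) := by ring
      _ ≤ γ ^ 3 * (K' * (a * s)) := by gcongr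
      _ = K' * ((γ ^ 2 * a) * (γ * s)) := by ring
      _ ≤ K' * ((κ ^ 2 * n) * (κ * n)) := by gcongr
      _ = _ := by ring
  have h7 := le_of_mul_le_mul_right h6 (by positivity)
  rw [hκ] at h7
  linarith [show K' * (K * r ^ 2) ^ 3 = r ^ 6 * (K' * K ^ 3) by ring]

/-! ### The Riesz isomorphism onto the conjugate-linear dual -/

/-- A Hilbert space is isomorphic to the conjugate-linear dual of any isometric copy. -/
lemma exists_rieszEquiv {X E : Type*} [SeminormedAddCommGroup X] [NormedSpace ℂ X]
    [NormedAddCommGroup E] [InnerProductSpace ℂ E] [CompleteSpace E] (J : X ≃ₗᵢ[ℂ] E) :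
    ∃ D : E ≃L[ℂ] (X →SL[starRingEnd ℂ] ℂ), ∀ x ψ, D x ψ = inner ℂ (J ψ) x := by
  let D₀ : E →ₗ[ℂ] (X →SL[starRingEnd ℂ] ℂ) :=
    { toFun := fun x => (innerSLFlip ℂ x).comp (J.toContinuousLinearEquiv : X →L[ℂ] E)
      map_add' := fun x y => by ext ψ; simp
      map_smul' := fun a x => by ext ψ; simp }
  have hD₀ : ∀ x ψ, D₀ x ψ = inner ℂ (J ψ) x := fun x ψ => rfl
  let D₁ : E →ₗᵢ[ℂ] (X →SL[starRingEnd ℂ] ℂ) := ⟨D₀, fun x => by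
    refine le_antisymm (ContinuousLinearMap.opNorm_le_bound _ (norm_nonneg _) fun ψ => ?_) ?_
    · rw [hD₀, mul_comm, ← J.norm_map]
      exact norm_inner_le_norm _ _
    · rcases (norm_nonneg x).eq_or_lt with hx | hx
      · rw [← hx]; exact norm_nonneg _
      · have h := (D₀ x).le_opNorm (J.symm x)
        rw [hD₀, J.apply_symm_apply, J.symm.norm_map, inner_self_eq_norm_sq_to_K] at h
        refine le_of_mul_le_mul_right ?_ hx
        simpa [pow_two] using h⟩
  have hsurj : Function.Surjective D₁ := by
    intro F
    -- Conjugating the values turns the conjugate-linear functional into a linear one, to which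
    -- Riesz representation applies.
    let ℓ : E →L[ℂ] ℂ := ((starL ℂ : ℂ ≃L⋆[ℂ] ℂ) : ℂ →L⋆[ℂ] ℂ).comp
      (F.comp (J.symm.toContinuousLinearEquiv : E →L[ℂ] X))
    refine ⟨(InnerProductSpace.toDual ℂ E).symm ℓ, ?_⟩
    ext ψ
    change D₀ _ ψ = F ψ
    rw [hD₀, ← inner_conj_symm, InnerProductSpace.toDual_symm_apply]
    simp [ℓ]
  exact ⟨(LinearIsometryEquiv.ofSurjective D₁ hsurj).toContinuousLinearEquiv, hD₀⟩

/-! ### The form of the operator in normalized coordinates -/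

/-- The entries of the pairing with respect to the orthonormal basis of `H²_⋄`. -/
def normalizedEntry (r γ ω : ℝ) (β Ω : ℝ → ℝ) (i j : PosIndex) : ℂ :=
  pairingEntry r γ ω β Ω i j / (r * eigenvalue r i.1 * (r * eigenvalue r j.1))

/-- The entries of the form `‖(-Δ_h)^{1/2} Ψ‖²` with respect to the orthonormal basis of `H²_⋄`. -/
def energyEntry (r : ℝ) (i j : PosIndex) : ℂ := if i = j then ((eigenvalue r i.1)⁻¹ : ℝ) else 0

lemma finForm_energyEntry (r : ℝ) (y : PosIndex →₀ ℂ) :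
    finForm (energyEntry r) y y
      = ((∑ i ∈ y.support, (eigenvalue r i.1)⁻¹ * ‖y i‖ ^ 2 : ℝ) : ℂ) := by
  rw [finForm_eq_sum, Complex.ofReal_sum]
  refine Finset.sum_congr rfl fun i hi => ?_
  simp only [energyEntry, mul_ite, mul_zero, Finset.sum_ite_eq, if_pos hi]
  rw [Complex.mul_conj']
  push_cast; ring

section Fixed

variable {r : ℝ} (hr : 0 < r)
include hr

lemma inv_eigenvalue_le (i : PosIndex) : (eigenvalue r i.1)⁻¹ ≤ r ^ 2 / 2 := by
  rw [← inv_div]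
  exact inv_anti₀ (by positivity) (two_div_le_eigenvalue hr i)

lemma lapNorm_normalized (y : PosIndex →₀ ℂ) :
    lapNorm y.support (fun i => y i / (r * eigenvalue r i.1)) = r * ‖finEmb y‖ := by
  refine (sq_eq_sq₀ (lapNorm_nonneg _ _) (by positivity)).1 ?_
  rw [lapNorm_sq, mul_pow, norm_sq_finEmb, Finset.mul_sum]
  refine Finset.sum_congr rfl fun i _ => ?_
  have h1 := eigenvalue_pos hr i
  have h2 : unitEigenvalue i.1 = r ^ 2 * eigenvalue r i.1 := by
    rw [eigenvalue_eq]; field_simp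
  rw [norm_div, h2, ← Complex.ofReal_mul, Complex.norm_real, Real.norm_of_nonneg (by positivity)]
  field_simp

lemma energyNorm_normalized (y : PosIndex →₀ ℂ) :
    energyNorm y.support (fun i => y i / (r * eigenvalue r i.1))
      = Real.sqrt (∑ i ∈ y.support, (eigenvalue r i.1)⁻¹ * ‖y i‖ ^ 2) := by
  rw [energyNorm]
  congr 1
  refine Finset.sum_congr rfl fun i _ => ?_
  have h1 := eigenvalue_pos hr i
  have h2 : unitEigenvalue i.1 = r ^ 2 * eigenvalue r i.1 := by
    rw [eigenvalue_eq]; field_simp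
  rw [norm_div, h2, ← Complex.ofReal_mul, Complex.norm_real, Real.norm_of_nonneg (by positivity)]
  field_simp

/-- The normalization makes the viscous term exactly γ times the squared norm and the frequency term
-iω times the compact energy form; only the β- and α-terms remain to be estimated. -/
lemma finForm_normalizedEntry (γ ω : ℝ) (β Ω : ℝ → ℝ) (y : PosIndex →₀ ℂ) :
    finForm (normalizedEntry r γ ω β Ω) y y
      = ((γ * ‖finEmb y‖ ^ 2 : ℝ) : ℂ)
        - Complex.I * ((ω * ∑ i ∈ y.support, (eigenvalue r i.1)⁻¹ * ‖y i‖ ^ 2 : ℝ) : ℂ)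
        + skewForm β Ω y.support (fun i => y i / (r * eigenvalue r i.1)) := by
  have h : ∀ i ∈ y.support, ∀ j ∈ y.support,
      y i * starRingEnd ℂ (y j) * normalizedEntry r γ ω β Ω i j
        = (if i = j then ((γ * ‖y i‖ ^ 2 : ℝ) : ℂ)
            - Complex.I * ((ω * ((eigenvalue r i.1)⁻¹ * ‖y i‖ ^ 2) : ℝ) : ℂ) else 0)
          + y i / (r * eigenvalue r i.1) * starRingEnd ℂ (y j / (r * eigenvalue r j.1))
            * skewEntry β Ω i j := by
    intro i _ j _
    have hi : (eigenvalue r i.1 : ℂ) ≠ 0 := Complex.ofReal_ne_zero.2 (eigenvalue_pos hr i).ne'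
    have hj : (eigenvalue r j.1 : ℂ) ≠ 0 := Complex.ofReal_ne_zero.2 (eigenvalue_pos hr j).ne'
    have hr' : (r : ℂ) ≠ 0 := Complex.ofReal_ne_zero.2 hr.ne'
    have h2 : (unitEigenvalue i.1 : ℂ) = r ^ 2 * eigenvalue r i.1 := by
      rw [eigenvalue_eq]; push_cast; field_simp
    rw [normalizedEntry, pairingEntry, h2, map_div₀, map_mul, Complex.conj_ofReal,
      Complex.conj_ofReal, add_div, mul_add]
    congr 1
    · split_ifs with hij
      · subst hij
        rw [Complex.mul_conj']
        push_cast
        field_simp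
      · simp
    · field_simp
  rw [finForm_eq_sum, Finset.sum_congr rfl fun i hi => Finset.sum_congr rfl (h i hi)]
  simp_rw [Finset.sum_add_distrib, Finset.sum_ite_eq]
  rw [skewForm]
  congr 1
  rw [norm_sq_finEmb, Finset.mul_sum, Finset.mul_sum, Complex.ofReal_sum, Complex.ofReal_sum,
    Finset.mul_sum, ← Finset.sum_sub_distrib]
  exact Finset.sum_congr rfl fun i hi => by rw [if_pos hi]

lemma finForm_eq_inertialPairing (γ ω Ωref : ℝ) {Ω : ℝ → ℝ} (hΩ : MemSobolev r 1 (zonal Ω))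
    {c d y z : PosIndex →₀ ℂ} (hy : ∀ i, y i = r * eigenvalue r i.1 * c i)
    (hz : ∀ i, z i = r * eigenvalue r i.1 * d i) :
    finForm (normalizedEntry r γ ω (fun θ => Ω θ - Ωref) Ω) y z
      = inertialPairing r γ ω Ωref Ω (harmonicSum c) (harmonicSum d) := by
  have hr' : (r : ℂ) ≠ 0 := Complex.ofReal_ne_zero.2 hr.ne'
  have hne : ∀ i : PosIndex, (eigenvalue r i.1 : ℂ) ≠ 0 := fun i =>
    Complex.ofReal_ne_zero.2 (eigenvalue_pos hr i).ne'
  have hs : ∀ {c y : PosIndex →₀ ℂ}, (∀ i, y i = r * eigenvalue r i.1 * c i) →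
      y.support = c.support := by
    intro c y h
    ext i
    simp [h i, hr', hne i]
  rw [harmonicSum_eq_finiteSum, harmonicSum_eq_finiteSum, inertialPairing_finiteSum hr γ ω Ωref hΩ,
    finForm_eq_sum, hs hy, hs hz]
  refine Finset.sum_congr rfl fun i _ => Finset.sum_congr rfl fun j _ => ?_
  rw [hy, hz, normalizedEntry, map_mul, map_mul, Complex.conj_ofReal, Complex.conj_ofReal]
  have := hne i
  have := hne j
  field_simp

/-- A bound on the eigenvalue bounds l, and |m| ≤ l bounds m. This is the compactness behind the
Fredholm property. -/
lemma finite_eigenvalue_le (b : ℝ) : {i : PosIndex | eigenvalue r i.1 ≤ b}.Finite := by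
  obtain ⟨N, hN⟩ := exists_nat_gt (r ^ 2 * b)
  have hfin : (Set.Iic N ×ˢ Set.Icc (-(N : ℤ)) N).Finite := (Set.finite_Iic N).prod
    (Set.finite_Icc _ _)
  refine (hfin.preimage (f := fun i : PosIndex => i.1.1)
    (fun i _ j _ h => Subtype.ext (Subtype.ext h))).subset fun i hi => ?_
  have h1 : (i.1.1.1 : ℝ) * (i.1.1.1 + 1) ≤ r ^ 2 * b := by
    have : eigenvalue r i.1 ≤ b := hi
    rw [eigenvalue, div_le_iff₀ (by positivity)] at this
    linarith
  have h2 : (i.1.1.1 : ℝ) ≤ N := by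
    have : (0 : ℝ) ≤ i.1.1.1 := Nat.cast_nonneg _
    nlinarith
  have h3 : i.1.1.1 ≤ N := by exact_mod_cast h2
  have h4 := i.1.2
  refine ⟨h3, ?_, ?_⟩ <;> simp only [] <;> omega

/-- The form `‖(-Δ_h)^{1/2} Ψ‖²` is compact on `H²_⋄`. -/
lemma exists_energyOperator : ∃ M : CoeffSpace →L[ℂ] CoeffSpace,
    (∀ y : PosIndex →₀ ℂ, (inner ℂ (finEmb y) (M (finEmb y))).re
      = ∑ i ∈ y.support, (eigenvalue r i.1)⁻¹ * ‖y i‖ ^ 2) ∧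
    (∀ x, 0 ≤ (inner ℂ x (M x)).re) ∧
    (∀ ε, 0 < ε → ∃ s : Finset PosIndex, ∀ x,
      (inner ℂ x (M x)).re ≤ ε * ‖x‖ ^ 2 + r ^ 2 / 2 * ∑ i ∈ s, ‖x i‖ ^ 2) := by
  have hpos : ∀ y : PosIndex →₀ ℂ, 0 ≤ ∑ i ∈ y.support, (eigenvalue r i.1)⁻¹ * ‖y i‖ ^ 2 := fun y =>
    Finset.sum_nonneg fun i _ => mul_nonneg (inv_nonneg.2 (eigenvalue_nonneg r _)) (sq_nonneg _)
  obtain ⟨M, hM⟩ := exists_operator (energyEntry r) (K := r ^ 2 / 2) fun y => by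
    rw [finForm_energyEntry, Complex.norm_real, Real.norm_of_nonneg (hpos y), norm_sq_finEmb,
      Finset.mul_sum]
    exact Finset.sum_le_sum fun i _ =>
      mul_le_mul_of_nonneg_right (inv_eigenvalue_le hr i) (sq_nonneg _)
  have hM' : ∀ y : PosIndex →₀ ℂ, (inner ℂ (finEmb y) (M (finEmb y))).re
      = ∑ i ∈ y.support, (eigenvalue r i.1)⁻¹ * ‖y i‖ ^ 2 := fun y => by
    rw [hM, finForm_energyEntry, Complex.ofReal_re]
  have hcont : Continuous fun x : CoeffSpace => (inner ℂ x (M x)).re :=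
    Complex.continuous_re.comp (continuous_id.inner M.continuous)
  refine ⟨M, hM', fun x => ?_, fun ε hε => ?_⟩
  · refine isClosed_property denseRange_finEmb (isClosed_le continuous_const hcont) (fun y => ?_) x
    rw [hM']
    exact hpos y
  -- Outside these finitely many modes the weight 1/λ is below ε; on them it is at most r²/2.
  · set s := (finite_eigenvalue_le hr ε⁻¹).toFinset with hs
    refine ⟨s, fun x => ?_⟩
    have hc : ∀ i : PosIndex, Continuous fun x : CoeffSpace => x i := fun i => by
      simp_rw [← inner_unitVec]
      exact continuous_const.inner continuous_id
    have hcont' : Continuous fun x : CoeffSpace => ε * ‖x‖ ^ 2 + r ^ 2 / 2 * ∑ i ∈ s, ‖x i‖ ^ 2 :=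
      (continuous_const.mul (continuous_norm.pow 2)).add
        (continuous_const.mul (continuous_finsetSum _ fun i _ => ((hc i).norm.pow 2)))
    refine isClosed_property denseRange_finEmb (isClosed_le hcont hcont') (fun y => ?_) x
    rw [hM', norm_sq_finEmb, Finset.mul_sum]
    simp_rw [finEmb_apply]
    have h1 : ∀ i ∈ y.support, (eigenvalue r i.1)⁻¹ * ‖y i‖ ^ 2
        ≤ ε * ‖y i‖ ^ 2 + if i ∈ s then r ^ 2 / 2 * ‖y i‖ ^ 2 else 0 := by
      intro i _
      split_ifs with hi
      · nlinarith [mul_le_mul_of_nonneg_right (inv_eigenvalue_le hr i) (sq_nonneg ‖y i‖),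
          mul_nonneg hε.le (sq_nonneg ‖y i‖)]
      · rw [add_zero]
        refine mul_le_mul_of_nonneg_right ?_ (sq_nonneg _)
        rw [hs, Set.Finite.mem_toFinset, Set.mem_ofPred_eq, not_le] at hi
        exact (inv_le_comm₀ (eigenvalue_pos hr i) hε).2 hi.le
    refine (Finset.sum_le_sum h1).trans ?_
    rw [Finset.sum_add_distrib, ← Finset.sum_filter]
    refine add_le_add le_rfl ?_
    rw [Finset.mul_sum]
    refine Finset.sum_le_sum_of_subset_of_nonneg (fun i hi => (Finset.mem_filter.1 hi).2)
      fun i _ _ => by positivity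

end Fixed

/-! ### The operator in normalized coordinates -/

section Fixed

variable {r : ℝ} (hr : 0 < r)
include hr

lemma abs_re_finForm_sub_le (γ ω Ωref : ℝ) {Ω : ℝ → ℝ} (hΩ : MemSobolev r 1 (zonal Ω))
    (y : PosIndex →₀ ℂ) :
    |(finForm (normalizedEntry r γ ω (fun θ => Ω θ - Ωref) Ω) y y).re - γ * ‖finEmb y‖ ^ 2|
      ≤ sinNorm (fun θ => Ω θ - Ωref) / Real.sqrt 2 * (r * ‖finEmb y‖ * Real.sqrt (r * ‖finEmb y‖
        * Real.sqrt (∑ i ∈ y.support, (eigenvalue r i.1)⁻¹ * ‖y i‖ ^ 2))) := by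
  have hβ := hΩ.zonal_sub_const hr Ωref
  have h := abs_re_skewForm_le (Ω := Ω) (aestronglyMeasurable_of_zonal hr hβ.1.1)
    (integrableOn_sq_mul_sin_of_zonal hr hβ.1) y.support (fun i => y i / (r * eigenvalue r i.1))
  rw [lapNorm_normalized hr, energyNorm_normalized hr] at h
  rw [finForm_normalizedEntry hr, Complex.add_re, Complex.sub_re, Complex.ofReal_re,
    Complex.I_mul_re, Complex.ofReal_im, neg_zero, sub_zero, add_sub_cancel_left]
  exact h

lemma abs_im_finForm_add_le (γ ω Ωref : ℝ) {Ω : ℝ → ℝ} (hΩ : MemSobolev r 1 (zonal Ω))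
    (y : PosIndex →₀ ℂ) :
    |(finForm (normalizedEntry r γ ω (fun θ => Ω θ - Ωref) Ω) y y).im
        + ω * ∑ i ∈ y.support, (eigenvalue r i.1)⁻¹ * ‖y i‖ ^ 2|
      ≤ (sinNorm (fun θ => Ω θ - Ωref) / Real.sqrt 2 + 12.1 * sinNorm Ω)
        * (r * ‖finEmb y‖ * Real.sqrt (r * ‖finEmb y‖
        * Real.sqrt (∑ i ∈ y.support, (eigenvalue r i.1)⁻¹ * ‖y i‖ ^ 2))) := by
  have hβ := hΩ.zonal_sub_const hr Ωref
  have h := abs_im_skewForm_le (aestronglyMeasurable_of_zonal hr hβ.1.1)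
    (integrableOn_sq_mul_sin_of_zonal hr hβ.1) (integrableOn_of_zonal hr hΩ)
    (integrableOn_sq_mul_sin_of_zonal hr hΩ.1) y.support (fun i => y i / (r * eigenvalue r i.1))
  rw [lapNorm_normalized hr, energyNorm_normalized hr] at h
  rw [finForm_normalizedEntry hr, Complex.add_im, Complex.sub_im, Complex.ofReal_im,
    Complex.I_mul_im, Complex.ofReal_re, zero_sub, neg_add_cancel_comm]
  exact h

lemma exists_inertialForm (γ ω Ωref : ℝ) {Ω : ℝ → ℝ} (hΩ : MemSobolev r 1 (zonal Ω)) :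
    ∃ A : CoeffSpace →L[ℂ] CoeffSpace, ∀ y z, inner ℂ (finEmb z) (A (finEmb y))
      = finForm (normalizedEntry r γ ω (fun θ => Ω θ - Ωref) Ω) y z := by
  set K := sinNorm (fun θ => Ω θ - Ωref) / Real.sqrt 2 with hK
  set K' := K + 12.1 * sinNorm Ω with hK'
  have hK0 : 0 ≤ K := div_nonneg (sinNorm_nonneg _) (Real.sqrt_nonneg _)
  have hK'0 : 0 ≤ K' := add_nonneg hK0 (mul_nonneg (by norm_num) (sinNorm_nonneg _))
  refine exists_operator _ (K := |γ| + |ω| * (r ^ 2 / 2) + (K + K') * r ^ 2) fun y => ?_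
  have h1 := abs_re_finForm_sub_le hr γ ω Ωref hΩ y
  have h2 := abs_im_finForm_add_le hr γ ω Ωref hΩ y
  set F := finForm (normalizedEntry r γ ω (fun θ => Ω θ - Ωref) Ω) y y
  set S := ∑ i ∈ y.support, (eigenvalue r i.1)⁻¹ * ‖y i‖ ^ 2 with hS
  have hS0 : 0 ≤ S := Finset.sum_nonneg fun i _ =>
    mul_nonneg (inv_nonneg.2 (eigenvalue_nonneg r _)) (sq_nonneg _)
  have hS1 : S ≤ r ^ 2 / 2 * ‖finEmb y‖ ^ 2 := by
    rw [norm_sq_finEmb, Finset.mul_sum]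
    exact Finset.sum_le_sum fun i _ =>
      mul_le_mul_of_nonneg_right (inv_eigenvalue_le hr i) (sq_nonneg _)
  have ha : 0 ≤ r * ‖finEmb y‖ := by positivity
  have h3 : Real.sqrt S ≤ r * ‖finEmb y‖ := by
    refine Real.sqrt_le_iff.2 ⟨ha, hS1.trans ?_⟩
    rw [mul_pow]
    nlinarith [mul_nonneg (sq_nonneg r) (sq_nonneg ‖finEmb y‖)]
  have h4 : r * ‖finEmb y‖ * Real.sqrt (r * ‖finEmb y‖ * Real.sqrt S)
      ≤ r ^ 2 * ‖finEmb y‖ ^ 2 := by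
    have : Real.sqrt (r * ‖finEmb y‖ * Real.sqrt S) ≤ r * ‖finEmb y‖ := by
      refine Real.sqrt_le_iff.2 ⟨ha, ?_⟩
      rw [pow_two]
      gcongr
    calc _ ≤ r * ‖finEmb y‖ * (r * ‖finEmb y‖) := by gcongr
      _ = _ := by ring
  have h5 : _ ≤ K * _ := h1.trans (mul_le_mul_of_nonneg_left h4 hK0)
  have h6 : |F.im + ω * S| ≤ K' * (r ^ 2 * ‖finEmb y‖ ^ 2) :=
    h2.trans (mul_le_mul_of_nonneg_left h4 hK'0)
  have h7 : |F.re| ≤ |γ| * ‖finEmb y‖ ^ 2 + K * (r ^ 2 * ‖finEmb y‖ ^ 2) := by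
    have := abs_add_le (F.re - γ * ‖finEmb y‖ ^ 2) (γ * ‖finEmb y‖ ^ 2)
    rw [sub_add_cancel, abs_mul γ, abs_of_nonneg (sq_nonneg ‖finEmb y‖)] at this
    linarith
  have h8 : |F.im| ≤ |ω| * (r ^ 2 / 2 * ‖finEmb y‖ ^ 2) + K' * (r ^ 2 * ‖finEmb y‖ ^ 2) := by
    have := abs_sub (F.im + ω * S) (ω * S)
    rw [add_sub_cancel_right, abs_mul ω, abs_of_nonneg hS0] at this
    have h9 := mul_le_mul_of_nonneg_left hS1 (abs_nonneg ω)
    linarith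
  have h9 := Complex.norm_le_abs_re_add_abs_im F
  calc ‖F‖ ≤ _ := h9.trans (add_le_add h7 h8)
    _ = _ := by ring

end Fixed

/-- The constant 2.6 is the one supplied by `exists_le_embeddingConst_mul`. After multiplication by
4 the claim reads b⁴ + 12.1√2 b³ o ≤ 2.6 (b² + 9o²)². -/
lemma form_const_le {b o : ℝ} (hb : 0 ≤ b) (ho : 0 ≤ o) :
    (b / Real.sqrt 2 + 12.1 * o) * (b / Real.sqrt 2) ^ 3 ≤ 2.6 / 4 * (b ^ 2 + 9 * o ^ 2) ^ 2 := by
  have h2 : Real.sqrt 2 ^ 2 = 2 := Real.sq_sqrt (by norm_num)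
  have h0 : 0 < Real.sqrt 2 := by positivity
  have h1 : Real.sqrt 2 ≤ 1.41422 := Real.sqrt_le_iff.2 ⟨by norm_num, by norm_num⟩
  have h3 : (b / Real.sqrt 2 + 12.1 * o) * (b / Real.sqrt 2) ^ 3
      = (b ^ 4 + 12.1 * Real.sqrt 2 * (o * b ^ 3)) / 4 := by
    have h4 : Real.sqrt 2 ^ 3 = 2 * Real.sqrt 2 := by rw [pow_succ, h2]
    have h5 : Real.sqrt 2 ^ 4 = 4 := by
      rw [show Real.sqrt 2 ^ 4 = (Real.sqrt 2 ^ 2) ^ 2 by ring, h2]; norm_num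
    have h6 : b / Real.sqrt 2 = Real.sqrt 2 * b / 2 := by
      rw [div_eq_div_iff h0.ne' two_ne_zero]; linear_combination (-b) * h2
    rw [h6]
    ring_nf
    rw [h4, h5]
    ring
  rw [h3]
  have h4 : 0 ≤ o * b ^ 3 := by positivity
  have h5 : 12.1 * Real.sqrt 2 * (o * b ^ 3) ≤ 17.1122 * (o * b ^ 3) := by
    refine mul_le_mul_of_nonneg_right ?_ h4
    linarith
  -- Here 1.6 = 2.6 - 1 and 46.8 = 2.6 · 18, while the o⁴ term is dropped. The quadratic form is
  -- positive because 17.1122² < 4 · 1.6 · 46.8; the number 5.3475625 is 17.1122/3.2.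
  have h6 : 0 ≤ b ^ 2 * (1.6 * b ^ 2 - 17.1122 * (b * o) + 46.8 * o ^ 2) := by
    refine mul_nonneg (sq_nonneg _) ?_
    nlinarith [sq_nonneg (b - 5.3475625 * o), sq_nonneg o]
  nlinarith [sq_nonneg (o ^ 2)]

/-- The embedding constants are replaced by the lower bounds L₁, L₂ and the H¹ norms by L² norms,
where 2πr² `sinNorm`² ≤ `sobolevNorm`². Both replacements only weaken the assumption, and the powers
of r then match. -/
lemma form_const_lt_of_frequency {r γ ω Ωref : ℝ} (hr : 0 < r) (hγ : 0 < γ) {Ω : ℝ → ℝ}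
    (hΩ : MemSobolev r 1 (zonal Ω))
    (h : ENNReal.ofReal (4 / γ ^ 3)
          * (embeddingConst r 1 6 * embeddingConst r (1 / 2) 3) ^ 4
          * ENNReal.ofReal ((sobolevNorm r 1 (zonal fun θ => Ω θ - Ωref) ^ 2
              + 9 * sobolevNorm r 1 (zonal Ω) ^ 2) ^ 2)
        < ENNReal.ofReal |ω|) :
    r ^ 6 * ((sinNorm (fun θ => Ω θ - Ωref) / Real.sqrt 2 + 12.1 * sinNorm Ω)
      * (sinNorm (fun θ => Ω θ - Ωref) / Real.sqrt 2) ^ 3) < |ω| * γ ^ 3 := by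
  obtain ⟨L₁, L₂, hL₁, hL₂, h1, h2, h3⟩ := exists_le_embeddingConst_mul hr
  have hX := sinNorm_sq_le_sobolevNorm_sq hr (hΩ.zonal_sub_const hr Ωref)
  have hY := sinNorm_sq_le_sobolevNorm_sq hr hΩ
  set b := sinNorm (fun θ => Ω θ - Ωref)
  set o := sinNorm Ω
  set S := sobolevNorm r 1 (zonal fun θ => Ω θ - Ωref) ^ 2 + 9 * sobolevNorm r 1 (zonal Ω) ^ 2
  have h4 : ENNReal.ofReal (4 / γ ^ 3 * (L₁ * L₂) ^ 4 * S ^ 2) < ENNReal.ofReal |ω| := by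
    refine lt_of_le_of_lt ?_ h
    rw [ENNReal.ofReal_mul (by positivity), ENNReal.ofReal_mul (by positivity),
      ENNReal.ofReal_pow (by positivity), ENNReal.ofReal_mul hL₁]
    gcongr
  rw [ENNReal.ofReal_lt_ofReal_iff_of_nonneg (by positivity)] at h4
  have h5 : 4 * (L₁ * L₂) ^ 4 * S ^ 2 < |ω| * γ ^ 3 := by
    have := mul_lt_mul_of_pos_right h4 (show 0 < γ ^ 3 by positivity)
    refine lt_of_eq_of_lt ?_ this
    field_simp
  refine lt_of_le_of_lt ?_ h5
  set Q := b ^ 2 + 9 * o ^ 2 with hQ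
  have hQ0 : 0 ≤ Q := by positivity
  have hS : 2 * Real.pi * r ^ 2 * Q ≤ S := by
    rw [hQ]; linarith
  have h6 := form_const_le (sinNorm_nonneg (fun θ => Ω θ - Ωref)) (sinNorm_nonneg Ω)
  calc _ ≤ r ^ 6 * (2.6 / 4 * Q ^ 2) := by gcongr
    _ = (2.6 * r ^ 2) * (r ^ 4 * Q ^ 2 / 4) := by ring
    _ ≤ (64 * Real.pi ^ 2 * (L₁ * L₂) ^ 4) * (r ^ 4 * Q ^ 2 / 4) := by gcongr
    _ = 4 * (L₁ * L₂) ^ 4 * (2 * Real.pi * r ^ 2 * Q) ^ 2 := by ring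
    _ ≤ 4 * (L₁ * L₂) ^ 4 * S ^ 2 := by gcongr

/-- The operator of the form in normalized coordinates: it is an isomorphism up to an operator of
finite rank, and injective at high frequencies. -/
lemma exists_normalizedOperator {r γ : ℝ} (hr : 0 < r) (hγ : 0 < γ) (ω Ωref : ℝ) {Ω : ℝ → ℝ}
    (hΩ : MemSobolev r 1 (zonal Ω)) :
    ∃ (A : CoeffSpace →L[ℂ] CoeffSpace) (L : CoeffSpace ≃L[ℂ] CoeffSpace) (σ : ℂ)
      (s : Finset PosIndex),
      (∀ y z, inner ℂ (finEmb z) (A (finEmb y))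
        = finForm (normalizedEntry r γ ω (fun θ => Ω θ - Ωref) Ω) y z) ∧
      A = (L : CoeffSpace →L[ℂ] CoeffSpace) - σ • finProj s ∧
      (r ^ 6 * ((sinNorm (fun θ => Ω θ - Ωref) / Real.sqrt 2 + 12.1 * sinNorm Ω)
        * (sinNorm (fun θ => Ω θ - Ωref) / Real.sqrt 2) ^ 3) < |ω| * γ ^ 3 →
        ∀ x, A x = 0 → x = 0) := by
  obtain ⟨A, hA⟩ := exists_inertialForm hr γ ω Ωref hΩ
  obtain ⟨M, hM, hM0, hMc⟩ := exists_energyOperator hr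
  set K := sinNorm (fun θ => Ω θ - Ωref) / Real.sqrt 2 with hK
  set K' := K + 12.1 * sinNorm Ω with hK'
  have hK0 : 0 ≤ K := div_nonneg (sinNorm_nonneg _) (Real.sqrt_nonneg _)
  have hK'0 : 0 ≤ K' := add_nonneg hK0 (mul_nonneg (by norm_num) (sinNorm_nonneg _))
  have hAc : Continuous fun x : CoeffSpace => (inner ℂ x (A x) : ℂ) :=
    continuous_id.inner A.continuous
  have hMcont : Continuous fun x : CoeffSpace => (inner ℂ x (M x)).re :=
    Complex.continuous_re.comp (continuous_id.inner M.continuous)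
  have hR : Continuous fun x : CoeffSpace =>
      r * ‖x‖ * Real.sqrt (r * ‖x‖ * Real.sqrt (inner ℂ x (M x)).re) :=
    (continuous_const.mul continuous_norm).mul ((continuous_const.mul continuous_norm).mul
      hMcont.sqrt).sqrt
  -- Both sides are continuous in x, so the bound extends from finitely supported sequences by
  -- density.
  have hRe : ∀ x : CoeffSpace, |(inner ℂ x (A x)).re - γ * ‖x‖ ^ 2| ≤ K * (r * ‖x‖
      * Real.sqrt (r * ‖x‖ * Real.sqrt (inner ℂ x (M x)).re)) := fun x => by
    refine denseRange_finEmb.induction_on x (isClosed_le ?_ ?_) fun y => ?_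
    · exact ((Complex.continuous_re.comp hAc).sub
        (continuous_const.mul (continuous_norm.pow 2))).abs
    · exact continuous_const.mul hR
    · rw [hA, hM]
      exact abs_re_finForm_sub_le hr γ ω Ωref hΩ y
  have hIm : ∀ x : CoeffSpace, |(inner ℂ x (A x)).im + ω * (inner ℂ x (M x)).re|
      ≤ K' * (r * ‖x‖ * Real.sqrt (r * ‖x‖ * Real.sqrt (inner ℂ x (M x)).re)) := fun x => by
    refine denseRange_finEmb.induction_on x (isClosed_le ?_ ?_) fun y => ?_
    · exact ((Complex.continuous_im.comp hAc).add (continuous_const.mul hMcont)).abs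
    · exact continuous_const.mul hR
    · rw [hA, hM]
      exact abs_im_finForm_add_le hr γ ω Ωref hΩ y
  obtain ⟨L, σ, s, hL⟩ := exists_equiv_sub_finProj hr hγ hK0 hM0 hMc hRe
  refine ⟨A, L, σ, s, hA, hL, fun hlt x hx => ?_⟩
  by_contra hne
  have hx0 : 0 < ‖x‖ := norm_pos_iff.2 hne
  have h1 := hRe x
  have h2 := hIm x
  -- For x in the kernel the form vanishes, and the two bounds become estimates of γ‖x‖² and of |ω|
  -- times the energy.
  rw [hx, inner_zero_right, Complex.zero_re, zero_sub, abs_neg,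
    abs_of_nonneg (by positivity)] at h1
  rw [hx, inner_zero_right, Complex.zero_im, zero_add, abs_mul, abs_of_nonneg (hM0 x),
    ← Real.sq_sqrt (hM0 x), Real.sqrt_sq (Real.sqrt_nonneg _)] at h2
  refine hlt.not_ge (abs_mul_pow_le_of_form_bounds (mul_pos hr hx0) (Real.sqrt_nonneg _) hr hγ hK0
    hK'0 ?_ h2)
  calc γ * (r * ‖x‖) ^ 2 = r ^ 2 * (γ * ‖x‖ ^ 2) := by ring
    _ ≤ r ^ 2 * _ := mul_le_mul_of_nonneg_left h1 (sq_nonneg r)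
    _ = _ := by ring

/-! ### The operator on `H²_⋄` -/

instance {r : ℝ} [hr : Fact (0 < r)] : T2Space (HDiamond r 2) :=
  T2Space.of_injective_continuous (coeffEquiv hr.out).injective (coeffEquiv hr.out).continuous

section Fixed

variable {r : ℝ} (hr : 0 < r)
include hr

lemma coeffEquiv_eq_of_ae_eq {Ψ : HDiamond r 2} {c : PosIndex →₀ ℂ}
    (h : Ψ.toFun =ᵐ[sphereMeasure r] harmonicSum c) (i : PosIndex) :
    coeffEquiv hr Ψ i = r * eigenvalue r i.1 * c i := by
  rw [coeffEquiv_apply, harmonicCoeff_congr r h, harmonicCoeff_harmonicSum hr, dif_pos i.2]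
  ring

lemma exists_finEmb_eq {Ψ : HDiamond r 2} {c : PosIndex →₀ ℂ}
    (h : Ψ.toFun =ᵐ[sphereMeasure r] harmonicSum c) :
    ∃ y : PosIndex →₀ ℂ, (∀ i, y i = r * eigenvalue r i.1 * c i) ∧ coeffEquiv hr Ψ = finEmb y := by
  refine ⟨Finsupp.onFinset c.support (fun i => r * eigenvalue r i.1 * c i) fun i hi => ?_,
    fun i => rfl, ?_⟩
  · exact Finsupp.mem_support_iff.2 (right_ne_zero_of_mul hi)
  · ext i
    rw [coeffEquiv_eq_of_ae_eq hr h, finEmb_apply]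
    rfl

lemma exists_ae_eq_harmonicSum (y : PosIndex →₀ ℂ) :
    ∃ c, ((coeffEquiv hr).symm (finEmb y)).toFun =ᵐ[sphereMeasure r] harmonicSum c := by
  set c : PosIndex →₀ ℂ := Finsupp.onFinset y.support (fun i => y i / (r * eigenvalue r i.1))
    fun i hi => Finsupp.mem_support_iff.2 (div_ne_zero_iff.1 hi).1 with hc
  obtain ⟨Ψ, hΨ⟩ := exists_hDiamond_eq hr 2 c
  have : (coeffEquiv hr).symm (finEmb y) = Ψ := by
    rw [LinearIsometryEquiv.symm_apply_eq]
    ext i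
    rw [coeffEquiv_eq_of_ae_eq hr hΨ, finEmb_apply, hc, Finsupp.onFinset_apply]
    have h1 : (eigenvalue r i.1 : ℂ) ≠ 0 := Complex.ofReal_ne_zero.2 (eigenvalue_pos hr i).ne'
    have h2 : (r : ℂ) ≠ 0 := Complex.ofReal_ne_zero.2 hr.ne'
    field_simp
  exact ⟨c, this ▸ hΨ⟩

/-- The bounded extension of the differential operator is unique. -/
lemma IsInertialOperator.unique {γ ω Ωref : ℝ} {Ω : ℝ → ℝ}
    {B B' : HDiamond r 2 →L[ℂ] HDiamondDual r 2} (hB : IsInertialOperator r γ ω Ωref Ω B)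
    (hB' : IsInertialOperator r γ ω Ωref Ω B') : B' = B := by
  have hd : DenseRange fun y : PosIndex →₀ ℂ => (coeffEquiv hr).symm (finEmb y) :=
    (coeffEquiv hr).symm.surjective.denseRange.comp denseRange_finEmb
      (coeffEquiv hr).symm.continuous
  refine DFunLike.coe_injective (hd.equalizer B'.continuous B.continuous (funext fun y => ?_))
  refine DFunLike.coe_injective (hd.equalizer (B' _).continuous (B _).continuous
    (funext fun z => ?_))
  obtain ⟨c, hc⟩ := exists_ae_eq_harmonicSum hr y
  obtain ⟨d, hd⟩ := exists_ae_eq_harmonicSum hr z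
  have hcs := mem_harmonicSpan_iff.2 ⟨c, rfl⟩
  have hds := mem_harmonicSpan_iff.2 ⟨d, rfl⟩
  simp only [Function.comp_apply]
  rw [hB' _ hcs _ hds _ _ hc hd, hB _ hcs _ hds _ _ hc hd]

end Fixed

end InertialWave

end

open InertialWave in
theorem theorem3p3 (r γ ω Ωref : ℝ) (hr : 0 < r) (hγ : 0 < γ)
    (Ω : ℝ → ℝ) (hΩ : MemSobolev r 1 (zonal Ω)) :
    ∃ B : HDiamond r 2 →L[ℂ] HDiamondDual r 2,
      IsInertialOperator r γ ω Ωref Ω B ∧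
      (∀ B', IsInertialOperator r γ ω Ωref Ω B' → B' = B) ∧
      B.IsFredholm ∧ B.toLinearMap.index = 0 ∧
      (ENNReal.ofReal (4 / γ ^ 3)
            * (embeddingConst r 1 6 * embeddingConst r (1 / 2) 3) ^ 4
            * ENNReal.ofReal ((sobolevNorm r 1 (zonal fun θ => Ω θ - Ωref) ^ 2
                + 9 * sobolevNorm r 1 (zonal Ω) ^ 2) ^ 2)
          < ENNReal.ofReal |ω| →
        B.IsInvertible) := by
  obtain ⟨A, L, σ, s, hA, hL, hinj⟩ := exists_normalizedOperator hr hγ ω Ωref hΩ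
  obtain ⟨D, hD⟩ := exists_rieszEquiv (coeffEquiv hr)
  set J : HDiamond r 2 ≃L[ℂ] CoeffSpace := (coeffEquiv hr).toContinuousLinearEquiv with hJ
  have : Fact (0 < r) := ⟨hr⟩
  set B : HDiamond r 2 →L[ℂ] HDiamondDual r 2 :=
    (D : CoeffSpace →L[ℂ] HDiamondDual r 2) ∘L A ∘L (J : HDiamond r 2 →L[ℂ] CoeffSpace) with hB
  have hBA : IsInertialOperator r γ ω Ωref Ω B := by
    intro f hf g hg Ψ ψ hΨ hψ
    obtain ⟨c, rfl⟩ := mem_harmonicSpan_iff.1 hf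
    obtain ⟨d, rfl⟩ := mem_harmonicSpan_iff.1 hg
    obtain ⟨y, hy, hJy⟩ := exists_finEmb_eq hr hΨ
    obtain ⟨z, hz, hJz⟩ := exists_finEmb_eq hr hψ
    change D (A (coeffEquiv hr Ψ)) ψ = _
    rw [hD, hJy, hJz, hA]
    exact finForm_eq_inertialPairing hr γ ω Ωref hΩ hy hz
  -- The decomposition of A into an isomorphism and a finite rank operator is transported through
  -- the coordinate isometry J and the Riesz isomorphism D.
  set G : HDiamond r 2 →L[ℂ] HDiamondDual r 2 := (D : CoeffSpace →L[ℂ] HDiamondDual r 2) ∘L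
    (σ • finProj s) ∘L (J : HDiamond r 2 →L[ℂ] CoeffSpace) with hG
  have hfin : FiniteDimensional ℂ G.toLinearMap.range := by
    refine Submodule.finiteDimensional_of_le
      (S₂ := (σ • finProj s).toLinearMap.range.map D.toLinearEquiv.toLinearMap) ?_
    rintro _ ⟨x, rfl⟩
    exact ⟨_, ⟨J x, rfl⟩, rfl⟩
  obtain ⟨hF, hi⟩ := isFredholm_of_eq_sub (B := B) (G := G) (J.trans (L.trans D)) (by
    ext x : 1
    change D (A (J x)) = D (L (J x)) - D ((σ • finProj s) (J x))
    rw [← map_sub, hL]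
    rfl)
  refine ⟨B, hBA, fun B' hB' => IsInertialOperator.unique hr hBA hB', hF, hi, fun hlt => ?_⟩
  obtain ⟨L', hL'⟩ := exists_equiv_of_injective hL
    (hinj (form_const_lt_of_frequency hr hγ hΩ hlt))
  exact ⟨J.trans (L'.trans D), by rw [hB, ← hL']; rfl⟩
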